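/- **Setting.** Let $\Phi=\{x_i\}\subset\mathbb R^2$ be a homogeneous Poisson point process of density $\lambda>0$ (base stations, BSs, all at height $h\ge 0$); the typical user is at the origin, and $r_x=\|x\|$. Let $m\ge 1$ be an integer, $\alpha_{\rm NLOS}\ge\alpha_{\rm LOS}>2$, and $p_{\rm LOS}:[0,\infty)\to[0,1]$ measurable. Given $\Phi$, independently for different BSs, the BS at $x$ is in line of sight (LOS) with probability $p_{\rm LOS}(r_x)$ and its power fading gain $g_x$ is then Gamma distributed with shape $m$ and scale $1/m$; otherwise it is in NLOS and $g_x$ is exponential with mean $1$. For $Q\in\{{\rm LOS},{\rm NLOS}\}$ put $\ell_Q(r,h)=(r^2+h^2)^{-\alpha_Q/2}$. If $x\in\Phi$ is the serving BS, the interference and the signal-to-interference ratio are $$I_x=\sum_{y\in\Phi\setminus\{x\}}g_y\,\ell_{Q_y}(r_y,h),\qquad \mathrm{SIR}_x=\frac{g_x\,\ell_{Q_x}(r_x,h)}{I_x},$$ where $Q_y$ is the propagation type of $y$. The serving BS is either the one closest to the origin ("closest association") or the one with the highest SIR ("strongest association"), and $\mathrm P_{\rm cov}(\theta)=\Pr[\mathrm{SIR}_x>\theta]$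 for the serving BS $x$. Set $$f_{r_x}(r)=\begin{cases}2\pi\lambda e^{-\pi\lambda r^2}r&\text{(closest)}\\2\pi\lambda r&\text{(strongest)}\end{cases}\qquad \nu(r)=\begin{cases}r&\text{(closest)}\\0&\text{(strongest)}\end{cases}$$ and, with the dependence on $r$ suppressed, $$\mathcal L_I^{\rm NLOS}(s)=\exp\Big(-2\pi\lambda\int_{\nu(r)}^\infty\Big(1-\frac1{1+s\ell_{\rm NLOS}(t,h)}\Big)t\,dt\Big),$$ $$\mathcal L_I(s)=\mathcal L_I^{\rm NLOS}(s)\exp\Big(-2\pi\lambda\int_{\nu(r)}^\infty p_{\rm LOS}(t)\Big(\frac1{1+s\ell_{\rm NLOS}(t,h)}-\frac1{(1+\frac sm\ell_{\rm LOS}(t,h))^m}\Big)t\,dt\Big).$$ **Theorem.** Almost surely $0<I_x<\infty$ for all $x\in\Phi$; for every $r>0$ the integrals in $\mathcal L_I$ converge absolutely for $s\ge0$, and $\mathcal L_I$ is $C^\infty$ on $(0,\infty)$. 1. *Coverage.* For closest association and every $\theta>0$, and for strongest association and every $\theta\ge 1$, $$\mathrm P_{\rm cov}(\theta)=\int_0^\infty\Big(p_{\rm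 LOS}(r)\sum_{k=0}^{m-1}\Big[\frac{(-s)^k}{k!}\frac{d^k}{ds^k}\mathcal L_I(s)\Big]_{s=m\theta/\ell_{\rm LOS}(r,h)}+(1-p_{\rm LOS}(r))\,\mathcal L_I\Big(\frac{\theta}{\ell_{\rm NLOS}(r,h)}\Big)\Big)f_{r_x}(r)\,dr .$$ For both associations the integral on the right converges absolutely for every $\theta>0$; for strongest association and every $\theta>0$ it equals the mean number $\mathbb E\,\#\{x\in\Phi:\mathrm{SIR}_x>\theta\}$ of BSs whose SIR exceeds $\theta$. 2. *Laplace transform of the interference.* $\mathcal L_I$ is the Laplace transform of the interference given that the serving BS is at distance $r$. That is, for every $s\ge 0$ and every Borel set $B\subset\mathbb R$, $$\mathbb E\big[e^{-sI_x}\mathbf 1\{r_x\in B\}\big]=\int_{B\cap(0,\infty)}\mathcal L_I(s)\,f_{r_x}(r)\,dr\qquad(x\text{ the closest BS})$$ for closest association and, for strongest association (where any BS can be the serving one and conditioning on a BS at distance $r$ is under the reduced Palm distribution), $$\mathbb E\sum_{x\in\Phi}e^{-sI_x}\mathbf 1\{r_x\in B\}=\int_{B\cap(0,\infty)}\mathcal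 L_I(s)\,f_{r_x}(r)\,dr .$$ -/

import Mathlib

open MeasureTheory ProbabilityTheory Set
open scoped ENNReal NNReal

noncomputable section

namespace CellularNetwork

/-- The Euclidean plane; the typical user sits at the origin. -/
abbrev Plane : Type := EuclideanSpace ℝ (Fin 2)

/-- The deterministic parameters of the network. -/
structure Params where
  /-- density of the base stations -/
  lam : ℝ
  /-- height of the base stations -/
  h : ℝ
  /-- LOS pathloss exponent -/
  αLOS : ℝ
  /-- NLOS pathloss exponent -/
  αNLOS : ℝ
  /-- Nakagami shape parameter of the LOS fading -/
  m : ℕ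
  /-- LOS probability as a function of the horizontal distance -/
  pLOS : ℝ → ℝ
  lam_pos : 0 < lam
  h_nonneg : 0 ≤ h
  two_lt_αLOS : 2 < αLOS
  αLOS_le_αNLOS : αLOS ≤ αNLOS
  one_le_m : 1 ≤ m
  measurable_pLOS : Measurable pLOS
  pLOS_mem : ∀ r, 0 ≤ r → pLOS r ∈ Icc (0 : ℝ) 1

/-- The association policy of the typical user. -/
inductive Association
  | closest
  | strongest

/-! ### Point processes -/

section PointProcess

variable {Ω : Type*} [MeasurableSpace Ω]

/-- Number of points of the sequence `X` in the set `B`, counted with multiplicity. -/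
def count (X : ℕ → Ω → Plane) (B : Set Plane) (ω : Ω) : ℕ∞ := {i : ℕ | X i ω ∈ B}.encard

/-- The points `X 0, X 1, …` form a homogeneous Poisson point process of density `lam` in the
plane: the numbers of points in finitely many pairwise disjoint bounded Borel sets are independent
Poisson variables, whose means are `lam` times the areas. -/
structure IsHomogeneousPPP (P : Measure Ω) (lam : ℝ) (X : ℕ → Ω → Plane) : Prop where
  measurable : ∀ i, Measurable (X i)
  counts : ∀ (k : ℕ) (B : Fin k → Set Plane), (∀ j, MeasurableSet (B j)) →
    (∀ j, Bornology.IsBounded (B j)) → Pairwise (fun i j => Disjoint (B i) (B j)) →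
    ∀ n : Fin k → ℕ,
      P {ω | ∀ j, count X (B j) ω = (n j : ℕ∞)} =
        ∏ j, poissonMeasure (Real.toNNReal (lam * volume.real (B j))) {n j}

/-- The marks `M i` are attached independently to the points `X i`, according to the laws `K`:
conditionally on the whole sequence of points, the marks are independent, and the mark of a point
located at `x` has law `K x`. -/
structure IsIndependentMarking {S : Type*} [MeasurableSpace S] (P : Measure Ω)
    (X : ℕ → Ω → Plane) (M : ℕ → Ω → S) (K : Plane → Measure S) : Prop where
  measurable : ∀ i, Measurable (M i)
  cond_law : ∀ (s : Finset ℕ) (A : ℕ → Set S), (∀ i, MeasurableSet (A i)) →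
    ∀ B : Set (ℕ → Plane), MeasurableSet B →
      P {ω | (fun i => X i ω) ∈ B ∧ ∀ i ∈ s, M i ω ∈ A i} =
        ∫⁻ ω in {ω | (fun i => X i ω) ∈ B}, ∏ i ∈ s, K (X i ω) (A i) ∂P

end PointProcess

namespace Params

variable (N : Params)

/-- LOS pathloss at horizontal distance `r`. -/
def ellLOS (r : ℝ) : ℝ := (r ^ 2 + N.h ^ 2) ^ (-(N.αLOS / 2))

/-- NLOS pathloss at horizontal distance `r`. -/
def ellNLOS (r : ℝ) : ℝ := (r ^ 2 + N.h ^ 2) ^ (-(N.αNLOS / 2))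

/-- Law of the mark (LOS indicator, power fading gain) of a base station at `x`: with probability
`pLOS ‖x‖` it is in LOS and its gain is Gamma with shape `m` and scale `1 / m` (rate `m`), and
otherwise it is in NLOS and its gain is exponential with mean `1`. -/
def markLaw (x : Plane) : Measure (Bool × ℝ) :=
  ENNReal.ofReal (N.pLOS ‖x‖) • (Measure.dirac true).prod (gammaMeasure N.m N.m) +
    ENNReal.ofReal (1 - N.pLOS ‖x‖) • (Measure.dirac false).prod (expMeasure 1)

section Network

variable {Ω : Type*}

/-- The marked Poisson process of base stations: locations `X i`, LOS indicators `L i` and power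
fading gains `g i`. -/
structure IsNetwork [MeasurableSpace Ω] (P : Measure Ω) (X : ℕ → Ω → Plane) (L : ℕ → Ω → Bool)
    (g : ℕ → Ω → ℝ) : Prop where
  ppp : IsHomogeneousPPP P N.lam X
  marks : IsIndependentMarking P X (fun i ω => (L i ω, g i ω)) N.markLaw

variable (X : ℕ → Ω → Plane) (L : ℕ → Ω → Bool) (g : ℕ → Ω → ℝ)

/-- Power received by the typical user from the base station `i`. -/
def rxPower (i : ℕ) (ω : Ω) : ℝ≥0∞ :=
  ENNReal.ofReal (g i ω * if L i ω then N.ellLOS ‖X i ω‖ else N.ellNLOS ‖X i ω‖)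

/-- Aggregate interference when the base station `i` is the serving one. -/
def interference (i : ℕ) (ω : Ω) : ℝ≥0∞ := ∑' j : {j : ℕ // j ≠ i}, N.rxPower X L g j ω

/-- Signal-to-interference ratio when the base station `i` is the serving one. -/
def sir (i : ℕ) (ω : Ω) : ℝ≥0∞ := N.rxPower X L g i ω / N.interference X L g i ω

/-- The base station `i` is a closest one to the typical user. -/
def IsClosest (X : ℕ → Ω → Plane) (i : ℕ) (ω : Ω) : Prop := ∀ j, ‖X i ω‖ ≤ ‖X j ω‖

/-- The base station `i` serves the typical user. -/
def IsServing (i : ℕ) (ω : Ω) : Association → Prop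
  | .closest => IsClosest X i ω
  | .strongest => ∀ j, N.sir X L g j ω ≤ N.sir X L g i ω

/-- Coverage probability: the serving base station offers an SIR larger than `θ`. -/
def coverage [MeasurableSpace Ω] (P : Measure Ω) (a : Association) (θ : ℝ) : ℝ :=
  P.real {ω | ∃ i, N.IsServing X L g i ω a ∧ ENNReal.ofReal θ < N.sir X L g i ω}

end Network

/-! ### The quantities of the coverage formula -/

/-- The function `f_{r_x}`. -/
def servingDensity : Association → ℝ → ℝ
  | .closest, r => 2 * Real.pi * N.lam * Real.exp (-(Real.pi * N.lam * r ^ 2)) * r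
  | .strongest, r => 2 * Real.pi * N.lam * r

/-- The function `ν`. -/
def nu : Association → ℝ → ℝ
  | .closest, r => r
  | .strongest, _ => 0

/-- Integrand in the exponent of `laplaceNLOS`. -/
def kernelNLOS (s t : ℝ) : ℝ := (1 - 1 / (1 + s * N.ellNLOS t)) * t

/-- Integrand in the exponent of the correction factor of `laplace`. -/
def kernelCorrection (s t : ℝ) : ℝ :=
  N.pLOS t * (1 / (1 + s * N.ellNLOS t) - 1 / (1 + s / N.m * N.ellLOS t) ^ N.m) * t

/-- The function `L_I^NLOS(s)`, with the serving distance `r` as a parameter. -/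
def laplaceNLOS (a : Association) (r s : ℝ) : ℝ :=
  Real.exp (-(2 * Real.pi * N.lam * ∫ t in Ioi (nu a r), N.kernelNLOS s t))

/-- The function `L_I(s)`, with the serving distance `r` as a parameter. -/
def laplace (a : Association) (r s : ℝ) : ℝ :=
  N.laplaceNLOS a r s *
    Real.exp (-(2 * Real.pi * N.lam * ∫ t in Ioi (nu a r), N.kernelCorrection s t))

/-- The LOS part of the coverage formula:
`∑_{k<m} [(-s)^k / k! · d^k/ds^k L_I(s)]` at `s = m θ / ℓ_LOS(r, h)`. -/
def coverageLOS (a : Association) (θ r : ℝ) : ℝ :=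
  ∑ k ∈ Finset.range N.m,
    (-(N.m * θ / N.ellLOS r)) ^ k / k.factorial *
      iteratedDeriv k (N.laplace a r) (N.m * θ / N.ellLOS r)

/-- The integrand of the coverage formula. -/
def coverageIntegrand (a : Association) (θ r : ℝ) : ℝ :=
  (N.pLOS r * N.coverageLOS a θ r +
      (1 - N.pLOS r) * N.laplace a r (θ / N.ellNLOS r)) * N.servingDensity a r

end Params

end CellularNetwork

end

/-!
The coverage formula and the Laplace transform of the interference are both means of sums over the
base stations, so everything rests on the Mecke formula for the Poisson process.

*Poisson process.* The process is given by the laws of its counts in disjoint bounded sets. For a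
step function with finitely many bounded cells, the mean of a product over the points, and the mean
of a sum over the points of a product over the other points, reduce to moments of independent
Poisson variables. Monotone limits extend this to all functions with values in `[0, 1]`:
`IsHomogeneousPPP.lintegral_infProd` (generating functional) and
`IsHomogeneousPPP.lintegral_tsum_infProd_fill` (Mecke formula). The latter lets the factors depend
on the distance `ρ` of the distinguished point `x`, by discarding all configurations that have a
point closer than `ρ(x)`. Taking `ρ(x) = ‖x‖` singles out the closest point, and `ρ(x) = 0` singles
out every point, so the two associations are treated together. The indicator that a base station is
a possible serving one is `Params.weight`.

*Laplace transforms.* The marks are integrated out with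
`IsIndependentMarking.lintegral_infProd`, and polar coordinates turn the integrals over the plane
into the ones in the definition of `laplace`. Consequently `laplace a r` is the Laplace transform of
the random variable `farPower (nu a r)`, the total power received from the base stations at
distance at least `nu a r` (`lintegral_expNeg_farPower`). This gives three facts. The total received
power is a.s. finite, from the limit `s → 0`. The function `laplace a r` is smooth on `(0, ∞)`,
being a reflected moment generating function. The sum of derivatives in the coverage formula is the
mean of the tail of a Gamma distribution with integer shape, evaluated at a multiple of
`farPower (nu a r)` (`sum_iteratedDeriv_laplace`).

*Coverage.* A finite measure on `[0, ∞]` is determined by its Laplace transform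
(`ext_of_lintegral_expNeg`). Hence the Campbell measure of the pair (location of a possible serving
base station, its interference) is a mixture of the laws of `farPower`
(`campbell_eq_palmMixture`), and means of arbitrary functionals of the serving distance and the
interference can be computed (`lintegral_tsum_weight_norm`). Integrating out the fading gain of the
serving base station, whose tail is a Gamma tail, shows that the integral of `coverageIntegrand` is
the mean number of possible serving base stations with SIR larger than `θ`
(`lintegral_tsum_weight_sir`).

It remains to see that this number is the indicator of coverage. For closest association, there is
a.s. exactly one closest base station: at least one since bounded sets contain finitely many
points, and the mean number is `1`. For strongest association and `θ ≥ 1`, a base station with SIR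
larger than `θ` receives more power than all the others together, so it is unique and has the
largest SIR. For every `θ > 0`, at most `(1 + θ) / θ` base stations have SIR larger than `θ`, which
yields the integrability of the coverage integrand.
-/

noncomputable section

namespace CellularNetwork

open Filter Topology

/-! ### The exponential `e^{-t}` on `[0, ∞]` and infinite products of numbers in `[0, 1]` -/

/-- The function `t ↦ e^{-t}` on `[0, ∞]`, with value `0` at `∞`. -/
def expNeg (t : ℝ≥0∞) : ℝ≥0∞ := (EReal.exp (t : EReal))⁻¹

lemma expNeg_add (a b : ℝ≥0∞) : expNeg (a + b) = expNeg a * expNeg b := by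
  unfold expNeg
  rw [EReal.coe_ennreal_add, EReal.exp_add, ENNReal.mul_inv]
  · left
    simp [EReal.exp_eq_zero_iff]
  · right
    simp [EReal.exp_eq_zero_iff]

@[simp] lemma expNeg_zero : expNeg 0 = 1 := by simp [expNeg]

@[simp] lemma expNeg_top : expNeg ⊤ = 0 := by simp [expNeg]

lemma expNeg_ofReal {x : ℝ} (hx : 0 ≤ x) :
    expNeg (ENNReal.ofReal x) = ENNReal.ofReal (Real.exp (-x)) := by
  rw [expNeg, EReal.coe_ennreal_ofReal, max_eq_left hx, EReal.exp_coe, Real.exp_neg,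
    ENNReal.ofReal_inv_of_pos (Real.exp_pos x)]

lemma expNeg_of_ne_top {t : ℝ≥0∞} (ht : t ≠ ⊤) :
    expNeg t = ENNReal.ofReal (Real.exp (-t.toReal)) := by
  rw [← expNeg_ofReal ENNReal.toReal_nonneg, ENNReal.ofReal_toReal ht]

lemma strictAnti_expNeg : StrictAnti expNeg := fun _ _ h =>
  ENNReal.inv_lt_inv.2 (EReal.exp_strictMono (EReal.coe_ennreal_lt_coe_ennreal_iff.2 h))

lemma antitone_expNeg : Antitone expNeg := strictAnti_expNeg.antitone

lemma continuous_expNeg : Continuous expNeg := by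
  unfold expNeg
  exact continuous_inv.comp (ENNReal.continuous_exp.comp continuous_coe_ennreal_ereal)

lemma measurable_expNeg : Measurable expNeg := continuous_expNeg.measurable

lemma expNeg_le_one (t : ℝ≥0∞) : expNeg t ≤ 1 := by
  simpa using antitone_expNeg (zero_le (a := t))

lemma expNeg_sum {ι : Type*} (s : Finset ι) (f : ι → ℝ≥0∞) :
    expNeg (∑ i ∈ s, f i) = ∏ i ∈ s, expNeg (f i) := by
  classical
  induction s using Finset.induction_on with
  | empty => simp
  | insert a s ha ih => rw [Finset.sum_insert ha, Finset.prod_insert ha, expNeg_add, ih]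

lemma expNeg_iSup {ι : Type*} [Nonempty ι] (f : ι → ℝ≥0∞) :
    expNeg (⨆ i, f i) = ⨅ i, expNeg (f i) :=
  Antitone.map_ciSup_of_continuousAt continuous_expNeg.continuousAt antitone_expNeg

/-- The infinite product of a sequence of numbers in `[0, 1]`, as the infimum of the finite
products. -/
def infProd (u : ℕ → ℝ≥0∞) : ℝ≥0∞ := ⨅ k, ∏ j ∈ Finset.range k, u j

lemma infProd_expNeg (u : ℕ → ℝ≥0∞) : infProd (fun j => expNeg (u j)) = expNeg (∑' j, u j) := by
  rw [ENNReal.tsum_eq_iSup_nat, expNeg_iSup]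
  simp only [infProd, expNeg_sum]

lemma infProd_le_one (u : ℕ → ℝ≥0∞) : infProd u ≤ 1 :=
  (iInf_le _ 0).trans (by simp)

lemma infProd_mono {u v : ℕ → ℝ≥0∞} (h : ∀ j, u j ≤ v j) : infProd u ≤ infProd v :=
  iInf_mono fun _ => Finset.prod_le_prod' fun j _ => h j

lemma antitone_prod_range {u : ℕ → ℝ≥0∞} (hu : ∀ j, u j ≤ 1) :
    Antitone fun k => ∏ j ∈ Finset.range k, u j := by
  refine antitone_nat_of_succ_le fun k => ?_
  rw [Finset.prod_range_succ]
  exact mul_le_of_le_one_right' (hu k)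

lemma infProd_eq_prod {u : ℕ → ℝ≥0∞} (hu : ∀ j, u j ≤ 1) (F : Finset ℕ)
    (hF : ∀ j ∉ F, u j = 1) : infProd u = ∏ j ∈ F, u j := by
  refine le_antisymm ?_ (le_iInf fun k => ?_)
  · obtain ⟨k, hk⟩ := F.exists_nat_subset_range
    refine (iInf_le _ k).trans (le_of_eq ?_)
    exact (Finset.prod_subset hk fun j _ hj => hF j hj).symm
  · rw [← Finset.prod_filter_mul_prod_filter_not F (· ∈ Finset.range k)]
    have h1 : ∏ j ∈ F with j ∈ Finset.range k, u j = ∏ j ∈ Finset.range k, u j := by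
      refine Finset.prod_subset (fun j hj => (Finset.mem_filter.1 hj).2) fun j hj hj' => hF j ?_
      exact fun h => hj' (Finset.mem_filter.2 ⟨h, hj⟩)
    rw [h1]
    exact mul_le_of_le_one_right' (Finset.prod_le_one' fun j _ => hu j)

/-- The infinite product commutes with infima of antitone sequences. -/
lemma infProd_iInf {v : ℕ → ℕ → ℝ≥0∞} (hv : ∀ j, Antitone fun n => v n j)
    (h1 : ∀ n j, v n j ≤ 1) : infProd (fun j => ⨅ n, v n j) = ⨅ n, infProd (v n) := by
  unfold infProd
  rw [iInf_comm]
  refine iInf_congr fun k => ?_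
  have ht : Tendsto (fun n => ∏ j ∈ Finset.range k, v n j) atTop
      (𝓝 (∏ j ∈ Finset.range k, ⨅ n, v n j)) :=
    ENNReal.tendsto_finsetProd_of_ne_top _ (fun j _ => tendsto_atTop_iInf (hv j))
      fun j _ => ((iInf_le _ 0).trans_lt ((h1 0 j).trans_lt ENNReal.one_lt_top)).ne
  have ha : Antitone fun n => ∏ j ∈ Finset.range k, v n j := fun m n hmn =>
    Finset.prod_le_prod' fun j _ => hv j hmn
  exact tendsto_nhds_unique ht (tendsto_atTop_iInf ha)

lemma Measurable.infProd {α : Type*} [MeasurableSpace α] {f : ℕ → α → ℝ≥0∞}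
    (hf : ∀ j, Measurable (f j)) : Measurable fun a => infProd fun j => f j a :=
  Measurable.iInf fun _ => Finset.measurable_prod _ fun j _ => hf j

/-! ### Moments of the Poisson distribution -/

lemma lintegral_pow_poissonMeasure (μ : ℝ≥0) {a : ℝ≥0∞} (ha : a ≤ 1) :
    ∫⁻ n, a ^ n ∂poissonMeasure μ = expNeg (μ * (1 - a)) := by
  lift a to ℝ≥0 using (ha.trans_lt ENNReal.one_lt_top).ne
  have ha1 : a ≤ 1 := by exact_mod_cast ha
  have h := (NormedSpace.expSeries_div_hasSum_exp ((a : ℝ) * μ)).mul_left (Real.exp (-μ))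
  rw [← Real.exp_eq_exp_ℝ, ← Real.exp_add] at h
  rw [lintegral_countable']
  have e : (μ : ℝ≥0∞) * (1 - a) = ENNReal.ofReal ((μ : ℝ) * (1 - (a : ℝ))) := by
    rw [ENNReal.ofReal_mul μ.coe_nonneg, ENNReal.ofReal_sub _ a.coe_nonneg]
    simp
  rw [e, expNeg_ofReal (mul_nonneg μ.coe_nonneg (sub_nonneg.2 (by exact_mod_cast ha1)))]
  have e2 : -((μ : ℝ) * (1 - a)) = -μ + a * μ := by ring
  rw [e2, ← h.tsum_eq, ENNReal.ofReal_tsum_of_nonneg (fun n => by positivity) h.summable]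
  refine tsum_congr fun n => ?_
  rw [poissonMeasure_singleton, ← ENNReal.ofReal_coe_nnreal (p := a),
    ← ENNReal.ofReal_pow a.coe_nonneg, ← ENNReal.ofReal_mul (by positivity)]
  congr 1
  rw [mul_pow]
  ring

lemma lintegral_mul_pow_poissonMeasure (μ : ℝ≥0) {a : ℝ≥0∞} (ha : a ≤ 1) :
    ∫⁻ n : ℕ, n * a ^ (n - 1) ∂poissonMeasure μ = μ * expNeg (μ * (1 - a)) := by
  rw [← lintegral_pow_poissonMeasure μ ha, lintegral_countable', lintegral_countable',
    tsum_eq_zero_add' ENNReal.summable, ← ENNReal.tsum_mul_left]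
  simp only [CharP.cast_eq_zero, zero_mul, zero_add]
  refine tsum_congr fun n => ?_
  -- `(n + 1) * p (n + 1) = μ * p n` for the Poisson weights `p`
  have h : ((n + 1 : ℕ) : ℝ≥0∞) * poissonMeasure μ {n + 1} = μ * poissonMeasure μ {n} := by
    rw [poissonMeasure_singleton, poissonMeasure_singleton,
      ← ENNReal.ofReal_natCast, ← ENNReal.ofReal_mul (by positivity),
      ← ENNReal.ofReal_coe_nnreal (p := μ), ← ENNReal.ofReal_mul (by positivity)]
    congr 1
    rw [Nat.factorial_succ]
    push_cast
    field_simp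
    ring
  rw [Nat.add_sub_cancel, mul_right_comm, h]
  ring

/-! ### Counts of a Poisson process -/

section PointProcess

variable {Ω : Type*} [MeasurableSpace Ω] {P : Measure Ω} {lam : ℝ} {X : ℕ → Ω → Plane}

omit [MeasurableSpace Ω] in
lemma count_eq_tsum (X : ℕ → Ω → Plane) (B : Set Plane) (ω : Ω) :
    ((count X B ω : ℕ∞) : ℝ≥0∞) = ∑' i, B.indicator 1 (X i ω) := by
  rw [count, ← ENNReal.tsum_set_one, tsum_subtype {i | X i ω ∈ B} fun _ => (1 : ℝ≥0∞)]
  rfl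

/-- The mean of the Poisson number of points in a set `B`. -/
def meanCount (lam : ℝ) (B : Set Plane) : ℝ≥0 := Real.toNNReal (lam * volume.real B)

lemma coe_meanCount {B : Set Plane} (hlam : 0 ≤ lam) (hB : volume B ≠ ⊤) :
    (meanCount lam B : ℝ≥0∞) = ENNReal.ofReal lam * volume B := by
  rw [meanCount, ← ENNReal.ofReal, ENNReal.ofReal_mul hlam, Measure.real,
    ENNReal.ofReal_toReal hB]

namespace IsHomogeneousPPP

variable (hX : IsHomogeneousPPP P lam X)
include hX

lemma measurable_count {B : Set Plane} (hB : MeasurableSet B) :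
    Measurable fun ω => ((count X B ω : ℕ∞) : ℝ≥0∞) := by
  simp only [count_eq_tsum]
  exact Measurable.tsum fun i => (measurable_one.indicator hB).comp (hX.measurable i)

lemma measurableSet_count_eq {B : Set Plane} (hB : MeasurableSet B) (n : ℕ) :
    MeasurableSet {ω | count X B ω = n} := by
  have : {ω | count X B ω = n} = {ω | ((count X B ω : ℕ∞) : ℝ≥0∞) = (n : ℝ≥0∞)} := by
    ext ω
    rw [mem_ofPred_eq, mem_ofPred_eq, ← ENat.toENNReal_coe, ENat.toENNReal_inj]
  rw [this]
  exact hX.measurable_count hB (measurableSet_singleton _)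

lemma ae_count_ne_top [IsProbabilityMeasure P] {B : Set Plane} (hB : MeasurableSet B)
    (hb : Bornology.IsBounded B) : ∀ᵐ ω ∂P, count X B ω ≠ ⊤ := by
  have h1 : ∀ n : ℕ, P {ω | count X B ω = n} = poissonMeasure (meanCount lam B) {n} := by
    intro n
    have := hX.counts 1 (fun _ => B) (fun _ => hB) (fun _ => hb)
      (fun i j hij => (hij (Subsingleton.elim i j)).elim) (fun _ => n)
    simpa [meanCount] using this
  have h2 : P (⋃ n : ℕ, {ω | count X B ω = n}) = 1 := by
    rw [measure_iUnion _ fun n => hX.measurableSet_count_eq hB n]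
    · simp_rw [h1]
      have := lintegral_countable' (μ := poissonMeasure (meanCount lam B)) fun _ => 1
      simpa using this.symm
    · intro m n hmn
      refine Set.disjoint_left.2 fun ω h h' => hmn ?_
      have := (show count X B ω = m from h).symm.trans h'
      exact_mod_cast this
  have h3 : MeasurableSet (⋃ n : ℕ, {ω | count X B ω = n}) :=
    MeasurableSet.iUnion fun n => hX.measurableSet_count_eq hB n
  filter_upwards [(mem_ae_iff_prob_eq_one h3).2 h2] with ω hω
  obtain ⟨n, hn⟩ := mem_iUnion.1 hω
  rw [show count X B ω = n from hn]
  exact ENat.natCast_ne_top n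

/-- Product functionals of the counts in disjoint bounded sets factorize. -/
lemma lintegral_prod_count [IsProbabilityMeasure P] {ι : Type*} [Fintype ι] {B : ι → Set Plane}
    (hB : ∀ l, MeasurableSet (B l)) (hb : ∀ l, Bornology.IsBounded (B l))
    (hd : Pairwise fun i j => Disjoint (B i) (B j)) (c : ι → ℕ → ℝ≥0∞) :
    ∫⁻ ω, ∏ l, c l (count X (B l) ω).toNat ∂P =
      ∏ l, ∫⁻ n, c l n ∂poissonMeasure (meanCount lam (B l)) := by
  set e := Fintype.equivFin ι
  have hcount : ∀ l, ∀ᵐ ω ∂P, count X (B l) ω ≠ ⊤ := fun l => hX.ae_count_ne_top (hB l) (hb l)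
  set N : Ω → ι → ℕ := fun ω l => (count X (B l) ω).toNat with hN
  have hNm : Measurable N := by
    refine measurable_pi_lambda _ fun l => ?_
    have h0 : Measurable fun ω => ((count X (B l) ω : ℕ∞) : ℝ≥0∞).toReal :=
      (hX.measurable_count (hB l)).ennreal_toReal
    have : (fun ω => N ω l) = fun ω => ⌊((count X (B l) ω : ℕ∞) : ℝ≥0∞).toReal⌋₊ := by
      ext ω
      simp only [hN]
      induction count X (B l) ω using ENat.recTopCoe with
      | top => simp
      | coe a => simp
    rw [this]
    exact Nat.measurable_floor.comp h0
  have hmap : P.map N = Measure.pi fun l => poissonMeasure (meanCount lam (B l)) := by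
    refine Measure.ext_of_singleton fun n => ?_
    rw [Measure.map_apply hNm (measurableSet_singleton n), Measure.pi_singleton]
    have h := hX.counts _ (fun j => B (e.symm j)) (fun j => hB _) (fun j => hb _)
      (fun i j hij => hd fun h => hij (e.symm.injective h)) fun j => n (e.symm j)
    rw [← Equiv.prod_comp e.symm]
    refine Eq.trans (measure_congr ?_) h
    filter_upwards [ae_all_iff.2 hcount] with ω hω
    refine propext ⟨fun h j => ?_, fun h => funext fun l => ?_⟩
    · rw [← congr_fun (mem_singleton_iff.1 h) (e.symm j)]
      exact (ENat.natCast_toNat (hω _)).symm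
    · have := h (e l)
      rw [e.symm_apply_apply] at this
      simp only [hN]
      rw [this, ENat.toNat_natCast]
  have h1 := lintegral_prod_eq_prod_lintegral_of_indepFun Finset.univ
    (fun l (n : ι → ℕ) => c l (n l))
    (iIndepFun_pi (μ := fun l => poissonMeasure (meanCount lam (B l))) (X := c)
      fun l => (measurable_of_countable _).aemeasurable)
    fun l => (measurable_of_countable _).comp (measurable_pi_apply l)
  rw [← hmap, lintegral_map (measurable_of_countable _) hNm] at h1
  rw [h1]
  refine Finset.prod_congr rfl fun l _ => ?_
  rw [hmap]
  exact (measurePreserving_eval (fun l => poissonMeasure (meanCount lam (B l))) l).lintegral_comp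
    (measurable_of_countable _)

end IsHomogeneousPPP

/-! ### Product functionals of step functions -/

section Cells

-- The step function `φ` has the value `a l` on the cell `C l`, and the value `1` outside the cells.
variable {ι : Type*} [Fintype ι] {C : ι → Set Plane} {φ : Plane → ℝ≥0∞} {a : ι → ℝ≥0∞}

omit [Fintype ι] in
lemma step_le_one (hin : ∀ l, ∀ x ∈ C l, φ x = a l) (hout : ∀ x, (∀ l, x ∉ C l) → φ x = 1)
    (ha : ∀ l, a l ≤ 1) (x : Plane) : φ x ≤ 1 := by
  by_cases h : ∀ l, x ∉ C l
  · exact (hout x h).le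
  · push Not at h
    obtain ⟨l, hl⟩ := h
    exact (hin l x hl).trans_le (ha l)

/-- A product over a sequence of points of a step function is a product of powers. -/
lemma infProd_step [DecidableEq ι] (hd : Pairwise fun i j => Disjoint (C i) (C j))
    (hin : ∀ l, ∀ x ∈ C l, φ x = a l) (hout : ∀ x, (∀ l, x ∉ C l) → φ x = 1) (ha : ∀ l, a l ≤ 1)
    {x : ℕ → Plane} (hfin : ∀ l, {j | x j ∈ C l}.Finite) :
    infProd (fun j => φ (x j)) = ∏ l, a l ^ {j | x j ∈ C l}.encard.toNat := by
  have hdF : (Set.univ : Set ι).PairwiseDisjoint fun l => (hfin l).toFinset := by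
    intro l _ l' _ hll
    refine Finset.disjoint_left.2 fun j h h' => ?_
    exact Set.disjoint_left.1 (hd hll) ((hfin l).mem_toFinset.1 h) ((hfin l').mem_toFinset.1 h')
  rw [infProd_eq_prod (fun j => step_le_one hin hout ha _)
      (Finset.univ.biUnion fun l => (hfin l).toFinset), Finset.prod_biUnion (by simpa using hdF)]
  · refine Finset.prod_congr rfl fun l _ => ?_
    rw [Finset.prod_congr rfl fun j hj => hin l (x j) ((hfin l).mem_toFinset.1 hj),
      Finset.prod_const, (hfin l).encard_eq_coe_toFinset_card, ENat.toNat_natCast]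
  · intro j hj
    refine hout _ fun l hl => hj ?_
    exact Finset.mem_biUnion.2 ⟨l, Finset.mem_univ l, (hfin l).mem_toFinset.2 hl⟩

/-- The sum over the points of one cell of the product over all other points. Updating the factor
of index `i` to `1` removes the point `i` from the product; if the cell `l₀` has `n` points, this
leaves `n` equal terms with `n - 1` factors `a l₀`. -/
lemma tsum_infProd_step [DecidableEq ι] (hd : Pairwise fun i j => Disjoint (C i) (C j))
    (hin : ∀ l, ∀ x ∈ C l, φ x = a l) (hout : ∀ x, (∀ l, x ∉ C l) → φ x = 1) (ha : ∀ l, a l ≤ 1)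
    {x : ℕ → Plane} (hfin : ∀ l, {j | x j ∈ C l}.Finite) (l₀ : ι) :
    ∑' i, (C l₀).indicator 1 (x i) * infProd (Function.update (fun j => φ (x j)) i 1) =
      ∏ l, Function.update (fun l (n : ℕ) => a l ^ n) l₀ (fun n => n * a l₀ ^ (n - 1)) l
        {j | x j ∈ C l}.encard.toNat := by
  have hdF : (Set.univ : Set ι).PairwiseDisjoint fun l => (hfin l).toFinset := by
    intro l _ l' _ hll
    refine Finset.disjoint_left.2 fun j h h' => ?_
    exact Set.disjoint_left.1 (hd hll) ((hfin l).mem_toFinset.1 h) ((hfin l').mem_toFinset.1 h')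
  have key : ∀ i, x i ∈ C l₀ → infProd (Function.update (fun j => φ (x j)) i 1) =
      a l₀ ^ ({j | x j ∈ C l₀}.encard.toNat - 1) *
        ∏ l ∈ Finset.univ.erase l₀, a l ^ {j | x j ∈ C l}.encard.toNat := by
    intro i hi
    have hi' : i ∈ (hfin l₀).toFinset := (hfin l₀).mem_toFinset.2 hi
    rw [infProd_eq_prod (fun j => ?_)
      (Finset.univ.biUnion fun l => (hfin l).toFinset), Finset.prod_biUnion (by simpa using hdF),
      ← Finset.mul_prod_erase _ _ (Finset.mem_univ l₀)]
    · congr 1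
      · rw [Finset.prod_update_of_mem hi', one_mul,
          Finset.prod_congr rfl fun j hj => hin l₀ (x j)
            ((hfin l₀).mem_toFinset.1 (Finset.mem_sdiff.1 hj).1),
          Finset.prod_const, (hfin l₀).encard_eq_coe_toFinset_card, ENat.toNat_natCast,
          Finset.card_sdiff_of_subset (by simpa using hi), Finset.card_singleton]
      · refine Finset.prod_congr rfl fun l hl => ?_
        have hne : l ≠ l₀ := Finset.ne_of_mem_erase hl
        have hi'' : i ∉ (hfin l).toFinset := fun h =>
          Set.disjoint_left.1 (hd hne) ((hfin l).mem_toFinset.1 h) hi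
        rw [Finset.prod_update_of_notMem hi'',
          Finset.prod_congr rfl fun j hj => hin l (x j) ((hfin l).mem_toFinset.1 hj),
          Finset.prod_const, (hfin l).encard_eq_coe_toFinset_card, ENat.toNat_natCast]
    · intro j hj
      have : j ≠ i := fun h => hj (h ▸ Finset.mem_biUnion.2 ⟨l₀, Finset.mem_univ _, hi'⟩)
      rw [Function.update_of_ne this]
      refine hout _ fun l hl => hj ?_
      exact Finset.mem_biUnion.2 ⟨l, Finset.mem_univ l, (hfin l).mem_toFinset.2 hl⟩
    · by_cases h : j = i
      · rw [h, Function.update_self]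
      · rw [Function.update_of_ne h]
        exact step_le_one hin hout ha _
  have h1 : ∀ i, (C l₀).indicator 1 (x i) * infProd (Function.update (fun j => φ (x j)) i 1) =
      (C l₀).indicator 1 (x i) * (a l₀ ^ ({j | x j ∈ C l₀}.encard.toNat - 1) *
        ∏ l ∈ Finset.univ.erase l₀, a l ^ {j | x j ∈ C l}.encard.toNat) := by
    intro i
    by_cases hi : x i ∈ C l₀
    · rw [key i hi]
    · simp [hi]
  rw [tsum_congr h1, ENNReal.tsum_mul_right, ← Finset.mul_prod_erase _ _ (Finset.mem_univ l₀),
    Function.update_self, mul_assoc]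
  congr 1
  · have : ∑' i, (C l₀).indicator (1 : Plane → ℝ≥0∞) (x i) = ({j | x j ∈ C l₀}.encard : ℝ≥0∞) := by
      rw [← ENNReal.tsum_set_one, tsum_subtype {i | x i ∈ C l₀} fun _ => (1 : ℝ≥0∞)]
      rfl
    rw [this, (hfin l₀).encard_eq_coe_toFinset_card, ENat.toNat_natCast]
    simp
  · congr 1
    refine Finset.prod_congr rfl fun l hl => ?_
    rw [Function.update_of_ne (Finset.ne_of_mem_erase hl)]

lemma lintegral_one_sub_step (hC : ∀ l, MeasurableSet (C l))
    (hd : Pairwise fun i j => Disjoint (C i) (C j))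
    (hin : ∀ l, ∀ x ∈ C l, φ x = a l) (hout : ∀ x, (∀ l, x ∉ C l) → φ x = 1) :
    ∫⁻ x, (1 - φ x) = ∑ l, volume (C l) * (1 - a l) := by
  classical
  have h : ∀ x, 1 - φ x = ∑ l, (C l).indicator (fun _ => 1 - a l) x := by
    intro x
    by_cases hx : ∀ l, x ∉ C l
    · rw [hout x hx, tsub_self, Finset.sum_eq_zero fun l _ => indicator_of_notMem (hx l) _]
    · push Not at hx
      obtain ⟨l, hl⟩ := hx
      rw [hin l x hl, Finset.sum_eq_single l, indicator_of_mem hl]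
      · exact fun l' _ hne => indicator_of_notMem
          (fun h' => Set.disjoint_left.1 (hd hne) h' hl) _
      · simp
  simp_rw [h]
  rw [lintegral_finsetSum _ fun l _ => measurable_const.indicator (hC l)]
  refine Finset.sum_congr rfl fun l _ => ?_
  rw [lintegral_indicator_const (hC l), mul_comm]

end Cells

/-! ### The generating functional and the Mecke formula for step functions -/

namespace IsHomogeneousPPP

variable [IsProbabilityMeasure P]

section Cells

variable {ι : Type*} [Fintype ι] {C : ι → Set Plane} {φ : Plane → ℝ≥0∞} {a : ι → ℝ≥0∞}

lemma ae_finite_cells (hX : IsHomogeneousPPP P lam X) (hC : ∀ l, MeasurableSet (C l))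
    (hb : ∀ l, Bornology.IsBounded (C l)) : ∀ᵐ ω ∂P, ∀ l, {j | X j ω ∈ C l}.Finite := by
  filter_upwards [ae_all_iff.2 fun l => hX.ae_count_ne_top (hC l) (hb l)] with ω hω l
  exact Set.encard_ne_top_iff.1 (hω l)

lemma prod_expNeg_meanCount (hlam : 0 ≤ lam) (hC : ∀ l, MeasurableSet (C l))
    (hb : ∀ l, Bornology.IsBounded (C l)) (hd : Pairwise fun i j => Disjoint (C i) (C j))
    (hin : ∀ l, ∀ x ∈ C l, φ x = a l) (hout : ∀ x, (∀ l, x ∉ C l) → φ x = 1) :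
    ∏ l, expNeg (meanCount lam (C l) * (1 - a l)) =
      expNeg (ENNReal.ofReal lam * ∫⁻ x, (1 - φ x)) := by
  rw [lintegral_one_sub_step hC hd hin hout, Finset.mul_sum, expNeg_sum]
  refine Finset.prod_congr rfl fun l _ => ?_
  rw [coe_meanCount hlam (hb l).measure_lt_top.ne, mul_assoc]

lemma lintegral_infProd_step (hX : IsHomogeneousPPP P lam X) (hlam : 0 ≤ lam)
    (hC : ∀ l, MeasurableSet (C l))
    (hb : ∀ l, Bornology.IsBounded (C l)) (hd : Pairwise fun i j => Disjoint (C i) (C j))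
    (hin : ∀ l, ∀ x ∈ C l, φ x = a l) (hout : ∀ x, (∀ l, x ∉ C l) → φ x = 1)
    (ha : ∀ l, a l ≤ 1) :
    ∫⁻ ω, infProd (fun j => φ (X j ω)) ∂P = expNeg (ENNReal.ofReal lam * ∫⁻ x, (1 - φ x)) := by
  classical
  have h1 : ∀ᵐ ω ∂P, infProd (fun j => φ (X j ω)) = ∏ l, a l ^ (count X (C l) ω).toNat := by
    filter_upwards [ae_finite_cells hX hC hb] with ω hω
    exact infProd_step hd hin hout ha hω
  rw [lintegral_congr_ae h1, hX.lintegral_prod_count hC hb hd fun l n => a l ^ n,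
    ← prod_expNeg_meanCount hlam hC hb hd hin hout]
  exact Finset.prod_congr rfl fun l _ => lintegral_pow_poissonMeasure _ (ha l)

lemma lintegral_tsum_infProd_step (hX : IsHomogeneousPPP P lam X) (hlam : 0 ≤ lam)
    (hC : ∀ l, MeasurableSet (C l))
    (hb : ∀ l, Bornology.IsBounded (C l)) (hd : Pairwise fun i j => Disjoint (C i) (C j))
    (hin : ∀ l, ∀ x ∈ C l, φ x = a l) (hout : ∀ x, (∀ l, x ∉ C l) → φ x = 1)
    (ha : ∀ l, a l ≤ 1) (l₀ : ι) :
    ∫⁻ ω, ∑' i, (C l₀).indicator 1 (X i ω) *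
        infProd (Function.update (fun j => φ (X j ω)) i 1) ∂P =
      ENNReal.ofReal lam * volume (C l₀) *
        expNeg (ENNReal.ofReal lam * ∫⁻ x, (1 - φ x)) := by
  classical
  have h1 : ∀ᵐ ω ∂P, ∑' i, (C l₀).indicator 1 (X i ω) *
      infProd (Function.update (fun j => φ (X j ω)) i 1) =
      ∏ l, Function.update (fun l (n : ℕ) => a l ^ n) l₀ (fun n => n * a l₀ ^ (n - 1)) l
        (count X (C l) ω).toNat := by
    filter_upwards [ae_finite_cells hX hC hb] with ω hω
    exact tsum_infProd_step hd hin hout ha hω l₀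
  rw [lintegral_congr_ae h1, hX.lintegral_prod_count hC hb hd,
    ← prod_expNeg_meanCount hlam hC hb hd hin hout,
    ← Finset.mul_prod_erase _ _ (Finset.mem_univ l₀),
    ← Finset.mul_prod_erase _ (fun l => expNeg (meanCount lam (C l) * (1 - a l)))
      (Finset.mem_univ l₀), ← mul_assoc]
  congr 1
  · simp only [Function.update_self]
    rw [lintegral_mul_pow_poissonMeasure _ (ha l₀), coe_meanCount hlam (hb l₀).measure_lt_top.ne]
  · refine Finset.prod_congr rfl fun l hl => ?_
    rw [Function.update_of_ne (Finset.ne_of_mem_erase hl)]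
    exact lintegral_pow_poissonMeasure _ (ha l)

end Cells

/-- The cells on which a simple function `g`, cut off outside a ball, is constant, refined by a
set `A`. -/
def cell (g : SimpleFunc Plane ℝ≥0∞) (R : ℝ) (A : Set Plane) (l : g.range × Bool) : Set Plane :=
  g ⁻¹' {(l.1 : ℝ≥0∞)} ∩ Metric.ball 0 R ∩ if l.2 then A else Aᶜ

lemma measurableSet_cell (g : SimpleFunc Plane ℝ≥0∞) (R : ℝ) {A : Set Plane}
    (hA : MeasurableSet A) (l : g.range × Bool) : MeasurableSet (cell g R A l) := by
  refine ((g.measurableSet_fiber _).inter measurableSet_ball).inter ?_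
  split_ifs
  · exact hA
  · exact hA.compl

lemma isBounded_cell (g : SimpleFunc Plane ℝ≥0∞) (R : ℝ) (A : Set Plane) (l : g.range × Bool) :
    Bornology.IsBounded (cell g R A l) :=
  Metric.isBounded_ball.subset fun _ hx => hx.1.2

lemma pairwise_disjoint_cell (g : SimpleFunc Plane ℝ≥0∞) (R : ℝ) (A : Set Plane) :
    Pairwise fun i j => Disjoint (cell g R A i) (cell g R A j) := by
  rintro ⟨v, b⟩ ⟨w, c⟩ hne
  refine Set.disjoint_left.2 fun x hx hx' => hne ?_
  have h1 : v = w := Subtype.ext (hx.1.1.symm.trans hx'.1.1)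
  have h2 : b = c := by
    have := hx.2
    have := hx'.2
    cases b <;> cases c <;> simp_all
  rw [h1, h2]

/-- The function `g` cut off outside the ball of radius `R`. -/
def cutoff (g : Plane → ℝ≥0∞) (R : ℝ) (x : Plane) : ℝ≥0∞ := (Metric.ball 0 R).indicator g x

lemma measurable_cutoff {g : Plane → ℝ≥0∞} (hg : Measurable g) (R : ℝ) :
    Measurable (cutoff g R) := hg.indicator measurableSet_ball

lemma one_sub_cutoff_of_mem_cell {g : SimpleFunc Plane ℝ≥0∞} {R : ℝ} {A : Set Plane}
    (l : g.range × Bool) (x : Plane) (hx : x ∈ cell g R A l) :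
    1 - cutoff g R x = 1 - (l.1 : ℝ≥0∞) := by
  rw [cutoff, indicator_of_mem hx.1.2, show g x = l.1 from hx.1.1]

lemma one_sub_cutoff_of_notMem_cell {g : SimpleFunc Plane ℝ≥0∞} {R : ℝ} {A : Set Plane}
    (x : Plane) (hx : ∀ l, x ∉ cell g R A l) : 1 - cutoff g R x = 1 := by
  classical
  rw [cutoff, indicator_of_notMem, tsub_zero]
  intro h
  refine hx (⟨g x, g.mem_range_self x⟩, decide (x ∈ A)) ⟨⟨rfl, h⟩, ?_⟩
  by_cases hA : x ∈ A <;> simp [hA]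

lemma cutoff_le {g : Plane → ℝ≥0∞} (hg : ∀ x, g x ≤ 1) (R : ℝ) (x : Plane) : cutoff g R x ≤ 1 :=
  indicator_le' (s := Metric.ball 0 R) (f := g) (g := fun _ => 1) (fun x _ => hg x)
    (fun _ _ => zero_le_one) x

lemma lintegral_infProd_simple (hX : IsHomogeneousPPP P lam X) (hlam : 0 ≤ lam)
    (g : SimpleFunc Plane ℝ≥0∞) (hg : ∀ x, g x ≤ 1) (R : ℝ) :
    ∫⁻ ω, infProd (fun j => 1 - cutoff g R (X j ω)) ∂P =
      expNeg (ENNReal.ofReal lam * ∫⁻ x, cutoff g R x) := by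
  have h := hX.lintegral_infProd_step hlam (measurableSet_cell g R MeasurableSet.empty)
    (isBounded_cell g R ∅) (pairwise_disjoint_cell g R ∅)
    (φ := fun x => 1 - cutoff g R x) one_sub_cutoff_of_mem_cell one_sub_cutoff_of_notMem_cell
    (fun _ => tsub_le_self)
  rw [h]
  congr 2
  refine lintegral_congr fun x => ?_
  exact ENNReal.sub_sub_cancel ENNReal.one_ne_top (cutoff_le hg R x)

lemma lintegral_tsum_infProd_simple (hX : IsHomogeneousPPP P lam X) (hlam : 0 ≤ lam)
    (g : SimpleFunc Plane ℝ≥0∞) (hg : ∀ x, g x ≤ 1) (R : ℝ) {A : Set Plane}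
    (hA : MeasurableSet A) (hAR : A ⊆ Metric.ball 0 R) :
    ∫⁻ ω, ∑' i, A.indicator 1 (X i ω) *
        infProd (Function.update (fun j => 1 - cutoff g R (X j ω)) i 1) ∂P =
      ENNReal.ofReal lam * volume A * expNeg (ENNReal.ofReal lam * ∫⁻ x, cutoff g R x) := by
  have h := fun v => hX.lintegral_tsum_infProd_step hlam (measurableSet_cell g R hA)
    (isBounded_cell g R A) (pairwise_disjoint_cell g R A)
    (φ := fun x => 1 - cutoff g R x) one_sub_cutoff_of_mem_cell one_sub_cutoff_of_notMem_cell
    (fun _ => tsub_le_self) (v, true)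
  have e : ∫⁻ x, (1 - (1 - cutoff g R x)) = ∫⁻ x, cutoff g R x :=
    lintegral_congr fun x => ENNReal.sub_sub_cancel ENNReal.one_ne_top (cutoff_le hg R x)
  rw [e] at h
  -- the cells with second index `true` partition `A`
  have hpart : ∀ x, A.indicator (1 : Plane → ℝ≥0∞) x =
      ∑ v, (cell g R A (v, true)).indicator 1 x := by
    intro x
    by_cases hx : x ∈ A
    · rw [Finset.sum_eq_single ⟨g x, g.mem_range_self x⟩]
      · rw [indicator_of_mem hx, indicator_of_mem]
        exact ⟨⟨rfl, hAR hx⟩, by simpa using hx⟩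
      · intro v _ hv
        refine indicator_of_notMem (fun h' => hv (Subtype.ext h'.1.1.symm)) _
      · simp
    · rw [indicator_of_notMem hx, Finset.sum_eq_zero]
      intro v _
      exact indicator_of_notMem (fun h' => hx (by simpa using h'.2)) _
  have hvol : volume A = ∑ v, volume (cell g R A (v, true)) := by
    rw [← lintegral_indicator_one hA, lintegral_congr hpart, lintegral_finsetSum]
    · exact Finset.sum_congr rfl fun v _ => lintegral_indicator_one (measurableSet_cell g R hA _)
    · exact fun v _ => measurable_one.indicator (measurableSet_cell g R hA _)
  rw [hvol, Finset.mul_sum, Finset.sum_mul, ← Finset.sum_congr rfl fun v _ => h v,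
    ← lintegral_finsetSum]
  · refine lintegral_congr fun ω => ?_
    rw [← Summable.tsum_finsetSum fun _ _ => ENNReal.summable]
    exact tsum_congr fun i => by rw [hpart, Finset.sum_mul]
  · refine fun v _ => Measurable.tsum fun i => ?_
    refine ((measurable_one.indicator (measurableSet_cell g R hA _)).comp (hX.measurable i)).mul ?_
    refine Measurable.infProd fun j => ?_
    by_cases hji : j = i
    · subst hji
      simp
    · simp only [Function.update_of_ne hji]
      exact measurable_const.sub ((measurable_cutoff g.measurable R).comp (hX.measurable j))

end IsHomogeneousPPP

/-! ### The generating functional and the Mecke formula -/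

lemma tsum_iInf_of_antitone {f : ℕ → ℕ → ℝ≥0∞} (hf : Antitone f) (h0 : ∑' i, f 0 i ≠ ⊤) :
    ∑' i, ⨅ n, f n i = ⨅ n, ∑' i, f n i := by
  simp only [← lintegral_count] at h0 ⊢
  exact lintegral_iInf (fun _ => measurable_of_countable _) hf h0

lemma measurable_infProd_update {f : ℕ → Ω → ℝ≥0∞} (hf : ∀ j, Measurable (f j)) (i : ℕ) :
    Measurable fun ω => infProd (Function.update (fun j => f j ω) i 1) := by
  refine Measurable.infProd fun j => ?_
  by_cases hji : j = i
  · subst hji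
    simp
  · simp only [Function.update_of_ne hji]
    exact hf j

/-- The step functions below `g`, cut off outside growing balls, that increase to `g`. -/
def approx (g : Plane → ℝ≥0∞) (R : ℝ) (n : ℕ) : Plane → ℝ≥0∞ :=
  IsHomogeneousPPP.cutoff (SimpleFunc.eapprox g n) (R + n)

lemma monotone_approx (g : Plane → ℝ≥0∞) (R : ℝ) : Monotone (approx g R) := by
  intro m n hmn x
  refine (indicator_le_indicator_of_subset (Metric.ball_subset_ball ?_) (fun _ => zero_le) x).trans
    (indicator_le_indicator (SimpleFunc.monotone_eapprox g hmn x))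
  gcongr

lemma iSup_approx {g : Plane → ℝ≥0∞} (hg : Measurable g) (R : ℝ) (x : Plane) :
    ⨆ n, approx g R n x = g x := by
  refine le_antisymm (iSup_le fun n => ?_) ?_
  · refine (indicator_le_self _ _ x).trans ?_
    rw [← SimpleFunc.iSup_eapprox_apply hg x]
    exact le_iSup (fun n => SimpleFunc.eapprox g n x) n
  · rw [← SimpleFunc.iSup_eapprox_apply hg x]
    refine iSup_le fun n => ?_
    obtain ⟨k, hk⟩ := exists_nat_gt (‖x‖ - R)
    refine le_trans ?_ (le_iSup _ (max n k))
    rw [approx, IsHomogeneousPPP.cutoff, indicator_of_mem]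
    · exact SimpleFunc.monotone_eapprox g (le_max_left n k) x
    · rw [mem_ball_zero_iff]
      have : (k : ℝ) ≤ (max n k : ℕ) := by exact_mod_cast le_max_right n k
      linarith

lemma measurable_approx (g : Plane → ℝ≥0∞) (R : ℝ) (n : ℕ) : Measurable (approx g R n) :=
  IsHomogeneousPPP.measurable_cutoff (SimpleFunc.measurable _) _

lemma one_sub_iSup {f : ℕ → ℝ≥0∞} : 1 - ⨆ n, f n = ⨅ n, (1 - f n) :=
  ENNReal.sub_iSup ENNReal.one_ne_top

lemma lintegral_eq_iSup_approx {g : Plane → ℝ≥0∞} (hg : Measurable g) (R : ℝ) :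
    ∫⁻ x, g x = ⨆ n, ∫⁻ x, approx g R n x := by
  rw [← lintegral_iSup (measurable_approx g R) (monotone_approx g R)]
  simp only [iSup_approx hg R]

namespace IsHomogeneousPPP

variable [IsProbabilityMeasure P]

lemma eapprox_le_one {g : Plane → ℝ≥0∞} (hg : Measurable g) (hg1 : ∀ x, g x ≤ 1) (n : ℕ)
    (x : Plane) : SimpleFunc.eapprox g n x ≤ 1 :=
  (le_iSup (fun n => SimpleFunc.eapprox g n x) n).trans
    ((SimpleFunc.iSup_eapprox_apply hg x).trans_le (hg1 x))

/-- The generating functional of a Poisson process. -/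
theorem lintegral_infProd (hX : IsHomogeneousPPP P lam X) (hlam : 0 ≤ lam) {g : Plane → ℝ≥0∞}
    (hg : Measurable g) (hg1 : ∀ x, g x ≤ 1) :
    ∫⁻ ω, infProd (fun j => 1 - g (X j ω)) ∂P =
      expNeg (ENNReal.ofReal lam * ∫⁻ x, g x) := by
  have h1 : ∀ ω, infProd (fun j => 1 - g (X j ω)) =
      ⨅ n, infProd (fun j => 1 - approx g 0 n (X j ω)) := by
    intro ω
    rw [← infProd_iInf]
    · simp only [← one_sub_iSup, iSup_approx hg]
    · exact fun j m n hmn => tsub_le_tsub_left (monotone_approx g 0 hmn _) 1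
    · exact fun _ _ => tsub_le_self
  simp_rw [h1]
  rw [lintegral_iInf]
  · rw [lintegral_eq_iSup_approx hg 0, ENNReal.mul_iSup, expNeg_iSup]
    refine iInf_congr fun n => ?_
    exact hX.lintegral_infProd_simple hlam _ (eapprox_le_one hg hg1 n) _
  · exact fun n => Measurable.infProd fun j =>
      measurable_const.sub ((measurable_approx g 0 n).comp (hX.measurable j))
  · exact fun m n hmn ω => infProd_mono fun j => tsub_le_tsub_left (monotone_approx g 0 hmn _) 1
  · refine ne_top_of_le_ne_top ENNReal.one_ne_top ?_
    calc ∫⁻ ω, infProd (fun j => 1 - approx g 0 0 (X j ω)) ∂P ≤ ∫⁻ _, 1 ∂P :=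
        lintegral_mono fun ω => infProd_le_one _
      _ = 1 := by simp

lemma lintegral_tsum_indicator_of_isBounded (hX : IsHomogeneousPPP P lam X) (hlam : 0 ≤ lam)
    {A : Set Plane} (hA : MeasurableSet A) (hb : Bornology.IsBounded A) :
    ∫⁻ ω, ∑' i, A.indicator 1 (X i ω) ∂P = ENNReal.ofReal lam * volume A := by
  obtain ⟨R, hR⟩ := hb.subset_ball 0
  have h := hX.lintegral_tsum_infProd_simple hlam 0 (fun x => by simp) R hA hR
  have h0 : ∀ x, cutoff (⇑(0 : SimpleFunc Plane ℝ≥0∞)) R x = 0 := by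
    intro x
    simp [cutoff]
  simp only [h0] at h
  have h1 : infProd (fun _ => 1) = 1 := by simp [infProd]
  simpa [h1] using h

/-- Monotone limits under the Campbell measure of a bounded set. -/
lemma lintegral_tsum_infProd_iInf (hX : IsHomogeneousPPP P lam X) (hlam : 0 ≤ lam)
    {A : Set Plane} (hA : MeasurableSet A) (hb : Bornology.IsBounded A)
    {u : ℕ → ℕ → ℕ → Ω → ℝ≥0∞} (hum : ∀ n i j, Measurable (u n i j))
    (hu : ∀ i j ω, Antitone fun n => u n i j ω) (hu1 : ∀ n i j ω, u n i j ω ≤ 1) :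
    ∫⁻ ω, ∑' i, A.indicator 1 (X i ω) *
        infProd (Function.update (fun j => ⨅ n, u n i j ω) i 1) ∂P =
      ⨅ n, ∫⁻ ω, ∑' i, A.indicator 1 (X i ω) *
        infProd (Function.update (fun j => u n i j ω) i 1) ∂P := by
  have hint := hX.lintegral_tsum_indicator_of_isBounded hlam hA hb
  have hfin : ∫⁻ ω, ∑' i, A.indicator 1 (X i ω) ∂P ≠ ⊤ := by
    rw [hint]
    exact ENNReal.mul_ne_top ENNReal.ofReal_ne_top hb.measure_lt_top.ne
  have hmA : ∀ i, Measurable fun ω => A.indicator (1 : Plane → ℝ≥0∞) (X i ω) := fun i =>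
    (measurable_one.indicator hA).comp (hX.measurable i)
  have hmono : ∀ ω, Antitone fun n i => A.indicator (1 : Plane → ℝ≥0∞) (X i ω) *
      infProd (Function.update (fun j => u n i j ω) i 1) := by
    intro ω m n hmn i
    refine mul_le_mul_right (infProd_mono fun j => ?_) _
    by_cases hji : j = i
    · subst hji
      simp
    · simp only [Function.update_of_ne hji]
      exact hu i j ω hmn
  have hle : ∀ n ω, ∑' i, A.indicator (1 : Plane → ℝ≥0∞) (X i ω) *
      infProd (Function.update (fun j => u n i j ω) i 1) ≤
      ∑' i, A.indicator (1 : Plane → ℝ≥0∞) (X i ω) := fun n ω =>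
    ENNReal.tsum_le_tsum fun i => mul_le_of_le_one_right' (infProd_le_one _)
  have h1 : ∀ᵐ ω ∂P, ∑' i, A.indicator 1 (X i ω) *
        infProd (Function.update (fun j => ⨅ n, u n i j ω) i 1) =
      ⨅ n, ∑' i, A.indicator 1 (X i ω) *
        infProd (Function.update (fun j => u n i j ω) i 1) := by
    have hm : Measurable fun ω => ∑' i, A.indicator (1 : Plane → ℝ≥0∞) (X i ω) :=
      Measurable.tsum hmA
    filter_upwards [ae_lt_top hm hfin] with ω hω
    rw [← tsum_iInf_of_antitone (hmono ω) ((hle 0 ω).trans_lt hω).ne]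
    refine tsum_congr fun i => ?_
    rw [← ENNReal.mul_iInf' (fun h => absurd h ?_) (fun _ => ⟨0⟩), ← infProd_iInf]
    · congr 2
      ext j
      by_cases hji : j = i
      · subst hji
        simp
      · simp only [Function.update_of_ne hji]
    · intro j
      by_cases hji : j = i
      · subst hji
        simpa using antitone_const
      · simpa only [Function.update_of_ne hji] using hu i j ω
    · intro n j
      by_cases hji : j = i
      · subst hji
        simp
      · simpa only [Function.update_of_ne hji] using hu1 n i j ω
    · by_cases hx : X i ω ∈ A <;> simp [hx]
  rw [lintegral_congr_ae h1, lintegral_iInf]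
  · exact fun n => Measurable.tsum fun i =>
      (hmA i).mul (measurable_infProd_update (hum n i) i)
  · exact fun m n hmn ω => ENNReal.tsum_le_tsum (hmono ω hmn)
  · exact ((lintegral_mono (hle 0)).trans_lt (lt_top_iff_ne_top.2 hfin)).ne

/-- The Mecke formula for products of a fixed function over the remaining points. -/
lemma lintegral_tsum_infProd (hX : IsHomogeneousPPP P lam X) (hlam : 0 ≤ lam)
    {A : Set Plane} (hA : MeasurableSet A) (hb : Bornology.IsBounded A) {g : Plane → ℝ≥0∞}
    (hg : Measurable g) (hg1 : ∀ x, g x ≤ 1) :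
    ∫⁻ ω, ∑' i, A.indicator 1 (X i ω) *
        infProd (Function.update (fun j => 1 - g (X j ω)) i 1) ∂P =
      ENNReal.ofReal lam * volume A * expNeg (ENNReal.ofReal lam * ∫⁻ x, g x) := by
  obtain ⟨R, hR⟩ := hb.subset_ball 0
  have hm : ∀ n j, Measurable fun ω => 1 - approx g R n (X j ω) := fun n j =>
    measurable_const.sub ((measurable_approx g R n).comp (hX.measurable j))
  have ha : ∀ j ω, Antitone fun n => 1 - approx g R n (X j ω) := fun j ω m n hmn =>
    tsub_le_tsub_left (monotone_approx g R hmn (X j ω)) 1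
  have h := hX.lintegral_tsum_infProd_iInf hlam hA hb
    (u := fun n _ j ω => 1 - approx g R n (X j ω)) (fun n _ j => hm n j) (fun _ j ω => ha j ω)
    (fun _ _ _ _ => tsub_le_self)
  simp only [← one_sub_iSup, iSup_approx hg] at h
  rw [h, lintegral_eq_iSup_approx hg R, ENNReal.mul_iSup, expNeg_iSup, ENNReal.mul_iInf']
  · exact iInf_congr fun n => hX.lintegral_tsum_infProd_simple hlam (SimpleFunc.eapprox g n)
      (eapprox_le_one hg hg1 n) (R + n) hA (hR.trans (Metric.ball_subset_ball (by simp)))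
  · intro h
    exact absurd h (ENNReal.mul_ne_top ENNReal.ofReal_ne_top hb.measure_lt_top.ne)
  · exact fun _ => ⟨0⟩

/-- The function `g` outside the disc of radius `ρ` around the origin, and `1` inside. -/
def fill (g : Plane → ℝ≥0∞) (ρ : ℝ) (y : Plane) : ℝ≥0∞ := if ρ ≤ ‖y‖ then g y else 1

lemma fill_le_one {g : Plane → ℝ≥0∞} (hg : ∀ x, g x ≤ 1) (ρ : ℝ) (y : Plane) :
    fill g ρ y ≤ 1 := by
  unfold fill
  split_ifs
  exacts [hg y, le_rfl]

lemma fill_mono {g : Plane → ℝ≥0∞} (hg : ∀ x, g x ≤ 1) {ρ σ : ℝ} (h : ρ ≤ σ) (y : Plane) :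
    fill g ρ y ≤ fill g σ y := by
  unfold fill
  split_ifs with h1 h2 h2
  exacts [le_rfl, hg y, absurd (h.trans h2) h1, le_rfl]

lemma measurable_fill {g : Plane → ℝ≥0∞} (hg : Measurable g) :
    Measurable fun p : ℝ × Plane => fill g p.1 p.2 :=
  Measurable.ite (measurableSet_le measurable_fst measurable_snd.norm)
    (hg.comp measurable_snd) measurable_const

/-- The largest dyadic number of level `n` below `t`. -/
def dyadic (n : ℕ) (t : ℝ) : ℝ := ⌊2 ^ n * t⌋ / 2 ^ n

lemma dyadic_le (n : ℕ) (t : ℝ) : dyadic n t ≤ t := by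
  rw [dyadic, div_le_iff₀ (by positivity), mul_comm]
  exact Int.floor_le _

lemma lt_dyadic_add (n : ℕ) (t : ℝ) : t - (1 / 2) ^ n < dyadic n t := by
  rw [dyadic, lt_div_iff₀ (by positivity), sub_mul, ← mul_pow]
  have := Int.lt_floor_add_one (2 ^ n * t)
  norm_num
  linarith

lemma monotone_dyadic (t : ℝ) : Monotone fun n => dyadic n t := by
  refine monotone_nat_of_le_succ fun n => ?_
  unfold dyadic
  rw [div_le_div_iff₀ (by positivity) (by positivity), pow_succ]
  have h : (⌊(2 : ℝ) ^ n * t⌋ * 2 : ℤ) ≤ ⌊(2 : ℝ) ^ n * 2 * t⌋ := by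
    rw [Int.le_floor]
    push_cast
    have := Int.floor_le ((2 : ℝ) ^ n * t)
    linarith
  have h' : (⌊(2 : ℝ) ^ n * t⌋ * 2 : ℝ) ≤ ⌊(2 : ℝ) ^ n * 2 * t⌋ := by exact_mod_cast h
  calc (⌊(2 : ℝ) ^ n * t⌋ : ℝ) * (2 ^ n * 2) = (⌊(2 : ℝ) ^ n * t⌋ * 2 : ℝ) * 2 ^ n := by ring
    _ ≤ _ := by gcongr

lemma iSup_fill_dyadic {g : Plane → ℝ≥0∞} (hg : ∀ x, g x ≤ 1) (ρ : ℝ) (y : Plane) :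
    ⨆ n, fill g (dyadic n ρ) y = fill g ρ y := by
  refine le_antisymm (iSup_le fun n => fill_mono hg (dyadic_le n ρ) y) ?_
  by_cases h : ρ ≤ ‖y‖
  · refine le_trans ?_ (le_iSup _ 0)
    rw [fill, fill, if_pos h, if_pos ((dyadic_le _ _).trans h)]
  · push Not at h
    obtain ⟨n, hn⟩ := exists_pow_lt_of_lt_one (sub_pos.2 h) (show (1 / 2 : ℝ) < 1 by norm_num)
    refine le_trans ?_ (le_iSup _ n)
    have : ‖y‖ < dyadic n ρ := by
      have := lt_dyadic_add n ρ
      linarith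
    rw [fill, fill, if_neg h.not_ge, if_neg this.not_ge]

/-- The Mecke formula for products over the remaining points that vanish as soon as one of these
points is closer to the origin than a function of the distinguished point. -/
theorem lintegral_tsum_infProd_fill (hX : IsHomogeneousPPP P lam X) (hlam : 0 ≤ lam)
    {A : Set Plane} (hA : MeasurableSet A) (hb : Bornology.IsBounded A) {g : Plane → ℝ≥0∞}
    (hg : Measurable g) (hg1 : ∀ x, g x ≤ 1) {ρ : Plane → ℝ} (hρ : Measurable ρ) :
    ∫⁻ ω, ∑' i, A.indicator 1 (X i ω) *
        infProd (Function.update (fun j => 1 - fill g (ρ (X i ω)) (X j ω)) i 1) ∂P =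
      ∫⁻ x in A, ENNReal.ofReal lam *
        expNeg (ENNReal.ofReal lam * ∫⁻ y, fill g (ρ x) y) := by
  have hdm : ∀ n, Measurable (dyadic n) := fun n => by
    unfold dyadic
    exact ((measurable_from_top (f := fun k : ℤ => (k : ℝ))).comp
      (Int.measurable_floor.comp (measurable_const.mul measurable_id))).div_const _
  have hfm : ∀ n, Measurable fun x => ∫⁻ y, fill g (dyadic n (ρ x)) y := fun n =>
    Measurable.lintegral_prod_right'
      (f := fun p : Plane × Plane => fill g (dyadic n (ρ p.1)) p.2)
      ((measurable_fill hg).comp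
        ((((hdm n).comp hρ).comp measurable_fst).prodMk measurable_snd))
  -- for a dyadic approximation of `ρ`, split `A` along its countably many values
  have hn : ∀ n, ∫⁻ ω, ∑' i, A.indicator 1 (X i ω) * infProd (Function.update
        (fun j => 1 - fill g (dyadic n (ρ (X i ω))) (X j ω)) i 1) ∂P =
      ∫⁻ x in A, ENNReal.ofReal lam *
        expNeg (ENNReal.ofReal lam * ∫⁻ y, fill g (dyadic n (ρ x)) y) := by
    intro n
    set q : Plane → ℤ := fun x => ⌊2 ^ n * ρ x⌋ with hq
    have hqm : Measurable q := Int.measurable_floor.comp (measurable_const.mul hρ)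
    set c : ℤ → ℝ := fun k => k / 2 ^ n
    have hqc : ∀ x, dyadic n (ρ x) = c (q x) := fun x => rfl
    have hAk : ∀ k, MeasurableSet (A ∩ q ⁻¹' {k}) := fun k =>
      hA.inter (hqm (measurableSet_singleton k))
    have hsplit : ∀ (x : Plane) (F : ℤ → ℝ≥0∞), A.indicator 1 x * F (q x) =
        ∑' k, (A ∩ q ⁻¹' {k}).indicator 1 x * F k := by
      intro x F
      rw [tsum_eq_single (q x)]
      · by_cases hx : x ∈ A <;> simp [hx]
      · intro k hk
        rw [indicator_of_notMem, zero_mul]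
        exact fun h => hk h.2.symm
    have hL : ∀ ω i, A.indicator 1 (X i ω) * infProd (Function.update
        (fun j => 1 - fill g (dyadic n (ρ (X i ω))) (X j ω)) i 1) =
        ∑' k, (A ∩ q ⁻¹' {k}).indicator 1 (X i ω) * infProd (Function.update
        (fun j => 1 - fill g (c k) (X j ω)) i 1) := by
      intro ω i
      rw [← hsplit (X i ω) fun k => infProd (Function.update
        (fun j => 1 - fill g (c k) (X j ω)) i 1)]
      simp only [hqc]
    have hmeas : ∀ k i, Measurable fun ω => (A ∩ q ⁻¹' {k}).indicator (1 : Plane → ℝ≥0∞) (X i ω) *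
        infProd (Function.update (fun j => 1 - fill g (c k) (X j ω)) i 1) := fun k i =>
      ((measurable_one.indicator (hAk k)).comp (hX.measurable i)).mul
        (measurable_infProd_update (fun j => measurable_const.sub
          ((measurable_fill hg).comp (measurable_const.prodMk (hX.measurable j)))) i)
    simp_rw [hL]
    have hswap : ∀ ω, ∑' i, ∑' k, (A ∩ q ⁻¹' {k}).indicator (1 : Plane → ℝ≥0∞) (X i ω) *
        infProd (Function.update (fun j => 1 - fill g (c k) (X j ω)) i 1) =
        ∑' k, ∑' i, (A ∩ q ⁻¹' {k}).indicator (1 : Plane → ℝ≥0∞) (X i ω) *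
        infProd (Function.update (fun j => 1 - fill g (c k) (X j ω)) i 1) :=
      fun ω => ENNReal.tsum_comm
    simp_rw [hswap]
    rw [lintegral_tsum fun k => (Measurable.tsum (hmeas k)).aemeasurable,
      ← lintegral_indicator hA]
    have hR : ∀ x, A.indicator (fun x => ENNReal.ofReal lam *
        expNeg (ENNReal.ofReal lam * ∫⁻ y, fill g (dyadic n (ρ x)) y)) x =
        ∑' k, (A ∩ q ⁻¹' {k}).indicator 1 x * (ENNReal.ofReal lam *
        expNeg (ENNReal.ofReal lam * ∫⁻ y, fill g (c k) y)) := by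
      intro x
      rw [← hsplit x fun k => ENNReal.ofReal lam *
        expNeg (ENNReal.ofReal lam * ∫⁻ y, fill g (c k) y), ← hqc]
      by_cases hx : x ∈ A <;> simp [hx]
    simp_rw [hR]
    rw [lintegral_tsum fun k =>
      ((measurable_one.indicator (hAk k)).mul_const _).aemeasurable]
    refine tsum_congr fun k => ?_
    rw [hX.lintegral_tsum_infProd hlam (hAk k) (hb.subset inter_subset_left) (g := fill g (c k))
      ((measurable_fill hg).comp (measurable_const.prodMk measurable_id)) (fill_le_one hg1 _),
      lintegral_mul_const _ (measurable_one.indicator (hAk k)), lintegral_indicator_one (hAk k)]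
    ring
  have h := hX.lintegral_tsum_infProd_iInf hlam hA hb
    (u := fun n i j ω => 1 - fill g (dyadic n (ρ (X i ω))) (X j ω))
    (fun n i j => measurable_const.sub ((measurable_fill hg).comp
      (((hdm n).comp (hρ.comp (hX.measurable i))).prodMk (hX.measurable j))))
    (fun _ j ω m n hmn => tsub_le_tsub_left (fill_mono hg1 (monotone_dyadic _ hmn) _) 1)
    (fun _ _ _ _ => tsub_le_self)
  simp only [← one_sub_iSup, iSup_fill_dyadic hg1] at h
  rw [h]
  simp_rw [hn]
  have hlim : ∀ x, ∫⁻ y, fill g (ρ x) y = ⨆ n, ∫⁻ y, fill g (dyadic n (ρ x)) y := by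
    intro x
    rw [← lintegral_iSup]
    · simp only [iSup_fill_dyadic hg1]
    · exact fun n => (measurable_fill hg).comp (measurable_const.prodMk measurable_id)
    · exact fun m n hmn y => fill_mono hg1 (monotone_dyadic _ hmn) y
  simp_rw [hlim, ENNReal.mul_iSup, expNeg_iSup]
  rw [← lintegral_iInf]
  · refine lintegral_congr fun x => ?_
    rw [ENNReal.mul_iInf' (fun h => absurd h ENNReal.ofReal_ne_top) (fun _ => ⟨0⟩)]
  · exact fun n => (measurable_expNeg.comp ((hfm n).const_mul _)).const_mul _
  · intro m n hmn x
    refine mul_le_mul_right (antitone_expNeg (mul_le_mul_right (lintegral_mono fun y => ?_) _)) _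
    exact fill_mono hg1 (monotone_dyadic _ hmn) y
  · refine ((lintegral_mono (g := fun _ => ENNReal.ofReal lam) fun x =>
      mul_le_of_le_one_right' (expNeg_le_one _)).trans_lt ?_).ne
    rw [setLIntegral_const]
    exact ENNReal.mul_lt_top ENNReal.ofReal_lt_top hb.measure_lt_top

/-- The intensity measure of a Poisson process. -/
theorem lintegral_tsum_comp (hX : IsHomogeneousPPP P lam X) (hlam : 0 ≤ lam) {f : Plane → ℝ≥0∞}
    (hf : Measurable f) :
    ∫⁻ ω, ∑' i, f (X i ω) ∂P = ENNReal.ofReal lam * ∫⁻ x, f x := by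
  have key : Measure.sum (fun i => P.map (X i)) = ENNReal.ofReal lam • volume := by
    have hball : ∀ A, MeasurableSet A → Bornology.IsBounded A →
        Measure.sum (fun i => P.map (X i)) A =
          (ENNReal.ofReal lam • (volume : Measure Plane)) A := by
      intro A hA hb
      rw [Measure.sum_apply _ hA, Measure.smul_apply, smul_eq_mul,
        ← hX.lintegral_tsum_indicator_of_isBounded hlam hA hb, lintegral_tsum]
      · refine tsum_congr fun i => ?_
        rw [Measure.map_apply (hX.measurable i) hA,
          ← lintegral_indicator_one (hX.measurable i hA)]
        rfl
      · exact fun i => ((measurable_one.indicator hA).comp (hX.measurable i)).aemeasurable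
    refine Measure.ext fun A hA => ?_
    have hU : A = ⋃ n : ℕ, A ∩ Metric.ball 0 n := by
      rw [← inter_iUnion, Metric.iUnion_ball_nat, inter_univ]
    have hmono : Monotone fun n : ℕ => A ∩ Metric.ball (0 : Plane) n := fun m n hmn =>
      inter_subset_inter_right _ (Metric.ball_subset_ball (by exact_mod_cast hmn))
    rw [hU, hmono.measure_iUnion, hmono.measure_iUnion]
    exact iSup_congr fun n => hball _ (hA.inter measurableSet_ball)
      (Metric.isBounded_ball.subset inter_subset_right)
  rw [lintegral_tsum (f := fun i ω => f (X i ω)) fun i => (hf.comp (hX.measurable i)).aemeasurable]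
  have h := congr_arg (fun μ => ∫⁻ x, f x ∂μ) key
  simp only [lintegral_sum_measure, lintegral_smul_measure, smul_eq_mul] at h
  rw [← h]
  exact tsum_congr fun i => (lintegral_map hf (hX.measurable i)).symm

end IsHomogeneousPPP

end PointProcess

/-! ### Independent marks -/

section Marking

variable {Ω : Type*} [MeasurableSpace Ω] {P : Measure Ω} {X : ℕ → Ω → Plane}
  {S : Type*} [MeasurableSpace S] {M : ℕ → Ω → S} {K : Kernel Plane S}

namespace IsIndependentMarking

/-- Conditional independence of the marks, tested against functions of the points. -/
lemma setLIntegral_comp (hM : IsIndependentMarking P X M K) (hX : ∀ i, Measurable (X i))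
    (s : Finset ℕ) {A : ℕ → Set S} (hA : ∀ i, MeasurableSet (A i))
    {k : (ℕ → Plane) → ℝ≥0∞} (hk : Measurable k) :
    ∫⁻ ω in {ω | ∀ i ∈ s, M i ω ∈ A i}, k (fun i => X i ω) ∂P =
      ∫⁻ ω, (∏ i ∈ s, K (X i ω) (A i)) * k (fun i => X i ω) ∂P := by
  have hXm : Measurable fun ω i => X i ω := measurable_pi_lambda _ hX
  have hmp : Measurable fun x : ℕ → Plane => ∏ i ∈ s, K (x i) (A i) :=
    Finset.measurable_prod _ fun i _ => (K.measurable_coe (hA i)).comp (measurable_pi_apply i)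
  have hE : MeasurableSet {ω | ∀ i ∈ s, M i ω ∈ A i} := by
    have : {ω | ∀ i ∈ s, M i ω ∈ A i} = ⋂ i ∈ s, M i ⁻¹' A i := by
      ext ω
      simp
    rw [this]
    exact Finset.measurableSet_biInter s fun i _ => hM.measurable i (hA i)
  have h : (P.restrict {ω | ∀ i ∈ s, M i ω ∈ A i}).map (fun ω i => X i ω) =
      (P.map fun ω i => X i ω).withDensity fun x => ∏ i ∈ s, K (x i) (A i) := by
    refine Measure.ext fun B hB => ?_
    rw [Measure.map_apply hXm hB, Measure.restrict_apply (hXm hB), withDensity_apply _ hB,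
      setLIntegral_map hB hmp hXm]
    exact hM.cond_law s A hA B hB
  rw [← lintegral_map hk hXm, h, lintegral_withDensity_eq_lintegral_mul _ hmp hk,
    lintegral_map (hmp.mul hk) hXm]
  rfl

/-- A single mark can be integrated out: given the points and the other marks, it has the law
prescribed by the position of its point. -/
lemma lintegral_update [IsProbabilityMeasure P] [IsMarkovKernel K]
    (hM : IsIndependentMarking P X M K) (hX : ∀ i, Measurable (X i)) (i : ℕ)
    {F : (ℕ → Plane) × (ℕ → S) → ℝ≥0∞} (hF : Measurable F) :
    ∫⁻ ω, F (fun j => X j ω, fun j => M j ω) ∂P =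
      ∫⁻ ω, ∫⁻ m, F (fun j => X j ω, Function.update (fun j => M j ω) i m) ∂K (X i ω) ∂P := by
  have hXm : Measurable fun ω j => X j ω := measurable_pi_lambda _ hX
  have hMm : Measurable fun ω j => M j ω := measurable_pi_lambda _ hM.measurable
  have hZ : Measurable fun ω => ((fun j => X j ω, fun j => M j ω) : (ℕ → Plane) × (ℕ → S)) :=
    hXm.prodMk hMm
  have hev : Measurable fun z : (ℕ → Plane) × (ℕ → S) => z.1 i :=
    (measurable_pi_apply i).comp measurable_fst
  have hup : Measurable fun p : ((ℕ → Plane) × (ℕ → S)) × S =>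
      (p.1.1, Function.update p.1.2 i p.2) := by
    refine (measurable_fst.comp measurable_fst).prodMk (measurable_pi_lambda _ fun j => ?_)
    by_cases hj : j = i
    · subst hj
      simpa using measurable_snd
    · simp only [Function.update_of_ne hj]
      exact (measurable_pi_apply j).comp (measurable_snd.comp measurable_fst)
  set μ : Measure ((ℕ → Plane) × (ℕ → S)) :=
    P.map fun ω => (fun j => X j ω, fun j => M j ω) with hμ
  have : IsProbabilityMeasure μ := Measure.isProbabilityMeasure_map hZ.aemeasurable
  set κ : Kernel ((ℕ → Plane) × (ℕ → S)) S := K.comap (fun z => z.1 i) hev with hκ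
  have hrect : ∀ (B : Set (ℕ → Plane)), MeasurableSet B → ∀ (s : Finset ℕ), i ∉ s →
      ∀ t : ℕ → Set S, (∀ j, MeasurableSet (t j)) →
      μ (B ×ˢ ((insert i s : Finset ℕ) : Set ℕ).pi t) =
        ((μ ⊗ₘ κ).map fun p => (p.1.1, Function.update p.1.2 i p.2))
          (B ×ˢ ((insert i s : Finset ℕ) : Set ℕ).pi t) := by
    intro B hB s hi t ht
    have hC : MeasurableSet (B ×ˢ ((insert i s : Finset ℕ) : Set ℕ).pi t) :=
      hB.prod (MeasurableSet.pi (Finset.countable_toSet _) fun j _ => ht j)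
    have hk : Measurable fun x : ℕ → Plane => B.indicator 1 x * K (x i) (t i) :=
      (measurable_one.indicator hB).mul
        ((K.measurable_coe (ht i)).comp (measurable_pi_apply i))
    have h1 := hM.setLIntegral_comp hX s ht hk
    have hE : MeasurableSet {ω | ∀ j ∈ s, M j ω ∈ t j} := by
      have : {ω | ∀ j ∈ s, M j ω ∈ t j} = ⋂ j ∈ s, M j ⁻¹' t j := by
        ext ω
        simp
      rw [this]
      exact Finset.measurableSet_biInter s fun j _ => hM.measurable j (ht j)
    rw [Measure.map_apply hup hC, Measure.compProd_apply (hup hC), hμ,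
      Measure.map_apply hZ hC, lintegral_map (Kernel.measurable_kernel_prodMk_left (hup hC)) hZ]
    have h2 : ∀ ω, κ (fun j => X j ω, fun j => M j ω)
        (Prod.mk (fun j => X j ω, fun j => M j ω) ⁻¹'
          ((fun p : ((ℕ → Plane) × (ℕ → S)) × S => (p.1.1, Function.update p.1.2 i p.2)) ⁻¹'
            (B ×ˢ ((insert i s : Finset ℕ) : Set ℕ).pi t))) =
        {ω | ∀ j ∈ s, M j ω ∈ t j}.indicator
          (fun ω => B.indicator 1 (fun j => X j ω) * K (X i ω) (t i)) ω := by
      intro ω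
      rw [hκ, Kernel.comap_apply]
      have hset : (Prod.mk (fun j => X j ω, fun j => M j ω) ⁻¹'
          ((fun p : ((ℕ → Plane) × (ℕ → S)) × S => (p.1.1, Function.update p.1.2 i p.2)) ⁻¹'
            (B ×ˢ ((insert i s : Finset ℕ) : Set ℕ).pi t))) =
          {m | (fun j => X j ω) ∈ B ∧ (∀ j ∈ s, M j ω ∈ t j) ∧ m ∈ t i} := by
        ext m
        simp only [mem_preimage, mem_prod, Set.mem_pi, Finset.mem_coe, Finset.mem_insert,
          forall_eq_or_imp, Function.update_self, mem_ofPred_eq]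
        refine and_congr_right fun _ => ?_
        rw [and_comm]
        refine and_congr_left fun _ => forall₂_congr fun j hj => ?_
        rw [Function.update_of_ne (ne_of_mem_of_not_mem hj hi)]
      rw [hset]
      by_cases hb : (fun j => X j ω) ∈ B
      · by_cases hc : ∀ j ∈ s, M j ω ∈ t j
        · simp [indicator, hb, eq_true hc]
        · simp [indicator, hb, eq_false hc]
      · simp [indicator, hb]
    rw [lintegral_congr h2, lintegral_indicator hE, h1]
    have h3 := hM.cond_law (insert i s) t ht B hB
    have h4 : (fun ω => ((fun j => X j ω, fun j => M j ω) : (ℕ → Plane) × (ℕ → S))) ⁻¹'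
        (B ×ˢ ((insert i s : Finset ℕ) : Set ℕ).pi t) =
        {ω | (fun j => X j ω) ∈ B ∧ ∀ j ∈ insert i s, M j ω ∈ t j} := by
      ext ω
      simp only [mem_preimage, mem_prod, Set.mem_pi, Finset.mem_coe, mem_ofPred_eq]
    have hB' : MeasurableSet {ω | (fun j => X j ω) ∈ B} := hXm hB
    rw [h4, h3, ← lintegral_indicator hB']
    refine lintegral_congr fun ω => ?_
    by_cases hb : (fun j => X j ω) ∈ B
    · rw [indicator_of_mem (show ω ∈ {ω | (fun j => X j ω) ∈ B} from hb), indicator_of_mem hb,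
        Finset.prod_insert hi, Pi.one_apply, one_mul, mul_comm]
    · rw [indicator_of_notMem (show ω ∉ {ω | (fun j => X j ω) ∈ B} from hb),
        indicator_of_notMem hb, zero_mul, mul_zero]
  have key : μ = (μ ⊗ₘ κ).map fun p => (p.1.1, Function.update p.1.2 i p.2) := by
    have : IsProbabilityMeasure
        ((μ ⊗ₘ κ).map fun p => (p.1.1, Function.update p.1.2 i p.2)) :=
      Measure.isProbabilityMeasure_map hup.aemeasurable
    refine ext_of_generate_finite (image2 (· ×ˢ ·) {B : Set (ℕ → Plane) | MeasurableSet B}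
      (squareCylinders fun _ : ℕ => {s : Set S | MeasurableSet s}))
      (generateFrom_eq_prod MeasurableSpace.generateFrom_measurableSet generateFrom_squareCylinders
        isCountablySpanning_measurableSet ?_).symm
      (MeasurableSpace.isPiSystem_measurableSet.prod (isPiSystem_squareCylinders
        (fun _ => MeasurableSpace.isPiSystem_measurableSet) fun _ => MeasurableSet.univ)) ?_
      (by simp)
    · exact ⟨fun _ => univ, fun _ => ⟨∅, fun _ => univ, fun _ _ => MeasurableSet.univ, by simp⟩,
        iUnion_const _⟩
    · rintro _ ⟨B, hB, _, ⟨s, t, ht, rfl⟩, rfl⟩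
      have ht' : ∀ j, MeasurableSet (t j) := fun j => ht j (mem_univ j)
      by_cases hi : i ∈ s
      · have := hrect B hB (s.erase i) (Finset.notMem_erase i s) t ht'
        rwa [Finset.insert_erase hi] at this
      · have h5 := hrect B hB s hi (Function.update t i univ) fun j => by
          by_cases hj : j = i
          · subst hj
            simp
          · simpa [Function.update_of_ne hj] using ht' j
        have h6 : ((insert i s : Finset ℕ) : Set ℕ).pi (Function.update t i univ) =
            (s : Set ℕ).pi t := by
          ext m
          simp only [Set.mem_pi, Finset.mem_coe, Finset.mem_insert, forall_eq_or_imp,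
            Function.update_self, mem_univ, true_and]
          refine forall₂_congr fun j hj => ?_
          rw [Function.update_of_ne (ne_of_mem_of_not_mem hj hi)]
        rwa [h6] at h5
  rw [← lintegral_map hF hZ, ← hμ]
  conv_lhs => rw [key]
  rw [lintegral_map hF hup, Measure.lintegral_compProd (f := fun p : ((ℕ → Plane) × (ℕ → S)) × S =>
      F (p.1.1, Function.update p.1.2 i p.2)) (hF.comp hup), hμ,
    lintegral_map (f := fun z => ∫⁻ m, F (z.1, Function.update z.2 i m) ∂κ z)
      ((hF.comp hup).lintegral_kernel_prod_right') hZ]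
  rfl

/-- Integrating out finitely many marks, one after the other. -/
lemma lintegral_prod [IsProbabilityMeasure P] [IsMarkovKernel K]
    (hM : IsIndependentMarking P X M K) (hX : ∀ i, Measurable (X i)) (s : Finset ℕ)
    {φ : ℕ → Plane × S → ℝ≥0∞} (hφ : ∀ j, Measurable (φ j)) {G : (ℕ → Plane) → ℝ≥0∞}
    (hG : Measurable G) :
    ∫⁻ ω, G (fun j => X j ω) * ∏ j ∈ s, φ j (X j ω, M j ω) ∂P =
      ∫⁻ ω, G (fun j => X j ω) * ∏ j ∈ s, ∫⁻ m, φ j (X j ω, m) ∂K (X j ω) ∂P := by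
  induction s using Finset.induction_on generalizing G with
  | empty => simp
  | insert i s hi ih =>
    have hψ : Measurable fun x : Plane => ∫⁻ m, φ i (x, m) ∂K x :=
      (hφ i).lintegral_kernel_prod_right'
    have hpair : ∀ j, Measurable fun z : (ℕ → Plane) × (ℕ → S) => (z.1 j, z.2 j) := fun j =>
      ((measurable_pi_apply j).comp measurable_fst).prodMk
        ((measurable_pi_apply j).comp measurable_snd)
    have h1 := hM.lintegral_update hX i
      (F := fun z => G z.1 * ∏ j ∈ insert i s, φ j (z.1 j, z.2 j))
      ((hG.comp measurable_fst).mul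
        (Finset.measurable_prod _ fun j _ => (hφ j).comp (hpair j)))
    rw [h1]
    have h2 : ∀ ω, ∫⁻ m, G (fun j => X j ω) * ∏ j ∈ insert i s,
        φ j (X j ω, Function.update (fun j => M j ω) i m j) ∂K (X i ω) =
        (G (fun j => X j ω) * ∫⁻ m, φ i (X i ω, m) ∂K (X i ω)) *
          ∏ j ∈ s, φ j (X j ω, M j ω) := by
      intro ω
      have h3 : ∀ m, G (fun j => X j ω) * ∏ j ∈ insert i s,
          φ j (X j ω, Function.update (fun j => M j ω) i m j) =
          (G (fun j => X j ω) * ∏ j ∈ s, φ j (X j ω, M j ω)) * φ i (X i ω, m) := by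
        intro m
        rw [Finset.prod_insert hi, Function.update_self, mul_assoc, mul_comm (φ i _)]
        congr 2
        refine Finset.prod_congr rfl fun j hj => ?_
        rw [Function.update_of_ne (ne_of_mem_of_not_mem hj hi)]
      simp_rw [h3]
      rw [lintegral_const_mul _ (f := fun m => φ i (X i ω, m))
        ((hφ i).comp (measurable_const.prodMk measurable_id))]
      ring
    rw [lintegral_congr h2, ih (G := fun x => G x * ∫⁻ m, φ i (x i, m) ∂K (x i))
      (hG.mul (hψ.comp (measurable_pi_apply i)))]
    refine lintegral_congr fun ω => ?_
    rw [Finset.prod_insert hi, mul_assoc]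

/-- Integrating out all marks in an infinite product. -/
lemma lintegral_infProd [IsProbabilityMeasure P] [IsMarkovKernel K]
    (hM : IsIndependentMarking P X M K) (hX : ∀ i, Measurable (X i))
    {φ : ℕ → Plane × S → ℝ≥0∞} (hφ : ∀ j, Measurable (φ j)) (hφ1 : ∀ j p, φ j p ≤ 1)
    {G : (ℕ → Plane) → ℝ≥0∞} (hG : Measurable G) (hG1 : ∀ x, G x ≤ 1) :
    ∫⁻ ω, G (fun j => X j ω) * infProd (fun j => φ j (X j ω, M j ω)) ∂P =
      ∫⁻ ω, G (fun j => X j ω) * infProd (fun j => ∫⁻ m, φ j (X j ω, m) ∂K (X j ω)) ∂P := by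
  have hXm : Measurable fun ω j => X j ω := measurable_pi_lambda _ hX
  have hψ : ∀ j, Measurable fun x : Plane => ∫⁻ m, φ j (x, m) ∂K x := fun j =>
    (hφ j).lintegral_kernel_prod_right'
  have hψ1 : ∀ j x, ∫⁻ m, φ j (x, m) ∂K x ≤ 1 := fun j x =>
    (lintegral_mono fun m => hφ1 j (x, m)).trans (by simp)
  have hlim : ∀ u : ℕ → Ω → ℝ≥0∞, (∀ j, Measurable (u j)) → (∀ j ω, u j ω ≤ 1) →
      ∫⁻ ω, G (fun j => X j ω) * infProd (fun j => u j ω) ∂P =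
        ⨅ k, ∫⁻ ω, G (fun j => X j ω) * ∏ j ∈ Finset.range k, u j ω ∂P := by
    intro u hu hu1
    have h1 : ∀ ω, G (fun j => X j ω) * infProd (fun j => u j ω) =
        ⨅ k, G (fun j => X j ω) * ∏ j ∈ Finset.range k, u j ω := fun ω =>
      ENNReal.mul_iInf' (fun h => absurd h ((hG1 _).trans_lt ENNReal.one_lt_top).ne)
        fun _ => ⟨0⟩
    simp_rw [h1]
    refine lintegral_iInf (fun k => (hG.comp hXm).mul
      (Finset.measurable_prod _ fun j _ => hu j)) (fun k l hkl ω => ?_) ?_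
    · exact mul_le_mul_right (antitone_prod_range (fun j => hu1 j ω) hkl) _
    · refine ne_top_of_le_ne_top ENNReal.one_ne_top
        ((lintegral_mono (g := fun _ => 1) fun ω => ?_).trans (by simp))
      simpa using hG1 _
  rw [hlim (fun j ω => φ j (X j ω, M j ω))
      (fun j => (hφ j).comp ((hX j).prodMk (hM.measurable j))) fun j ω => hφ1 j _,
    hlim (fun j ω => ∫⁻ m, φ j (X j ω, m) ∂K (X j ω))
      (fun j => (hψ j).comp (hX j)) fun j ω => hψ1 j _]
  exact iInf_congr fun k => hM.lintegral_prod hX _ hφ hG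

lemma ae_mem [IsProbabilityMeasure P] [IsMarkovKernel K]
    (hM : IsIndependentMarking P X M K) {A : Set S} (hA : MeasurableSet A)
    (hK : ∀ x, K x Aᶜ = 0) : ∀ᵐ ω ∂P, ∀ i, M i ω ∈ A := by
  refine ae_all_iff.2 fun i => ?_
  have h := hM.cond_law {i} (fun _ => Aᶜ) (fun _ => hA.compl) univ MeasurableSet.univ
  simp only [Finset.prod_singleton, hK, lintegral_zero, mem_univ, true_and,
    Finset.mem_singleton, forall_eq] at h
  exact h

end IsIndependentMarking

end Marking

/-! ### Polar coordinates -/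

lemma lintegral_comp_norm {f : ℝ → ℝ≥0∞} (hf : Measurable f) :
    ∫⁻ x : Plane, f ‖x‖ = ∫⁻ r in Ioi (0 : ℝ), ENNReal.ofReal (2 * Real.pi * r) * f r := by
  have hdim : Module.finrank ℝ Plane = 2 := by simp
  have hmp := Measure.measurePreserving_homeomorphUnitSphereProd (volume : Measure Plane)
  have hsphere : (volume : Measure Plane).toSphere univ = ENNReal.ofReal (2 * Real.pi) := by
    rw [Measure.toSphere_apply_univ, EuclideanSpace.volume_ball_fin_two, hdim,
      ENNReal.ofReal_mul zero_le_two]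
    simp [ENNReal.ofReal]
  calc ∫⁻ x : Plane, f ‖x‖ = ∫⁻ x in ({0}ᶜ : Set Plane), f ‖x‖ := by
        rw [restrict_compl_singleton]
    _ = ∫⁻ x : ({0}ᶜ : Set Plane), f ‖(x : Plane)‖ ∂(Measure.comap Subtype.val volume) :=
        (lintegral_subtype_comap (measurableSet_singleton _).compl fun x : Plane => f ‖x‖).symm
    _ = ∫⁻ p, f p.2 ∂((volume : Measure Plane).toSphere.prod
          (Measure.volumeIoiPow (Module.finrank ℝ Plane - 1))) := by
        rw [← hmp.lintegral_comp (f := fun p => f p.2)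
          (hf.comp (measurable_subtype_coe.comp measurable_snd))]
        simp
    _ = ENNReal.ofReal (2 * Real.pi) * ∫⁻ r : Ioi (0 : ℝ), f r ∂(Measure.volumeIoiPow 1) := by
        rw [lintegral_prod (fun p : Metric.sphere (0 : Plane) 1 × Ioi (0 : ℝ) => f p.2)
          (hf.comp (measurable_subtype_coe.comp measurable_snd)).aemeasurable]
        simp only [lintegral_const, hsphere, hdim]
        rw [mul_comm]
    _ = ENNReal.ofReal (2 * Real.pi) * ∫⁻ r in Ioi (0 : ℝ), ENNReal.ofReal r * f r := by
        rw [Measure.volumeIoiPow, lintegral_withDensity_eq_lintegral_mul _ (by fun_prop)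
          (g := fun r : Ioi (0 : ℝ) => f r) (hf.comp measurable_subtype_coe)]
        simp only [pow_one]
        congr 1
        exact lintegral_subtype_comap measurableSet_Ioi fun r : ℝ => ENNReal.ofReal r * f r
    _ = _ := by
        rw [← lintegral_const_mul _ (f := fun r => ENNReal.ofReal r * f r)
          (ENNReal.measurable_ofReal.mul hf)]
        refine setLIntegral_congr_fun measurableSet_Ioi fun r hr => ?_
        rw [← mul_assoc, ← ENNReal.ofReal_mul (by positivity)]

/-! ### The Gamma distribution -/

lemma measurable_gammaPDF (a r : ℝ) : Measurable (gammaPDF a r) :=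
  (measurable_gammaPDFReal a r).ennreal_ofReal

lemma ae_pos_gammaMeasure (a r : ℝ) : ∀ᵐ x ∂gammaMeasure a r, 0 < x := by
  rw [gammaMeasure, ae_withDensity_iff (measurable_gammaPDF a r)]
  have h0 : ∀ᵐ x : ℝ, x ≠ 0 := by simp [ae_iff]
  filter_upwards [h0] with x hx h
  by_contra hneg
  exact h (gammaPDF_of_neg (lt_of_le_of_ne (not_lt.1 hneg) hx))

/-- The Laplace transform of a Gamma distribution. -/
lemma lintegral_exp_gammaMeasure {a r t : ℝ} (ha : 0 < a) (hr : 0 < r) (ht : 0 ≤ t) :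
    ∫⁻ x, ENNReal.ofReal (Real.exp (-(t * x))) ∂gammaMeasure a r =
      ENNReal.ofReal ((r / (r + t)) ^ a) := by
  have hrt : 0 < r + t := by linarith
  rw [gammaMeasure, lintegral_withDensity_eq_lintegral_mul _
    (measurable_gammaPDF a r) (by fun_prop)]
  -- tilting by `exp (-t x)` changes the rate from `r` to `r + t`
  have h : ∀ x, gammaPDF a r x * ENNReal.ofReal (Real.exp (-(t * x))) =
      ENNReal.ofReal ((r / (r + t)) ^ a) * gammaPDF a (r + t) x := by
    intro x
    rcases lt_or_ge x 0 with hx | hx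
    · simp [gammaPDF_of_neg hx]
    · rw [gammaPDF_of_nonneg hx, gammaPDF_of_nonneg hx, ← ENNReal.ofReal_mul',
        ← ENNReal.ofReal_mul']
      · congr 1
        have e : Real.exp (-((r + t) * x)) = Real.exp (-(r * x)) * Real.exp (-(t * x)) := by
          rw [← Real.exp_add]
          ring_nf
        rw [e, Real.div_rpow hr.le hrt.le]
        have := (Real.rpow_pos_of_pos hrt a).ne'
        field_simp
      · have := Real.Gamma_pos_of_pos ha
        positivity
      · positivity
  simp only [Pi.mul_apply, h]
  rw [lintegral_const_mul _ (measurable_gammaPDF a (r + t)),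
    lintegral_gammaPDF_eq_one ha hrt, mul_one]

/-- The partial sum `e^{-x} ∑_{k<m} x^k / k!` of the exponential series: the tail of the Gamma
distribution with integer shape `m`. -/
def erlangTail (m : ℕ) (x : ℝ) : ℝ :=
  ∑ k ∈ Finset.range m, x ^ k / k.factorial * Real.exp (-x)

lemma erlangTail_nonneg (m : ℕ) {x : ℝ} (hx : 0 ≤ x) : 0 ≤ erlangTail m x :=
  Finset.sum_nonneg fun k _ => by positivity

lemma continuous_erlangTail (m : ℕ) : Continuous (erlangTail m) := by
  unfold erlangTail
  fun_prop

lemma tendsto_erlangTail (m : ℕ) : Tendsto (erlangTail m) atTop (𝓝 0) := by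
  have h : ∀ k ∈ Finset.range m, Tendsto
      (fun x : ℝ => x ^ k / k.factorial * Real.exp (-x)) atTop (𝓝 0) := fun k _ => by
    have := (Real.tendsto_pow_mul_exp_neg_atTop_nhds_zero k).div_const (k.factorial : ℝ)
    rw [zero_div] at this
    exact this.congr fun x => by ring
  have h' := tendsto_finsetSum _ h
  rwa [Finset.sum_const_zero] at h'

/-- The derivative of the partial sum telescopes to its last term, the Gamma density. -/
lemma hasDerivAt_erlangTail (m : ℕ) (x : ℝ) :
    HasDerivAt (erlangTail (m + 1)) (-(x ^ m / m.factorial * Real.exp (-x))) x := by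
  induction m with
  | zero =>
    have : erlangTail 1 = fun x => Real.exp (-x) := by
      ext x
      simp [erlangTail]
    rw [this]
    simpa using (hasDerivAt_neg x).exp
  | succ m ih =>
    have h1 : erlangTail (m + 1 + 1) = fun x => erlangTail (m + 1) x +
        x ^ (m + 1) / (m + 1).factorial * Real.exp (-x) := by
      ext x
      rw [erlangTail, Finset.sum_range_succ, ← erlangTail]
    rw [h1]
    have h2 := ((hasDerivAt_pow (m + 1) x).div_const ((m + 1).factorial : ℝ)).mul
      (hasDerivAt_neg x).exp
    refine (ih.add h2).congr_deriv ?_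
    have h3 : (((m + 1 : ℕ) : ℝ)) * x ^ (m + 1 - 1) / (m + 1).factorial = x ^ m / m.factorial := by
      rw [Nat.factorial_succ, Nat.add_sub_cancel]
      push_cast
      field_simp
    rw [h3]
    ring

lemma gammaMeasure_Ioi {m : ℕ} (hm : 1 ≤ m) {r y : ℝ} (hr : 0 < r) (hy : 0 ≤ y) :
    gammaMeasure m r (Ioi y) = ENNReal.ofReal (erlangTail m (r * y)) := by
  obtain ⟨n, rfl⟩ : ∃ n, m = n + 1 := ⟨m - 1, by omega⟩
  have hmem : ∀ x ∈ Ioi y, 0 < x := fun x hx => hy.trans_lt hx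
  have hd : ∀ x ∈ Ici y, HasDerivAt (fun x => -erlangTail (n + 1) (r * x))
      (r * ((r * x) ^ n / n.factorial * Real.exp (-(r * x)))) x := by
    intro x _
    have h := ((hasDerivAt_erlangTail n (r * x)).comp x ((hasDerivAt_id x).const_mul r)).neg
    refine h.congr_deriv ?_
    ring
  have hlim : Tendsto (fun x => -erlangTail (n + 1) (r * x)) atTop (𝓝 0) := by
    simpa using ((tendsto_erlangTail (n + 1)).comp
      (tendsto_id.const_mul_atTop hr)).neg
  have hpos : ∀ x ∈ Ioi y, 0 ≤ r * ((r * x) ^ n / n.factorial * Real.exp (-(r * x))) := by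
    intro x hx
    have := hmem x hx
    positivity
  have hint := integrableOn_Ioi_deriv_of_nonneg
    (hd y self_mem_Ici).continuousAt.continuousWithinAt
    (fun x hx => hd x (mem_Ici_of_Ioi hx)) hpos hlim
  have h := integral_Ioi_of_hasDerivAt_of_tendsto' hd hint hlim
  rw [gammaMeasure, withDensity_apply _ measurableSet_Ioi,
    show erlangTail (n + 1) (r * y) = 0 - -erlangTail (n + 1) (r * y) by ring, ← h,
    ofReal_integral_eq_lintegral_ofReal hint
      ((ae_restrict_iff' measurableSet_Ioi).2 (Eventually.of_forall hpos))]
  refine setLIntegral_congr_fun measurableSet_Ioi fun x hx => ?_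
  rw [gammaPDF_of_nonneg (hmem x hx).le]
  congr 1
  push_cast
  rw [Real.Gamma_nat_eq_factorial, add_sub_cancel_right, Real.rpow_natCast, mul_pow,
    Real.rpow_add_one hr.ne', Real.rpow_natCast]
  ring

namespace Params

variable (N : Params)

/-! ### The exponent of the Laplace transform -/

lemma ellLOS_nonneg (r : ℝ) : 0 ≤ N.ellLOS r :=
  Real.rpow_nonneg (add_nonneg (sq_nonneg _) (sq_nonneg _)) _

lemma ellNLOS_nonneg (r : ℝ) : 0 ≤ N.ellNLOS r :=
  Real.rpow_nonneg (add_nonneg (sq_nonneg _) (sq_nonneg _)) _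

lemma ellLOS_pos {r : ℝ} (hr : 0 < r) : 0 < N.ellLOS r :=
  Real.rpow_pos_of_pos (add_pos_of_pos_of_nonneg (by positivity) (sq_nonneg _)) _

lemma ellNLOS_pos {r : ℝ} (hr : 0 < r) : 0 < N.ellNLOS r :=
  Real.rpow_pos_of_pos (add_pos_of_pos_of_nonneg (by positivity) (sq_nonneg _)) _

lemma measurable_ellLOS : Measurable N.ellLOS := by
  unfold ellLOS
  fun_prop

lemma measurable_ellNLOS : Measurable N.ellNLOS := by
  unfold ellNLOS
  fun_prop

lemma m_pos : (0 : ℝ) < N.m := by exact_mod_cast N.one_le_m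

/-- Away from the origin both pathlosses are dominated by `t ^ (-αLOS)`, which is integrable against
`t dt` because `αLOS > 2`. -/
lemma rpow_pathloss_le {α t : ℝ} (hα : N.αLOS ≤ α) (ht : 1 < t) :
    (t ^ 2 + N.h ^ 2) ^ (-(α / 2)) ≤ t ^ (-N.αLOS) := by
  have h2 := N.two_lt_αLOS
  have ht0 : 0 < t := by linarith
  calc (t ^ 2 + N.h ^ 2) ^ (-(α / 2)) ≤ (t ^ 2) ^ (-(α / 2)) :=
        Real.rpow_le_rpow_of_nonpos (by positivity) (by nlinarith [sq_nonneg N.h]) (by linarith)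
    _ = t ^ (-α) := by
        rw [← Real.rpow_natCast, ← Real.rpow_mul ht0.le]
        congr 1
        push_cast
        ring
    _ ≤ t ^ (-N.αLOS) := Real.rpow_le_rpow_of_exponent_le ht.le (by linarith)

/-- The NLOS part `1 - 1 / (1 + s ℓ)` of the exponent. -/
def lossNLOS (s t : ℝ) : ℝ := 1 - 1 / (1 + s * N.ellNLOS t)

/-- The LOS part `1 - 1 / (1 + s ℓ / m) ^ m` of the exponent. -/
def lossLOS (s t : ℝ) : ℝ := 1 - 1 / (1 + s / N.m * N.ellLOS t) ^ N.m

/-- One minus the Laplace transform at `s` of the power received from a base station at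
distance `t`. -/
def loss (s t : ℝ) : ℝ := N.lossNLOS s t + N.pLOS t * (N.lossLOS s t - N.lossNLOS s t)

lemma kernelNLOS_eq (s t : ℝ) : N.kernelNLOS s t = N.lossNLOS s t * t := rfl

lemma kernelCorrection_eq (s t : ℝ) :
    N.kernelCorrection s t = N.pLOS t * (N.lossLOS s t - N.lossNLOS s t) * t := by
  unfold kernelCorrection lossLOS lossNLOS
  ring

lemma kernel_add (s t : ℝ) : N.kernelNLOS s t + N.kernelCorrection s t = N.loss s t * t := by
  rw [kernelNLOS_eq, kernelCorrection_eq, loss]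
  ring

variable {s : ℝ}

lemma lossNLOS_mem (hs : 0 ≤ s) (t : ℝ) : N.lossNLOS s t ∈ Icc (0 : ℝ) 1 := by
  have h := mul_nonneg hs (N.ellNLOS_nonneg t)
  refine ⟨sub_nonneg.2 (div_le_one_of_le₀ (by linarith) (by linarith)), ?_⟩
  have : 0 ≤ 1 / (1 + s * N.ellNLOS t) := by positivity
  rw [lossNLOS]
  linarith

lemma lossLOS_mem (hs : 0 ≤ s) (t : ℝ) : N.lossLOS s t ∈ Icc (0 : ℝ) 1 := by
  have h := mul_nonneg (div_nonneg hs N.m_pos.le) (N.ellLOS_nonneg t)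
  have h1 : 1 ≤ (1 + s / N.m * N.ellLOS t) ^ N.m := one_le_pow₀ (by linarith)
  refine ⟨sub_nonneg.2 (div_le_one_of_le₀ h1 (by linarith)), ?_⟩
  have : 0 ≤ 1 / (1 + s / N.m * N.ellLOS t) ^ N.m := by positivity
  rw [lossLOS]
  linarith

lemma lossNLOS_le (hs : 0 ≤ s) (t : ℝ) : N.lossNLOS s t ≤ s * N.ellNLOS t := by
  have h := mul_nonneg hs (N.ellNLOS_nonneg t)
  rw [lossNLOS, sub_le_iff_le_add, ← sub_le_iff_le_add', le_div_iff₀ (by linarith)]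
  nlinarith

lemma lossLOS_le (hs : 0 ≤ s) (t : ℝ) : N.lossLOS s t ≤ s * N.ellLOS t := by
  have hm := N.m_pos
  set y := s / N.m * N.ellLOS t with hy
  have h : 0 ≤ y := mul_nonneg (div_nonneg hs hm.le) (N.ellLOS_nonneg t)
  have e : s * N.ellLOS t = N.m * y := by
    rw [hy]
    field_simp
  have hinv : 1 - y ≤ (1 + y)⁻¹ := by
    rw [← one_div, le_div_iff₀ (by linarith)]
    nlinarith
  -- Bernoulli's inequality for `(1 + y)⁻¹ = 1 + ((1 + y)⁻¹ - 1)`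
  have hb := one_add_mul_le_pow (a := (1 + y)⁻¹ - 1)
    (by have : 0 ≤ (1 + y)⁻¹ := by positivity
        linarith) N.m
  rw [add_sub_cancel, inv_pow] at hb
  rw [lossLOS, ← hy, e, one_div]
  nlinarith

lemma loss_mem (hs : 0 ≤ s) {t : ℝ} (ht : 0 ≤ t) : N.loss s t ∈ Icc (0 : ℝ) 1 := by
  obtain ⟨h1, h2⟩ := N.lossNLOS_mem hs t
  obtain ⟨h3, h4⟩ := N.lossLOS_mem hs t
  obtain ⟨h5, h6⟩ := N.pLOS_mem t ht
  rw [loss]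
  constructor <;> nlinarith

lemma measurable_lossNLOS (s : ℝ) : Measurable (N.lossNLOS s) := by
  have := N.measurable_ellNLOS
  unfold lossNLOS
  fun_prop

lemma measurable_lossLOS (s : ℝ) : Measurable (N.lossLOS s) := by
  have := N.measurable_ellLOS
  unfold lossLOS
  fun_prop

lemma measurable_loss (s : ℝ) : Measurable (N.loss s) :=
  (N.measurable_lossNLOS s).add
    (N.measurable_pLOS.mul ((N.measurable_lossLOS s).sub (N.measurable_lossNLOS s)))

lemma integrableOn_of_bounds {f : ℝ → ℝ} {C : ℝ} (hf : Measurable f)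
    (h0 : ∀ t, 0 < t → |f t| ≤ t) (h1 : ∀ t, 1 < t → |f t| ≤ C * t ^ (-N.αLOS) * t) :
    IntegrableOn f (Ioi 0) := by
  have hα := N.two_lt_αLOS
  rw [← Ioc_union_Ioi_eq_Ioi zero_le_one]
  refine IntegrableOn.union ?_ ?_
  · refine Measure.integrableOn_of_bounded (M := 1) measure_Ioc_lt_top.ne
      hf.aestronglyMeasurable ?_
    filter_upwards [ae_restrict_mem measurableSet_Ioc] with t ht
    exact (h0 t ht.1).trans ht.2
  · have hi : IntegrableOn (fun t : ℝ => C * t ^ (1 - N.αLOS)) (Ioi 1) :=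
      (integrableOn_Ioi_rpow_of_lt (by linarith) one_pos).const_mul C
    refine Integrable.mono' hi hf.aestronglyMeasurable ?_
    filter_upwards [ae_restrict_mem measurableSet_Ioi] with t ht
    have ht0 : 0 < t := one_pos.trans ht
    refine (h1 t ht).trans (le_of_eq ?_)
    rw [mul_assoc, ← Real.rpow_add_one ht0.ne']
    congr 2
    ring

lemma integrableOn_kernelNLOS (hs : 0 ≤ s) : IntegrableOn (N.kernelNLOS s) (Ioi 0) := by
  refine N.integrableOn_of_bounds (C := s) ((N.measurable_lossNLOS s).mul measurable_id)
    (fun t ht => ?_) fun t ht => ?_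
  · obtain ⟨h1, h2⟩ := N.lossNLOS_mem hs t
    rw [kernelNLOS_eq, abs_mul, abs_of_nonneg h1, abs_of_pos ht]
    exact mul_le_of_le_one_left ht.le h2
  · have ht0 : 0 < t := one_pos.trans ht
    obtain ⟨h1, h2⟩ := N.lossNLOS_mem hs t
    rw [kernelNLOS_eq, abs_mul, abs_of_nonneg h1, abs_of_pos ht0]
    have h3 := N.rpow_pathloss_le N.αLOS_le_αNLOS ht
    exact mul_le_mul_of_nonneg_right ((N.lossNLOS_le hs t).trans
      (mul_le_mul_of_nonneg_left h3 hs)) ht0.le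

lemma integrableOn_kernelCorrection (hs : 0 ≤ s) :
    IntegrableOn (N.kernelCorrection s) (Ioi 0) := by
  have hbound : ∀ t, 0 < t → ∀ c, N.lossNLOS s t ≤ c → N.lossLOS s t ≤ c →
      |N.kernelCorrection s t| ≤ c * t := by
    intro t ht c hc1 hc2
    obtain ⟨h1, h2⟩ := N.lossNLOS_mem hs t
    obtain ⟨h3, h4⟩ := N.lossLOS_mem hs t
    obtain ⟨h5, h6⟩ := N.pLOS_mem t ht.le
    rw [kernelCorrection_eq, abs_mul, abs_of_pos ht, abs_mul, abs_of_nonneg h5]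
    refine mul_le_mul_of_nonneg_right ?_ ht.le
    refine (mul_le_of_le_one_left (abs_nonneg _) h6).trans (abs_le.2 ⟨?_, ?_⟩) <;> linarith
  have hm : Measurable (N.kernelCorrection s) := by
    have : N.kernelCorrection s = fun t => N.pLOS t * (N.lossLOS s t - N.lossNLOS s t) * t :=
      funext (N.kernelCorrection_eq s)
    rw [this]
    exact (N.measurable_pLOS.mul
      ((N.measurable_lossLOS s).sub (N.measurable_lossNLOS s))).mul measurable_id
  refine N.integrableOn_of_bounds (C := s) hm (fun t ht => ?_) fun t ht => ?_
  · simpa using hbound t ht 1 (N.lossNLOS_mem hs t).2 (N.lossLOS_mem hs t).2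
  · refine hbound t (one_pos.trans ht) _ ?_ ?_
    · exact (N.lossNLOS_le hs t).trans (mul_le_mul_of_nonneg_left
        (N.rpow_pathloss_le N.αLOS_le_αNLOS ht) hs)
    · exact (N.lossLOS_le hs t).trans (mul_le_mul_of_nonneg_left
        (N.rpow_pathloss_le le_rfl ht) hs)

lemma integrableOn_loss_mul (hs : 0 ≤ s) : IntegrableOn (fun t => N.loss s t * t) (Ioi 0) := by
  refine ((N.integrableOn_kernelNLOS hs).add (N.integrableOn_kernelCorrection hs)).congr ?_
  exact Eventually.of_forall fun t => N.kernel_add s t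

lemma laplace_eq (a : Association) {r : ℝ} (hr : 0 ≤ nu a r) (hs : 0 ≤ s) :
    N.laplace a r s =
      Real.exp (-(2 * Real.pi * N.lam * ∫ t in Ioi (nu a r), N.loss s t * t)) := by
  have hsub : Ioi (nu a r) ⊆ Ioi 0 := Ioi_subset_Ioi hr
  rw [laplace, laplaceNLOS, ← Real.exp_add]
  congr 1
  have h : ∫ t in Ioi (nu a r), N.loss s t * t = (∫ t in Ioi (nu a r), N.kernelNLOS s t) +
      ∫ t in Ioi (nu a r), N.kernelCorrection s t := by
    rw [← integral_add ((N.integrableOn_kernelNLOS hs).mono_set hsub)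
      ((N.integrableOn_kernelCorrection hs).mono_set hsub)]
    exact integral_congr_ae (Eventually.of_forall fun t => (N.kernel_add s t).symm)
  rw [h]
  ring

/-- `loss` as a function on the plane. -/
def lossPlane (s : ℝ) (y : Plane) : ℝ≥0∞ := ENNReal.ofReal (N.loss s ‖y‖)

lemma measurable_lossPlane (s : ℝ) : Measurable (N.lossPlane s) :=
  ((N.measurable_loss s).comp measurable_norm).ennreal_ofReal

lemma lossPlane_le_one (hs : 0 ≤ s) (y : Plane) : N.lossPlane s y ≤ 1 := by
  rw [lossPlane, ENNReal.ofReal_le_one]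
  exact (N.loss_mem hs (norm_nonneg y)).2

lemma lintegral_indicator_lossPlane (hs : 0 ≤ s) {ρ : ℝ} (hρ : 0 ≤ ρ) :
    ENNReal.ofReal N.lam * ∫⁻ y, {y : Plane | ρ ≤ ‖y‖}.indicator (N.lossPlane s) y =
      ENNReal.ofReal (2 * Real.pi * N.lam * ∫ t in Ioi ρ, N.loss s t * t) := by
  have hlam := N.lam_pos
  have h1 : ∀ y : Plane, {y : Plane | ρ ≤ ‖y‖}.indicator (N.lossPlane s) y =
      (Ici ρ).indicator (fun t => ENNReal.ofReal (N.loss s t)) ‖y‖ := fun y => rfl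
  simp_rw [h1]
  rw [lintegral_comp_norm ((N.measurable_loss s).ennreal_ofReal.indicator measurableSet_Ici)]
  have h2 : ∀ t, ENNReal.ofReal (2 * Real.pi * t) *
      (Ici ρ).indicator (fun t => ENNReal.ofReal (N.loss s t)) t =
      (Ici ρ).indicator (fun t => ENNReal.ofReal (2 * Real.pi * t) *
        ENNReal.ofReal (N.loss s t)) t := by
    intro t
    by_cases ht : t ∈ Ici ρ <;> simp [ht]
  simp_rw [h2]
  rw [setLIntegral_indicator measurableSet_Ici]
  have h3 : (Ici ρ ∩ Ioi 0 : Set ℝ) =ᵐ[volume] Ioi ρ := by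
    rcases hρ.eq_or_lt with rfl | hρ
    · rw [inter_eq_right.2 (Ioi_subset_Ici_self (a := (0 : ℝ)))]
      exact EventuallyEq.refl _ _
    · have h4 : Ici ρ ⊆ Ioi 0 := fun t ht => hρ.trans_le ht
      rw [inter_eq_left.2 h4]
      exact Ioi_ae_eq_Ici.symm
  rw [setLIntegral_congr h3, mul_comm (2 * Real.pi) N.lam, mul_assoc N.lam,
    ENNReal.ofReal_mul hlam.le,
    ← integral_const_mul, ofReal_integral_eq_lintegral_ofReal]
  · congr 1
    refine setLIntegral_congr_fun measurableSet_Ioi fun t ht => ?_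
    have ht0 : 0 < t := hρ.trans_lt ht
    rw [← ENNReal.ofReal_mul (by positivity)]
    congr 1
    ring
  · exact ((N.integrableOn_loss_mul hs).mono_set (Ioi_subset_Ioi hρ)).const_mul _
  · filter_upwards [ae_restrict_mem measurableSet_Ioi] with t ht
    have ht0 : 0 < t := hρ.trans_lt ht
    have := (N.loss_mem hs ht0.le).1
    have := Real.pi_pos
    positivity

/-- The exponent of `laplace` as a mean over the plane. -/
lemma expNeg_lintegral_lossPlane (hs : 0 ≤ s) (a : Association) {r : ℝ} (hr : 0 ≤ nu a r) :
    expNeg (ENNReal.ofReal N.lam *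
        ∫⁻ y, {y : Plane | nu a r ≤ ‖y‖}.indicator (N.lossPlane s) y) =
      ENNReal.ofReal (N.laplace a r s) := by
  have hlam := N.lam_pos
  rw [N.lintegral_indicator_lossPlane hs hr, N.laplace_eq a hr hs, expNeg_ofReal]
  have : 0 ≤ ∫ t in Ioi (nu a r), N.loss s t * t := by
    refine setIntegral_nonneg measurableSet_Ioi fun t ht => ?_
    have ht0 : 0 < t := hr.trans_lt ht
    exact mul_nonneg (N.loss_mem hs ht0.le).1 ht0.le
  have := Real.pi_pos
  positivity

/-- The probability that no base station is closer than `nu a r`. -/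
def voidProb (a : Association) (r : ℝ) : ℝ := Real.exp (-(Real.pi * N.lam * nu a r ^ 2))

lemma servingDensity_eq (a : Association) (r : ℝ) :
    N.servingDensity a r = N.lam * N.voidProb a r * (2 * Real.pi * r) := by
  cases a
  · simp only [servingDensity, voidProb, nu]
    ring
  · simp only [servingDensity, voidProb, nu]
    simp
    ring

lemma expNeg_lintegral_fill (hs : 0 ≤ s) (a : Association) {r : ℝ} (hr : 0 ≤ nu a r) :
    expNeg (ENNReal.ofReal N.lam *
        ∫⁻ y, IsHomogeneousPPP.fill (N.lossPlane s) (nu a r) y) =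
      ENNReal.ofReal (N.voidProb a r) * ENNReal.ofReal (N.laplace a r s) := by
  have hlam := N.lam_pos
  have hpi := Real.pi_pos
  have h1 : ∀ y, IsHomogeneousPPP.fill (N.lossPlane s) (nu a r) y =
      (Metric.ball 0 (nu a r)).indicator 1 y +
        {y : Plane | nu a r ≤ ‖y‖}.indicator (N.lossPlane s) y := by
    intro y
    rcases le_or_gt (nu a r) ‖y‖ with h | h
    · simp [IsHomogeneousPPP.fill, h, indicator, h.not_gt]
    · simp [IsHomogeneousPPP.fill, h, indicator, h.not_ge]
  simp_rw [h1]
  rw [lintegral_add_left (measurable_one.indicator measurableSet_ball), mul_add, expNeg_add,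
    N.expNeg_lintegral_lossPlane hs a hr, lintegral_indicator_one measurableSet_ball,
    EuclideanSpace.volume_ball_fin_two]
  congr 1
  have h2 : ENNReal.ofReal N.lam * (ENNReal.ofReal (nu a r) ^ 2 * ENNReal.ofReal Real.pi) =
      ENNReal.ofReal (Real.pi * N.lam * nu a r ^ 2) := by
    rw [← ENNReal.ofReal_pow hr, ← ENNReal.ofReal_mul (by positivity),
      ← ENNReal.ofReal_mul hlam.le]
    congr 1
    ring
  rw [h2, expNeg_ofReal (by positivity), voidProb]

/-! ### The law of the marks -/

lemma isProbabilityMeasure_gamma : IsProbabilityMeasure (gammaMeasure N.m N.m) :=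
  isProbabilityMeasure_gammaMeasure N.m_pos N.m_pos

lemma lintegral_markLaw (x : Plane) {f : Bool × ℝ → ℝ≥0∞} (hf : Measurable f) :
    ∫⁻ z, f z ∂N.markLaw x =
      ENNReal.ofReal (N.pLOS ‖x‖) * ∫⁻ γ, f (true, γ) ∂gammaMeasure N.m N.m +
        ENNReal.ofReal (1 - N.pLOS ‖x‖) * ∫⁻ γ, f (false, γ) ∂expMeasure 1 := by
  have := N.isProbabilityMeasure_gamma
  have := isProbabilityMeasure_expMeasure one_pos
  rw [markLaw, lintegral_add_measure, lintegral_smul_measure, lintegral_smul_measure,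
    lintegral_prod _ hf.aemeasurable, lintegral_prod _ hf.aemeasurable, lintegral_dirac,
    lintegral_dirac, smul_eq_mul, smul_eq_mul]

lemma measurable_markLaw : Measurable N.markLaw := by
  refine Measure.measurable_of_measurable_coe _ fun A hA => ?_
  have h : ∀ x, N.markLaw x A =
      ENNReal.ofReal (N.pLOS ‖x‖) * ∫⁻ γ, A.indicator 1 (true, γ) ∂gammaMeasure N.m N.m +
        ENNReal.ofReal (1 - N.pLOS ‖x‖) * ∫⁻ γ, A.indicator 1 (false, γ) ∂expMeasure 1 := by
    intro x
    rw [← N.lintegral_markLaw x (measurable_one.indicator hA), lintegral_indicator_one hA]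
  simp_rw [h]
  have := N.measurable_pLOS
  fun_prop

/-- The law of the mark as a probability kernel. -/
def markKernel : Kernel Plane (Bool × ℝ) := ⟨N.markLaw, N.measurable_markLaw⟩

lemma markKernel_apply (x : Plane) : N.markKernel x = N.markLaw x := rfl

instance : IsMarkovKernel N.markKernel where
  isProbabilityMeasure x := by
    have := N.isProbabilityMeasure_gamma
    have := isProbabilityMeasure_expMeasure one_pos
    obtain ⟨h0, h1⟩ := N.pLOS_mem ‖x‖ (norm_nonneg x)
    refine ⟨?_⟩
    rw [N.markKernel_apply, ← lintegral_one, N.lintegral_markLaw x measurable_const]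
    simp only [lintegral_one, measure_univ, mul_one]
    rw [← ENNReal.ofReal_add h0 (by linarith)]
    simp

/-- The power received from a base station at `x` with mark `z`. -/
def power (x : Plane) (z : Bool × ℝ) : ℝ≥0∞ :=
  ENNReal.ofReal (z.2 * if z.1 then N.ellLOS ‖x‖ else N.ellNLOS ‖x‖)

lemma measurable_power : Measurable fun p : Plane × (Bool × ℝ) => N.power p.1 p.2 := by
  unfold power
  refine (Measurable.mul (by fun_prop) (Measurable.ite ?_ ?_ ?_)).ennreal_ofReal
  · exact (measurable_fst.comp measurable_snd) (measurableSet_singleton true)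
  · exact N.measurable_ellLOS.comp (measurable_norm.comp measurable_fst)
  · exact N.measurable_ellNLOS.comp (measurable_norm.comp measurable_fst)

variable {s : ℝ}

lemma lintegral_expNeg_gamma {a r ℓ : ℝ} (ha : 0 < a) (hr : 0 < r) (hs : 0 ≤ s) (hℓ : 0 ≤ ℓ) :
    ∫⁻ γ, expNeg (ENNReal.ofReal s * ENNReal.ofReal (γ * ℓ)) ∂gammaMeasure a r =
      ENNReal.ofReal ((r / (r + s * ℓ)) ^ a) := by
  rw [← lintegral_exp_gammaMeasure ha hr (mul_nonneg hs hℓ)]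
  refine lintegral_congr_ae ?_
  filter_upwards [ae_pos_gammaMeasure a r] with γ hγ
  rw [← ENNReal.ofReal_mul hs, expNeg_ofReal (by positivity)]
  congr 3
  ring

/-- The Laplace transform of the power received from a base station at `x`. -/
lemma lintegral_expNeg_power (hs : 0 ≤ s) (x : Plane) :
    ∫⁻ z, expNeg (ENNReal.ofReal s * N.power x z) ∂N.markKernel x = 1 - N.lossPlane s x := by
  have hm := N.m_pos
  have hp : Measurable fun z => N.power x z :=
    N.measurable_power.comp (measurable_prodMk_left (x := x))
  obtain ⟨h0, h1⟩ := N.pLOS_mem ‖x‖ (norm_nonneg x)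
  have hL := N.ellLOS_nonneg ‖x‖
  have hNL := N.ellNLOS_nonneg ‖x‖
  rw [markKernel_apply, N.lintegral_markLaw x
    (f := fun z => expNeg (ENNReal.ofReal s * N.power x z))
    (measurable_expNeg.comp (measurable_const.mul hp))]
  simp only [power, if_true, Bool.false_eq_true, if_false]
  rw [lintegral_expNeg_gamma hm hm hs hL, expMeasure,
    lintegral_expNeg_gamma one_pos one_pos hs hNL, Real.rpow_natCast, Real.rpow_one,
    ← ENNReal.ofReal_mul h0, ← ENNReal.ofReal_mul (by linarith),
    ← ENNReal.ofReal_add (by positivity) (mul_nonneg (by linarith) (by positivity)),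
    lossPlane, ← ENNReal.ofReal_one, ← ENNReal.ofReal_sub _ (N.loss_mem hs (norm_nonneg x)).1]
  congr 1
  have e : (N.m : ℝ) / (N.m + s * N.ellLOS ‖x‖) = 1 / (1 + s / N.m * N.ellLOS ‖x‖) := by
    field_simp
  rw [e, loss, lossLOS, lossNLOS, one_div_pow]
  ring

end Params

/-! ### The Laplace transform of the interference -/

section Network

variable {Ω : Type*} [MeasurableSpace Ω] {P : Measure Ω} [IsProbabilityMeasure P] {N : Params}
  {X : ℕ → Ω → Plane} {L : ℕ → Ω → Bool} {g : ℕ → Ω → ℝ} {s : ℝ}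

namespace Params

/-- The total power received from the base stations at distance at least `ρ`. -/
def farPower (N : Params) (X : ℕ → Ω → Plane) (L : ℕ → Ω → Bool) (g : ℕ → Ω → ℝ) (ρ : ℝ)
    (ω : Ω) : ℝ≥0∞ :=
  ∑' j, if ρ ≤ ‖X j ω‖ then N.rxPower X L g j ω else 0

/-- The indicator that no base station but `i` is closer than `nu a ‖X i ω‖`: for closest
association that `i` is a closest base station, and no condition for strongest association. -/
def weight (X : ℕ → Ω → Plane) (a : Association) (i : ℕ) (ω : Ω) : ℝ≥0∞ :=
  {x : ℕ → Plane | ∀ j, j ≠ i → nu a ‖x i‖ ≤ ‖x j‖}.indicator 1 fun j => X j ω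

lemma nu_nonneg (a : Association) {r : ℝ} (hr : 0 ≤ r) : 0 ≤ nu a r := by
  cases a
  exacts [hr, le_rfl]

lemma measurable_nu (a : Association) : Measurable (nu a) := by
  cases a
  exacts [measurable_id, measurable_const]

omit [MeasurableSpace Ω] in
lemma weight_closest (X : ℕ → Ω → Plane) (i : ℕ) (ω : Ω) :
    weight X .closest i ω = {ω | IsClosest X i ω}.indicator 1 ω := by
  have h : (∀ j, j ≠ i → ‖X i ω‖ ≤ ‖X j ω‖) ↔ IsClosest X i ω :=
    ⟨fun h j => (eq_or_ne j i).elim (fun e => e ▸ le_rfl) (h j), fun h j _ => h j⟩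
  by_cases hc : IsClosest X i ω
  · rw [indicator_of_mem (show ω ∈ {ω | IsClosest X i ω} from hc), weight,
      indicator_of_mem (by exact h.2 hc)]
    rfl
  · rw [indicator_of_notMem (show ω ∉ {ω | IsClosest X i ω} from hc), weight,
      indicator_of_notMem (by exact fun h' => hc (h.1 h'))]

omit [MeasurableSpace Ω] in
lemma weight_strongest (X : ℕ → Ω → Plane) (i : ℕ) (ω : Ω) : weight X .strongest i ω = 1 := by
  simp [weight, nu]

lemma measurableSet_weight (a : Association) (i : ℕ) :
    MeasurableSet {x : ℕ → Plane | ∀ j, j ≠ i → nu a ‖x i‖ ≤ ‖x j‖} := by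
  have : {x : ℕ → Plane | ∀ j, j ≠ i → nu a ‖x i‖ ≤ ‖x j‖} =
      ⋂ j, ⋂ (_ : j ≠ i), {x | nu a ‖x i‖ ≤ ‖x j‖} := by
    ext x
    simp
  rw [this]
  exact MeasurableSet.iInter fun j => MeasurableSet.iInter fun _ => measurableSet_le
    ((measurable_nu a).comp (measurable_pi_apply i).norm) (measurable_pi_apply j).norm

omit [MeasurableSpace Ω] in
lemma interference_eq_tsum (i : ℕ) (ω : Ω) :
    N.interference X L g i ω = ∑' j, if j = i then 0 else N.rxPower X L g j ω := by
  refine (tsum_subtype {j | j ≠ i} fun j => N.rxPower X L g j ω).trans ?_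
  refine tsum_congr fun j => ?_
  by_cases h : j = i <;> simp [h]

namespace IsNetwork

variable (hN : N.IsNetwork P X L g)
include hN

omit [IsProbabilityMeasure P]

lemma measurable_X (i : ℕ) : Measurable (X i) := hN.ppp.measurable i

lemma marking : IsIndependentMarking P X (fun i ω => (L i ω, g i ω)) N.markKernel := hN.marks

lemma measurable_rxPower (i : ℕ) : Measurable (N.rxPower X L g i) :=
  N.measurable_power.comp ((hN.measurable_X i).prodMk (hN.marks.measurable i))

lemma measurable_interference (i : ℕ) : Measurable (N.interference X L g i) := by
  unfold interference
  exact Measurable.tsum fun j => hN.measurable_rxPower j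

lemma measurable_farPower :
    Measurable fun p : ℝ × Ω => N.farPower X L g p.1 p.2 := by
  unfold farPower
  exact Measurable.tsum fun j => Measurable.ite
    (measurableSet_le measurable_fst ((hN.measurable_X j).comp measurable_snd).norm)
    ((hN.measurable_rxPower j).comp measurable_snd) measurable_const

lemma measurable_weight (a : Association) (i : ℕ) : Measurable (weight X a i) :=
  (measurable_one.indicator (measurableSet_weight a i)).comp
    (measurable_pi_lambda _ hN.measurable_X)

variable [IsProbabilityMeasure P]

/-- `laplace` is the Laplace transform of the power received from outside a disc, for every
radius of the disc. -/
theorem lintegral_expNeg_farPower (hs : 0 ≤ s) (a : Association) {r : ℝ} (hr : 0 ≤ r) :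
    ∫⁻ ω, expNeg (ENNReal.ofReal s * N.farPower X L g (nu a r) ω) ∂P =
      ENNReal.ofReal (N.laplace a r s) := by
  set φ : Plane × (Bool × ℝ) → ℝ≥0∞ := fun p =>
    if nu a r ≤ ‖p.1‖ then expNeg (ENNReal.ofReal s * N.power p.1 p.2) else 1 with hφ
  have hφm : Measurable φ := Measurable.ite
    (measurableSet_le measurable_const measurable_fst.norm)
    (measurable_expNeg.comp (measurable_const.mul N.measurable_power)) measurable_const
  have hφ1 : ∀ p, φ p ≤ 1 := fun p => by
    simp only [hφ]
    split_ifs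
    exacts [expNeg_le_one _, le_rfl]
  have h1 : ∀ ω, expNeg (ENNReal.ofReal s * N.farPower X L g (nu a r) ω) =
      1 * infProd fun j => φ (X j ω, (L j ω, g j ω)) := by
    intro ω
    rw [one_mul, farPower, ← ENNReal.tsum_mul_left, ← infProd_expNeg]
    congr 1
    ext j
    simp only [hφ]
    split_ifs
    · rfl
    · simp
  have h2 := hN.marking.lintegral_infProd hN.measurable_X (φ := fun _ => φ) (fun _ => hφm)
    (fun _ => hφ1) (G := fun _ => 1) measurable_const (fun _ => le_rfl)
  have h3 : ∀ x, ∫⁻ z, φ (x, z) ∂N.markKernel x =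
      1 - {y : Plane | nu a r ≤ ‖y‖}.indicator (N.lossPlane s) x := by
    intro x
    by_cases hx : nu a r ≤ ‖x‖
    · simp only [hφ, hx, if_true]
      rw [N.lintegral_expNeg_power hs x, indicator_of_mem (by exact hx)]
    · simp [hφ, hx]
  rw [lintegral_congr h1, h2]
  simp_rw [h3, one_mul]
  rw [hN.ppp.lintegral_infProd N.lam_pos.le, N.expNeg_lintegral_lossPlane hs a (nu_nonneg a hr)]
  · exact (N.measurable_lossPlane s).indicator (measurableSet_le measurable_const measurable_norm)
  · exact fun x => (indicator_le_self _ _ x).trans (N.lossPlane_le_one hs x)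

/-- The Laplace transform of the interference under the Campbell measure. -/
lemma lintegral_tsum_weight_expNeg (hs : 0 ≤ s) (a : Association) {A : Set Plane}
    (hA : MeasurableSet A) (hb : Bornology.IsBounded A) :
    ∫⁻ ω, ∑' i, A.indicator 1 (X i ω) *
        (weight X a i ω * expNeg (ENNReal.ofReal s * N.interference X L g i ω)) ∂P =
      ∫⁻ x in A, ENNReal.ofReal N.lam *
        (ENNReal.ofReal (N.voidProb a ‖x‖) * ENNReal.ofReal (N.laplace a ‖x‖ s)) := by
  set φ : ℕ → ℕ → Plane × (Bool × ℝ) → ℝ≥0∞ := fun i j p =>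
    if j = i then 1 else expNeg (ENNReal.ofReal s * N.power p.1 p.2) with hφ
  have hφm : ∀ i j, Measurable (φ i j) := fun i j => by
    simp only [hφ]
    split_ifs
    exacts [measurable_const, measurable_expNeg.comp (measurable_const.mul N.measurable_power)]
  have hφ1 : ∀ i j p, φ i j p ≤ 1 := fun i j p => by
    simp only [hφ]
    split_ifs
    exacts [le_rfl, expNeg_le_one _]
  set G : ℕ → (ℕ → Plane) → ℝ≥0∞ := fun i x => A.indicator 1 (x i) *
    {x : ℕ → Plane | ∀ j, j ≠ i → nu a ‖x i‖ ≤ ‖x j‖}.indicator 1 x with hG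
  have hGm : ∀ i, Measurable (G i) := fun i =>
    ((measurable_one.indicator hA).comp (measurable_pi_apply i)).mul
      (measurable_one.indicator (measurableSet_weight a i))
  have hG1 : ∀ i x, G i x ≤ 1 := fun i x =>
    mul_le_one' (indicator_le_self _ _ _) (indicator_le_self _ _ _)
  have h1 : ∀ i ω, A.indicator 1 (X i ω) *
        (weight X a i ω * expNeg (ENNReal.ofReal s * N.interference X L g i ω)) =
      G i (fun j => X j ω) * infProd fun j => φ i j (X j ω, (L j ω, g j ω)) := by
    intro i ω
    rw [← mul_assoc, interference_eq_tsum, ← ENNReal.tsum_mul_left, ← infProd_expNeg]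
    congr 2
    ext j
    simp only [hφ]
    split_ifs
    · simp
    · rfl
  -- the conditional Laplace transform given the points
  have h2 : ∀ i ω, G i (fun j => X j ω) *
        infProd (fun j => ∫⁻ z, φ i j (X j ω, z) ∂N.markKernel (X j ω)) =
      A.indicator 1 (X i ω) * infProd (Function.update (fun j =>
        1 - IsHomogeneousPPP.fill (N.lossPlane s) (nu a ‖X i ω‖) (X j ω)) i 1) := by
    intro i ω
    simp only [hG, mul_assoc]
    congr 1
    by_cases hw : ∀ j, j ≠ i → nu a ‖X i ω‖ ≤ ‖X j ω‖
    · rw [indicator_of_mem (show (fun j => X j ω) ∈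
        {x : ℕ → Plane | ∀ j, j ≠ i → nu a ‖x i‖ ≤ ‖x j‖} from hw), Pi.one_apply, one_mul]
      congr 1
      ext j
      by_cases hj : j = i
      · subst hj
        simp [hφ]
      · simp only [hφ, hj, if_false, Function.update_of_ne hj]
        rw [N.lintegral_expNeg_power hs, IsHomogeneousPPP.fill, if_pos (hw j hj)]
    · rw [indicator_of_notMem (show (fun j => X j ω) ∉
        {x : ℕ → Plane | ∀ j, j ≠ i → nu a ‖x i‖ ≤ ‖x j‖} from hw), zero_mul]
      push Not at hw
      obtain ⟨j, hj, hlt⟩ := hw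
      refine (le_antisymm ((iInf_le _ (j + 1)).trans (le_of_eq ?_)) zero_le).symm
      refine Finset.prod_eq_zero (Finset.mem_range.2 (Nat.lt_succ_self j)) ?_
      rw [Function.update_of_ne hj, IsHomogeneousPPP.fill, if_neg hlt.not_ge, tsub_self]
  have hmeas : ∀ i, Measurable fun ω => A.indicator 1 (X i ω) *
        (weight X a i ω * expNeg (ENNReal.ofReal s * N.interference X L g i ω)) := fun i =>
    ((measurable_one.indicator hA).comp (hN.measurable_X i)).mul ((hN.measurable_weight a i).mul
      (measurable_expNeg.comp (measurable_const.mul (hN.measurable_interference i))))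
  have hρ : Measurable fun x : Plane => nu a ‖x‖ := (measurable_nu a).comp measurable_norm
  have hmeas2 : ∀ i, Measurable fun ω => A.indicator 1 (X i ω) * infProd (Function.update (fun j =>
        1 - IsHomogeneousPPP.fill (N.lossPlane s) (nu a ‖X i ω‖) (X j ω)) i 1) := fun i =>
    ((measurable_one.indicator hA).comp (hN.measurable_X i)).mul
      (measurable_infProd_update (fun j => measurable_const.sub
        ((IsHomogeneousPPP.measurable_fill (N.measurable_lossPlane s)).comp
          ((hρ.comp (hN.measurable_X i)).prodMk (hN.measurable_X j)))) i)
  rw [lintegral_tsum fun i => (hmeas i).aemeasurable]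
  have h3 : ∀ i, ∫⁻ ω, A.indicator 1 (X i ω) *
        (weight X a i ω * expNeg (ENNReal.ofReal s * N.interference X L g i ω)) ∂P =
      ∫⁻ ω, A.indicator 1 (X i ω) * infProd (Function.update (fun j =>
        1 - IsHomogeneousPPP.fill (N.lossPlane s) (nu a ‖X i ω‖) (X j ω)) i 1) ∂P := by
    intro i
    rw [lintegral_congr (h1 i), hN.marking.lintegral_infProd hN.measurable_X (hφm i) (hφ1 i)
      (hGm i) (hG1 i), lintegral_congr (h2 i)]
  simp_rw [h3]
  rw [← lintegral_tsum fun i => (hmeas2 i).aemeasurable,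
    hN.ppp.lintegral_tsum_infProd_fill N.lam_pos.le hA hb (N.measurable_lossPlane s)
      (N.lossPlane_le_one hs) hρ]
  refine lintegral_congr fun x => ?_
  rw [N.expNeg_lintegral_fill hs a (nu_nonneg a (norm_nonneg x))]

end IsNetwork

end Params

end Network

namespace Params

variable (N : Params)

/-! ### Almost sure properties of the network -/

lemma loss_mono {s s' t : ℝ} (hs : 0 ≤ s) (h : s ≤ s') (ht : 0 ≤ t) :
    N.loss s t ≤ N.loss s' t := by
  have hm := N.m_pos
  have hL := N.ellLOS_nonneg t
  have hNL := N.ellNLOS_nonneg t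
  have h1 : N.lossNLOS s t ≤ N.lossNLOS s' t := by
    unfold lossNLOS
    gcongr
  have h2 : N.lossLOS s t ≤ N.lossLOS s' t := by
    unfold lossLOS
    gcongr
  obtain ⟨h5, h6⟩ := N.pLOS_mem t ht
  unfold loss
  nlinarith

lemma loss_le {s t : ℝ} (hs : 0 ≤ s) (ht : 0 ≤ t) :
    N.loss s t ≤ s * (N.ellNLOS t + N.ellLOS t) := by
  have h1 := N.lossNLOS_le hs t
  have h2 := N.lossLOS_le hs t
  have hL := mul_nonneg hs (N.ellLOS_nonneg t)
  have hNL := mul_nonneg hs (N.ellNLOS_nonneg t)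
  obtain ⟨h5, h6⟩ := N.pLOS_mem t ht
  unfold loss
  nlinarith

/-- The Laplace transform of the total received power tends to `1` at `0`. -/
lemma tendsto_laplace_strongest :
    Tendsto (fun n : ℕ => N.laplace .strongest 1 (1 / (n + 1))) atTop (𝓝 1) := by
  have hpos : ∀ n : ℕ, (0 : ℝ) ≤ 1 / (n + 1) := fun n => by positivity
  have hle : ∀ n : ℕ, (1 / (n + 1) : ℝ) ≤ 1 := fun n => by
    rw [div_le_one (by positivity)]
    linarith [n.cast_nonneg (α := ℝ)]
  have h0 : (fun n : ℕ => N.laplace .strongest 1 (1 / (n + 1))) = fun n : ℕ =>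
      Real.exp (-(2 * Real.pi * N.lam * ∫ t in Ioi 0, N.loss (1 / (n + 1)) t * t)) :=
    funext fun n => N.laplace_eq .strongest le_rfl (hpos n)
  have h1 : Tendsto (fun n : ℕ => ∫ t in Ioi (0 : ℝ), N.loss (1 / (n + 1)) t * t) atTop
      (𝓝 (∫ t in Ioi (0 : ℝ), 0)) := by
    refine tendsto_integral_of_dominated_convergence (fun t => N.loss 1 t * t)
      (fun n => ((N.measurable_loss _).mul measurable_id).aestronglyMeasurable)
      (N.integrableOn_loss_mul zero_le_one) (fun n => ?_) ?_
    · filter_upwards [ae_restrict_mem measurableSet_Ioi] with t ht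
      have ht0 : 0 < t := ht
      rw [Real.norm_of_nonneg (mul_nonneg (N.loss_mem (hpos n) ht0.le).1 ht0.le)]
      exact mul_le_mul_of_nonneg_right (N.loss_mono (hpos n) (hle n) ht0.le) ht0.le
    · filter_upwards [ae_restrict_mem measurableSet_Ioi] with t ht
      have ht0 : 0 < t := ht
      have h2 : Tendsto (fun n : ℕ => (1 / ((n : ℝ) + 1)) * (N.ellNLOS t + N.ellLOS t) * t) atTop
          (𝓝 0) := by
        have := (tendsto_one_div_add_atTop_nhds_zero_nat (𝕜 := ℝ)).mul_const
          ((N.ellNLOS t + N.ellLOS t) * t)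
        rw [zero_mul] at this
        exact this.congr fun n => by ring
      refine squeeze_zero (fun n => mul_nonneg (N.loss_mem (hpos n) ht0.le).1 ht0.le)
        (fun n => ?_) h2
      exact mul_le_mul_of_nonneg_right (N.loss_le (hpos n) ht0.le) ht0.le
  rw [h0]
  have h3 := (h1.const_mul (2 * Real.pi * N.lam)).neg.rexp
  simpa using h3

lemma markKernel_compl_pos (x : Plane) : N.markKernel x {z : Bool × ℝ | 0 < z.2}ᶜ = 0 := by
  have hA : MeasurableSet {z : Bool × ℝ | 0 < z.2} :=
    measurableSet_lt measurable_const measurable_snd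
  have h : ∀ (b : Bool) (a r : ℝ),
      ∫⁻ γ, {z : Bool × ℝ | 0 < z.2}ᶜ.indicator 1 (b, γ) ∂gammaMeasure a r = 0 := by
    intro b a r
    rw [← lintegral_zero (μ := gammaMeasure a r)]
    refine lintegral_congr_ae ?_
    filter_upwards [ae_pos_gammaMeasure a r] with γ hγ
    exact indicator_of_notMem (s := {z : Bool × ℝ | 0 < z.2}ᶜ)
      (fun h => h (show 0 < (b, γ).2 from hγ)) _
  rw [N.markKernel_apply, ← lintegral_indicator_one hA.compl,
    N.lintegral_markLaw x (measurable_one.indicator hA.compl), h, expMeasure, h]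
  simp

end Params

section Network

variable {Ω : Type*} [MeasurableSpace Ω] {P : Measure Ω} [IsProbabilityMeasure P] {N : Params}
  {X : ℕ → Ω → Plane} {L : ℕ → Ω → Bool} {g : ℕ → Ω → ℝ} {s : ℝ}

namespace Params

namespace IsNetwork

variable (hN : N.IsNetwork P X L g)
include hN

lemma ae_norm_pos : ∀ᵐ ω ∂P, ∀ i, 0 < ‖X i ω‖ := by
  have h := hN.ppp.lintegral_tsum_comp N.lam_pos.le
    (measurable_one.indicator (measurableSet_singleton (0 : Plane)))
  rw [lintegral_indicator_one (measurableSet_singleton _), measure_singleton, mul_zero,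
    lintegral_eq_zero_iff (f := fun ω => ∑' i, ({0} : Set Plane).indicator 1 (X i ω))
      (Measurable.tsum fun i =>
      (measurable_one.indicator (measurableSet_singleton (0 : Plane))).comp
        (hN.measurable_X i))] at h
  filter_upwards [h] with ω hω i
  have := ENNReal.tsum_eq_zero.1 hω i
  rw [norm_pos_iff]
  intro h0
  simp [h0] at this

lemma ae_rxPower_pos : ∀ᵐ ω ∂P, ∀ i, 0 < N.rxPower X L g i ω := by
  have h := hN.marking.ae_mem (measurableSet_lt measurable_const measurable_snd)
    N.markKernel_compl_pos
  filter_upwards [h, hN.ae_norm_pos] with ω h1 h2 i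
  have h3 : 0 < g i ω := h1 i
  rw [rxPower, ENNReal.ofReal_pos]
  refine mul_pos h3 ?_
  split_ifs
  exacts [N.ellLOS_pos (h2 i), N.ellNLOS_pos (h2 i)]

lemma ae_finite_near : ∀ᵐ ω ∂P, ∀ R : ℝ, {i | ‖X i ω‖ < R}.Finite := by
  have h := ae_all_iff.2 fun n : ℕ => hN.ppp.ae_count_ne_top
    (measurableSet_ball (x := (0 : Plane)) (ε := n)) Metric.isBounded_ball
  filter_upwards [h] with ω hω R
  obtain ⟨n, hn⟩ := exists_nat_gt R
  refine (Set.encard_ne_top_iff.1 (hω n)).subset fun i hi => ?_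
  exact mem_ball_zero_iff.2 ((show ‖X i ω‖ < R from hi).trans hn)

lemma ae_tsum_rxPower_lt_top : ∀ᵐ ω ∂P, ∑' i, N.rxPower X L g i ω < ⊤ := by
  have hm : Measurable fun ω => ∑' i, N.rxPower X L g i ω :=
    Measurable.tsum hN.measurable_rxPower
  have hset : MeasurableSet {ω | ∑' i, N.rxPower X L g i ω < ⊤} :=
    measurableSet_lt hm measurable_const
  have h1 : ∀ n : ℕ, ENNReal.ofReal (N.laplace .strongest 1 (1 / (n + 1))) ≤
      P {ω | ∑' i, N.rxPower X L g i ω < ⊤} := by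
    intro n
    have hpos : (0 : ℝ) < 1 / (n + 1) := by positivity
    rw [← hN.lintegral_expNeg_farPower hpos.le .strongest zero_le_one,
      ← lintegral_indicator_one hset]
    refine lintegral_mono fun ω => ?_
    have h2 : N.farPower X L g (nu .strongest 1) ω = ∑' i, N.rxPower X L g i ω := by
      simp [farPower, nu]
    by_cases hω : ∑' i, N.rxPower X L g i ω < ⊤
    · rw [indicator_of_mem (show ω ∈ {ω | ∑' i, N.rxPower X L g i ω < ⊤} from hω)]
      exact expNeg_le_one _
    · rw [h2, not_lt_top_iff.1 hω, ENNReal.mul_top (ENNReal.ofReal_pos.2 hpos).ne', expNeg_top]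
      exact zero_le
  have h2 : P {ω | ∑' i, N.rxPower X L g i ω < ⊤} = 1 := by
    refine le_antisymm prob_le_one ?_
    have h3 := (ENNReal.continuous_ofReal.tendsto 1).comp N.tendsto_laplace_strongest
    rw [ENNReal.ofReal_one] at h3
    exact le_of_tendsto' h3 h1
  exact (mem_ae_iff_prob_eq_one hset).2 h2

/-- Almost surely, no base station is at the origin, bounded sets contain finitely many base
stations, and the received powers are positive and summable. -/
lemma ae_regular : ∀ᵐ ω ∂P, (∀ i, 0 < ‖X i ω‖) ∧ (∀ i, 0 < N.rxPower X L g i ω) ∧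
    (∀ R : ℝ, {i | ‖X i ω‖ < R}.Finite) ∧ ∑' i, N.rxPower X L g i ω < ⊤ := by
  filter_upwards [hN.ae_norm_pos, hN.ae_rxPower_pos, hN.ae_finite_near,
    hN.ae_tsum_rxPower_lt_top] with ω h1 h2 h3 h4
  exact ⟨h1, h2, h3, h4⟩

lemma ae_interference : ∀ᵐ ω ∂P, ∀ i, 0 < N.interference X L g i ω ∧
    N.interference X L g i ω < ⊤ := by
  filter_upwards [hN.ae_regular] with ω hω i
  obtain ⟨-, h2, -, h4⟩ := hω
  constructor
  · refine (h2 (i + 1)).trans_le ?_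
    exact ENNReal.le_tsum (f := fun j : {j // j ≠ i} => N.rxPower X L g j ω)
      ⟨i + 1, Nat.succ_ne_self i⟩
  · refine lt_of_le_of_lt ?_ h4
    exact ENNReal.tsum_comp_le_tsum_of_injective Subtype.val_injective
      fun j => N.rxPower X L g j ω

lemma ae_farPower : ∀ᵐ ω ∂P, ∀ ρ, 0 < N.farPower X L g ρ ω ∧ N.farPower X L g ρ ω < ⊤ := by
  filter_upwards [hN.ae_regular] with ω hω ρ
  obtain ⟨-, h2, h3, h4⟩ := hω
  constructor
  · obtain ⟨j, hj⟩ := (h3 ρ).exists_notMem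
    have hj' : ρ ≤ ‖X j ω‖ := not_lt.1 hj
    refine (h2 j).trans_le (le_of_eq_of_le ?_ (ENNReal.le_tsum j))
    rw [if_pos hj']
  · refine lt_of_le_of_lt (ENNReal.tsum_le_tsum fun j => ?_) h4
    split_ifs
    exacts [le_rfl, zero_le]

/-! ### Smoothness and derivatives of the Laplace transform -/

omit [IsProbabilityMeasure P] in
lemma measurable_farPower_toReal (ρ : ℝ) : Measurable fun ω => (N.farPower X L g ρ ω).toReal :=
  (hN.measurable_farPower.comp (measurable_const.prodMk measurable_id)).ennreal_toReal

lemma integrable_exp_farPower (ρ : ℝ) {t : ℝ} (ht : t ≤ 0) :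
    Integrable (fun ω => Real.exp (t * (N.farPower X L g ρ ω).toReal)) P := by
  have hm := hN.measurable_farPower_toReal ρ
  refine Integrable.of_bound (C := 1) (hm.const_mul t).exp.aestronglyMeasurable
    (Eventually.of_forall fun ω => ?_)
  rw [Real.norm_eq_abs, Real.abs_exp, Real.exp_le_one_iff]
  exact mul_nonpos_of_nonpos_of_nonneg ht ENNReal.toReal_nonneg

lemma mem_interior_integrableExpSet (ρ : ℝ) {t : ℝ} (ht : t < 0) :
    t ∈ interior (integrableExpSet (fun ω => (N.farPower X L g ρ ω).toReal) P) :=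
  mem_interior.2 ⟨Iio 0, fun _ hu => hN.integrable_exp_farPower ρ (le_of_lt hu), isOpen_Iio, ht⟩

lemma lintegral_exp_farPower (hs : 0 ≤ s) (a : Association) {r : ℝ} (hr : 0 ≤ r) :
    ∫⁻ ω, ENNReal.ofReal (Real.exp (-(s * (N.farPower X L g (nu a r) ω).toReal))) ∂P =
      ENNReal.ofReal (N.laplace a r s) := by
  rw [← hN.lintegral_expNeg_farPower hs a hr]
  refine lintegral_congr_ae ?_
  filter_upwards [hN.ae_farPower] with ω hω
  rw [expNeg_of_ne_top (ENNReal.mul_ne_top ENNReal.ofReal_ne_top (hω _).2.ne),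
    ENNReal.toReal_mul, ENNReal.toReal_ofReal hs]

lemma laplace_eq_mgf (hs : 0 ≤ s) (a : Association) {r : ℝ} (hr : 0 ≤ r) :
    N.laplace a r s = mgf (fun ω => (N.farPower X L g (nu a r) ω).toReal) P (-s) := by
  have h0 : 0 ≤ N.laplace a r s := mul_nonneg (Real.exp_pos _).le (Real.exp_pos _).le
  rw [mgf, integral_eq_lintegral_of_nonneg_ae (Eventually.of_forall fun ω => (Real.exp_pos _).le)
    (hN.integrable_exp_farPower _ (by linarith)).aestronglyMeasurable,
    ← ENNReal.toReal_ofReal h0, ← hN.lintegral_exp_farPower hs a hr]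
  simp only [neg_mul]

lemma laplace_eventuallyEq_mgf (hs : 0 < s) (a : Association) {r : ℝ} (hr : 0 ≤ r) :
    N.laplace a r =ᶠ[𝓝 s]
      fun s => mgf (fun ω => (N.farPower X L g (nu a r) ω).toReal) P (-s) := by
  filter_upwards [Ioi_mem_nhds hs] with u hu
  exact hN.laplace_eq_mgf (le_of_lt hu) a hr

lemma contDiffOn_laplace (a : Association) {r : ℝ} (hr : 0 ≤ r) :
    ContDiffOn ℝ (⊤ : ℕ∞) (N.laplace a r) (Ioi 0) := by
  intro s hs
  have hs' : 0 < s := hs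
  have h1 := (analyticAt_mgf (hN.mem_interior_integrableExpSet (nu a r)
    (neg_lt_zero.2 hs'))).contDiffAt (n := ((⊤ : ℕ∞) : WithTop ℕ∞))
  have h2 := h1.comp s (contDiff_neg.contDiffAt (x := s))
  exact (h2.congr_of_eventuallyEq (hN.laplace_eventuallyEq_mgf hs' a hr)).contDiffWithinAt

/-- The sum of derivatives in the coverage formula is the mean of a Gamma tail, because the
derivatives of a Laplace transform `E[e^{-sY}]` are the means of `(-Y)^k e^{-sY}`. -/
lemma sum_iteratedDeriv_laplace (hs : 0 < s) (a : Association) {r : ℝ} (hr : 0 ≤ r) (m : ℕ) :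
    ∑ k ∈ Finset.range m, (-s) ^ k / k.factorial * iteratedDeriv k (N.laplace a r) s =
      ∫ ω, erlangTail m (s * (N.farPower X L g (nu a r) ω).toReal) ∂P := by
  have hmem := hN.mem_interior_integrableExpSet (nu a r) (neg_lt_zero.2 hs)
  have h1 : ∀ k, iteratedDeriv k (N.laplace a r) s =
      (-1) ^ k * ∫ ω, (N.farPower X L g (nu a r) ω).toReal ^ k *
        Real.exp (-s * (N.farPower X L g (nu a r) ω).toReal) ∂P := by
    intro k
    rw [(hN.laplace_eventuallyEq_mgf hs a hr).iteratedDeriv_eq, iteratedDeriv_comp_neg,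
      iteratedDeriv_mgf hmem, smul_eq_mul]
  simp only [erlangTail]
  rw [integral_finsetSum]
  · refine Finset.sum_congr rfl fun k _ => ?_
    rw [h1, ← mul_assoc, ← integral_const_mul]
    refine integral_congr_ae (Eventually.of_forall fun ω => ?_)
    have e : (-s) ^ k = (-1) ^ k * s ^ k := by rw [← mul_pow, neg_one_mul]
    have e2 : ((-1 : ℝ) ^ k) * (-1) ^ k = 1 := by rw [← mul_pow]; simp
    simp only [e, neg_mul, mul_pow]
    linear_combination (s ^ k / k.factorial * ((N.farPower X L g (nu a r) ω).toReal ^ k *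
      Real.exp (-(s * (N.farPower X L g (nu a r) ω).toReal)))) * e2
  · intro k _
    have h2 := (integrable_pow_mul_exp_of_mem_interior_integrableExpSet hmem k).const_mul
      (s ^ k / k.factorial)
    refine h2.congr (Eventually.of_forall fun ω => ?_)
    simp only [neg_mul, mul_pow]
    ring

end IsNetwork

end Params

end Network

/-! ### Uniqueness of Laplace transforms on `[0, ∞]` -/

/-- The function `t ↦ e^{-t}` as a bounded continuous real function on `[0, ∞]`. -/
def expNegBCF : BoundedContinuousFunction ℝ≥0∞ ℝ :=
  BoundedContinuousFunction.ofNormedAddCommGroup (fun t => (expNeg t).toReal)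
    (ENNReal.continuousOn_toReal.comp_continuous continuous_expNeg fun t =>
      ((expNeg_le_one t).trans_lt ENNReal.one_lt_top).ne) 1 fun t => by
    rw [Real.norm_of_nonneg ENNReal.toReal_nonneg]
    exact ENNReal.toReal_mono ENNReal.one_ne_top (expNeg_le_one t)

lemma expNegBCF_apply (t : ℝ≥0∞) : expNegBCF t = (expNeg t).toReal := rfl

lemma expNegBCF_injective : Function.Injective expNegBCF := fun t u h =>
  strictAnti_expNeg.injective ((ENNReal.toReal_eq_toReal_iff'
    ((expNeg_le_one t).trans_lt ENNReal.one_lt_top).ne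
    ((expNeg_le_one u).trans_lt ENNReal.one_lt_top).ne).1 h)

lemma expNeg_pow (t : ℝ≥0∞) (n : ℕ) : expNeg t ^ n = expNeg (n * t) := by
  have := expNeg_sum (Finset.range n) fun _ => t
  simpa using this.symm

lemma integral_expNegBCF_pow (μ : Measure ℝ≥0∞) (n : ℕ) :
    ∫ t, (expNegBCF t) ^ n ∂μ = (∫⁻ t, expNeg (n * t) ∂μ).toReal := by
  rw [integral_eq_lintegral_of_nonneg_ae]
  · congr 1
    refine lintegral_congr fun t => ?_
    rw [expNegBCF_apply, ← ENNReal.toReal_pow, expNeg_pow, ENNReal.ofReal_toReal]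
    exact ((expNeg_le_one _).trans_lt ENNReal.one_lt_top).ne
  · exact Eventually.of_forall fun t => pow_nonneg ENNReal.toReal_nonneg n
  · exact (expNegBCF.continuous.pow n).aestronglyMeasurable

/-- A finite measure on `[0, ∞]` is determined by its Laplace transform at the natural numbers:
the polynomials in `e^{-t}` are dense by the Stone–Weierstrass theorem. -/
theorem ext_of_lintegral_expNeg {μ ν : Measure ℝ≥0∞} [IsFiniteMeasure μ] [IsFiniteMeasure ν]
    (h : ∀ n : ℕ, ∫⁻ t, expNeg (n * t) ∂μ = ∫⁻ t, expNeg (n * t) ∂ν) : μ = ν := by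
  set A : StarSubalgebra ℝ (BoundedContinuousFunction ℝ≥0∞ ℝ) :=
    { (Polynomial.aeval (R := ℝ) expNegBCF).range with
      star_mem' := fun {f} hf => by
        rwa [show star f = f from BoundedContinuousFunction.ext fun _ => rfl] } with hA
  have hmem : ∀ f ∈ A, ∃ p : Polynomial ℝ, Polynomial.aeval expNegBCF p = f := fun f hf => hf
  refine ext_of_forall_mem_subalgebra_integral_eq_of_polish (𝕜 := ℝ) (A := A) ?_ fun f hf => ?_
  · intro t u htu
    refine ⟨expNegBCF, ⟨BoundedContinuousFunction.toContinuousMapStarₐ ℝ expNegBCF, ?_, rfl⟩,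
      fun h => htu (expNegBCF_injective h)⟩
    exact ⟨expNegBCF, ⟨Polynomial.X, Polynomial.aeval_X _⟩, rfl⟩
  · obtain ⟨p, rfl⟩ := hmem f hf
    induction p using Polynomial.induction_on' with
    | add p q hp hq =>
      simp only [map_add, BoundedContinuousFunction.add_apply]
      rw [integral_add (BoundedContinuousFunction.integrable _ _)
        (BoundedContinuousFunction.integrable _ _),
        integral_add (BoundedContinuousFunction.integrable _ _)
        (BoundedContinuousFunction.integrable _ _), hp ⟨p, rfl⟩, hq ⟨q, rfl⟩]
    | monomial n c =>
      simp only [Polynomial.aeval_monomial, BoundedContinuousFunction.mul_apply,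
        BoundedContinuousFunction.pow_apply, BoundedContinuousFunction.algebraMap_apply]
      rw [integral_const_mul, integral_const_mul, integral_expNegBCF_pow, integral_expNegBCF_pow,
        h n]

/-! ### The joint law of the serving distance and the interference -/

section Network

variable {Ω : Type*} [MeasurableSpace Ω] {P : Measure Ω} [IsProbabilityMeasure P] {N : Params}
  {X : ℕ → Ω → Plane} {L : ℕ → Ω → Bool} {g : ℕ → Ω → ℝ} {s : ℝ}

namespace Params

/-- The Campbell measure of the pairs (position of a possible serving base station, interference
seen by it). -/
def campbell (N : Params) (P : Measure Ω) (X : ℕ → Ω → Plane) (L : ℕ → Ω → Bool)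
    (g : ℕ → Ω → ℝ) (a : Association) : Measure (Plane × ℝ≥0∞) :=
  Measure.sum fun i => (P.withDensity (weight X a i)).map
    fun ω => (X i ω, N.interference X L g i ω)

/-- The mixture, over the position `x` of the serving base station, of the laws of the power
received from outside the disc of radius `nu a ‖x‖`. -/
def palmMixture (N : Params) (P : Measure Ω) (X : ℕ → Ω → Plane) (L : ℕ → Ω → Bool)
    (g : ℕ → Ω → ℝ) (a : Association) : Measure (Plane × ℝ≥0∞) :=
  (((volume : Measure Plane).withDensity
    fun x => ENNReal.ofReal (N.lam * N.voidProb a ‖x‖)).prod P).map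
    fun p => (p.1, N.farPower X L g (nu a ‖p.1‖) p.2)

lemma measurable_voidProb (N : Params) (a : Association) : Measurable (N.voidProb a) := by
  have := measurable_nu a
  unfold voidProb
  fun_prop

lemma voidProb_pos (N : Params) (a : Association) (r : ℝ) : 0 < N.voidProb a r := Real.exp_pos _

lemma voidProb_le_one (N : Params) (a : Association) (r : ℝ) : N.voidProb a r ≤ 1 := by
  have := N.lam_pos
  have := Real.pi_pos
  rw [voidProb, Real.exp_le_one_iff, neg_nonpos]
  positivity

namespace IsNetwork

variable (hN : N.IsNetwork P X L g)
include hN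

omit [IsProbabilityMeasure P] in
lemma lintegral_campbell (a : Association) {H : Plane × ℝ≥0∞ → ℝ≥0∞} (hH : Measurable H) :
    ∫⁻ p, H p ∂N.campbell P X L g a =
      ∫⁻ ω, ∑' i, weight X a i ω * H (X i ω, N.interference X L g i ω) ∂P := by
  have hp : ∀ i, Measurable fun ω => (X i ω, N.interference X L g i ω) := fun i =>
    (hN.measurable_X i).prodMk (hN.measurable_interference i)
  rw [campbell, lintegral_sum_measure, lintegral_tsum
      (f := fun i ω => weight X a i ω * H (X i ω, N.interference X L g i ω)) fun i =>
    ((hN.measurable_weight a i).mul (hH.comp (hp i))).aemeasurable]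
  refine tsum_congr fun i => ?_
  rw [lintegral_map hH (hp i), lintegral_withDensity_eq_lintegral_mul _ (hN.measurable_weight a i)
    (g := fun ω => H (X i ω, N.interference X L g i ω)) (hH.comp (hp i))]
  rfl

omit [IsProbabilityMeasure P] in
lemma measurable_palm (a : Association) : Measurable fun p : Plane × Ω =>
    (p.1, N.farPower X L g (nu a ‖p.1‖) p.2) :=
  measurable_fst.prodMk (hN.measurable_farPower.comp
    (((measurable_nu a).comp measurable_fst.norm).prodMk measurable_snd))

lemma lintegral_palmMixture (a : Association) {H : Plane × ℝ≥0∞ → ℝ≥0∞} (hH : Measurable H) :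
    ∫⁻ p, H p ∂N.palmMixture P X L g a =
      ∫⁻ x, ENNReal.ofReal (N.lam * N.voidProb a ‖x‖) *
        ∫⁻ ω, H (x, N.farPower X L g (nu a ‖x‖) ω) ∂P := by
  have hm := hH.comp (hN.measurable_palm a)
  have hv : Measurable fun x : Plane => ENNReal.ofReal (N.lam * N.voidProb a ‖x‖) :=
    (((N.measurable_voidProb a).comp measurable_norm).const_mul _).ennreal_ofReal
  rw [palmMixture, lintegral_map hH (hN.measurable_palm a),
    lintegral_prod (fun p : Plane × Ω => H (p.1, N.farPower X L g (nu a ‖p.1‖) p.2))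
      hm.aemeasurable,
    lintegral_withDensity_eq_lintegral_mul _ hv
      (g := fun x => ∫⁻ ω, H (x, N.farPower X L g (nu a ‖x‖) ω) ∂P) hm.lintegral_prod_right']
  rfl

lemma palmMixture_prod_univ_lt_top (a : Association) {A : Set Plane} (hA : MeasurableSet A)
    (hb : Bornology.IsBounded A) : N.palmMixture P X L g a (A ×ˢ univ) < ⊤ := by
  rw [← lintegral_indicator_one (hA.prod MeasurableSet.univ),
    hN.lintegral_palmMixture a (measurable_one.indicator (hA.prod MeasurableSet.univ))]
  calc ∫⁻ x, ENNReal.ofReal (N.lam * N.voidProb a ‖x‖) *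
        ∫⁻ ω, (A ×ˢ univ).indicator 1 (x, N.farPower X L g (nu a ‖x‖) ω) ∂P
      ≤ ∫⁻ x, A.indicator (fun _ => ENNReal.ofReal N.lam) x := by
        refine lintegral_mono fun x => ?_
        by_cases hx : x ∈ A
        · simp only [hx, indicator, mem_prod, mem_univ, and_self, if_true, Pi.one_apply,
            lintegral_one, measure_univ, mul_one]
          refine ENNReal.ofReal_le_ofReal ?_
          exact mul_le_of_le_one_right N.lam_pos.le (N.voidProb_le_one a _)
        · simp [hx, indicator]
    _ = ENNReal.ofReal N.lam * volume A := lintegral_indicator_const hA _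
    _ < ⊤ := ENNReal.mul_lt_top ENNReal.ofReal_lt_top hb.measure_lt_top

/-- Under the Campbell measure, the interference seen by a base station at `x` is distributed as
the power received from outside the disc of radius `nu a ‖x‖`. -/
theorem campbell_eq_palmMixture (a : Association) :
    N.campbell P X L g a = N.palmMixture P X L g a := by
  -- the Laplace transforms over a bounded set of positions agree
  have hlap : ∀ A, MeasurableSet A → Bornology.IsBounded A → ∀ n : ℕ,
      ∫⁻ p, A.indicator 1 p.1 * expNeg (n * p.2) ∂N.campbell P X L g a =
        ∫⁻ p, A.indicator 1 p.1 * expNeg (n * p.2) ∂N.palmMixture P X L g a := by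
    intro A hA hb n
    have hH : Measurable fun p : Plane × ℝ≥0∞ => A.indicator 1 p.1 * expNeg (n * p.2) :=
      ((measurable_one.indicator hA).comp measurable_fst).mul
        (measurable_expNeg.comp (measurable_snd.const_mul _))
    have hn : ENNReal.ofReal n = n := ENNReal.ofReal_natCast n
    have h1 := hN.lintegral_tsum_weight_expNeg n.cast_nonneg a hA hb
    rw [hN.lintegral_campbell a hH, hN.lintegral_palmMixture a hH]
    simp only [hn] at h1
    simp only [mul_left_comm (weight X a _ _)]
    rw [h1, ← lintegral_indicator hA]
    refine lintegral_congr fun x => ?_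
    by_cases hx : x ∈ A
    · simp only [hx, indicator_of_mem, Pi.one_apply, one_mul]
      rw [← hn, hN.lintegral_expNeg_farPower n.cast_nonneg a (norm_nonneg x),
        ENNReal.ofReal_mul N.lam_pos.le, mul_assoc]
    · simp [hx]
  have hfin : ∀ A, MeasurableSet A → Bornology.IsBounded A →
      N.campbell P X L g a (A ×ˢ univ) = N.palmMixture P X L g a (A ×ˢ univ) := by
    intro A hA hb
    have h := hlap A hA hb 0
    have e : ∀ p : Plane × ℝ≥0∞, A.indicator 1 p.1 * expNeg ((0 : ℕ) * p.2) =
        (A ×ˢ univ).indicator (1 : Plane × ℝ≥0∞ → ℝ≥0∞) p := by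
      intro p
      by_cases hp : p.1 ∈ A <;> simp [indicator, hp]
    simp only [e] at h
    rwa [lintegral_indicator_one (hA.prod MeasurableSet.univ),
      lintegral_indicator_one (hA.prod MeasurableSet.univ)] at h
  have hrect : ∀ A, MeasurableSet A → Bornology.IsBounded A → ∀ C, MeasurableSet C →
      N.campbell P X L g a (A ×ˢ C) = N.palmMixture P X L g a (A ×ˢ C) := by
    intro A hA hb C hC
    have hAu : MeasurableSet (A ×ˢ (univ : Set ℝ≥0∞)) := hA.prod MeasurableSet.univ
    have hf2 := hN.palmMixture_prod_univ_lt_top a hA hb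
    have : IsFiniteMeasure
        (((N.campbell P X L g a).restrict (A ×ˢ univ)).map Prod.snd) := by
      refine ⟨?_⟩
      rw [Measure.map_apply measurable_snd MeasurableSet.univ, preimage_univ,
        Measure.restrict_apply_univ, hfin A hA hb]
      exact hf2
    have : IsFiniteMeasure
        (((N.palmMixture P X L g a).restrict (A ×ˢ univ)).map Prod.snd) := by
      refine ⟨?_⟩
      rw [Measure.map_apply measurable_snd MeasurableSet.univ, preimage_univ,
        Measure.restrict_apply_univ]
      exact hf2
    have hconv : ∀ (μ : Measure (Plane × ℝ≥0∞)) (n : ℕ),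
        ∫⁻ t, expNeg (n * t) ∂((μ.restrict (A ×ˢ univ)).map Prod.snd) =
          ∫⁻ p, A.indicator 1 p.1 * expNeg (n * p.2) ∂μ := by
      intro μ n
      rw [lintegral_map (f := fun t : ℝ≥0∞ => expNeg (n * t))
          (measurable_expNeg.comp (measurable_id.const_mul _)) measurable_snd,
        ← lintegral_indicator hAu]
      refine lintegral_congr fun p => ?_
      by_cases hp : p.1 ∈ A <;> simp [indicator, hp]
    have h := ext_of_lintegral_expNeg
      (μ := ((N.campbell P X L g a).restrict (A ×ˢ univ)).map Prod.snd)
      (ν := ((N.palmMixture P X L g a).restrict (A ×ˢ univ)).map Prod.snd)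
      fun n => by rw [hconv, hconv, hlap A hA hb n]
    have h2 := congr_arg (fun μ => μ C) h
    simp only [Measure.map_apply measurable_snd hC,
      Measure.restrict_apply (measurable_snd hC)] at h2
    have e : (Prod.snd ⁻¹' C ∩ A ×ˢ univ : Set (Plane × ℝ≥0∞)) = A ×ˢ C := by
      ext p
      simp [and_comm]
    rwa [e] at h2
  have hcover : ⋃ n : ℕ, Metric.ball (0 : Plane) n ×ˢ (univ : Set ℝ≥0∞) = univ := by
    rw [← iUnion_prod_const, Metric.iUnion_ball_nat, univ_prod_univ]
  refine (Measure.ext_iff_of_iUnion_eq_univ hcover).2 fun n => ?_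
  have hball : Bornology.IsBounded (Metric.ball (0 : Plane) n) := Metric.isBounded_ball
  have : IsFiniteMeasure ((N.campbell P X L g a).restrict
      (Metric.ball (0 : Plane) n ×ˢ (univ : Set ℝ≥0∞))) := by
    refine ⟨?_⟩
    rw [Measure.restrict_apply_univ, hfin _ measurableSet_ball hball]
    exact hN.palmMixture_prod_univ_lt_top a measurableSet_ball hball
  refine ext_of_generate_finite _ generateFrom_prod.symm isPiSystem_prod ?_ ?_
  · rintro _ ⟨A, hA, C, hC, rfl⟩
    have hA' : MeasurableSet A := hA
    have hC' : MeasurableSet C := hC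
    rw [Measure.restrict_apply (hA'.prod hC'), Measure.restrict_apply (hA'.prod hC'),
      prod_inter_prod, inter_univ]
    exact hrect _ (hA'.inter measurableSet_ball) (hball.subset inter_subset_right) C hC'
  · rw [Measure.restrict_apply_univ, Measure.restrict_apply_univ]
    exact hfin _ measurableSet_ball hball

/-- The mean of a functional of the possible serving base stations and of the interference. -/
theorem lintegral_tsum_weight (a : Association) {H : Plane × ℝ≥0∞ → ℝ≥0∞} (hH : Measurable H) :
    ∫⁻ ω, ∑' i, weight X a i ω * H (X i ω, N.interference X L g i ω) ∂P =
      ∫⁻ x, ENNReal.ofReal (N.lam * N.voidProb a ‖x‖) *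
        ∫⁻ ω, H (x, N.farPower X L g (nu a ‖x‖) ω) ∂P := by
  rw [← hN.lintegral_campbell a hH, hN.campbell_eq_palmMixture a, hN.lintegral_palmMixture a hH]

end IsNetwork

/-! ### The conditional coverage probability -/

lemma servingDensity_nonneg (N : Params) (a : Association) {r : ℝ} (hr : 0 ≤ r) :
    0 ≤ N.servingDensity a r := by
  rw [servingDensity_eq]
  have := N.lam_pos
  have := N.voidProb_pos a r
  have := Real.pi_pos
  positivity

lemma measurable_servingDensity (N : Params) (a : Association) :
    Measurable (N.servingDensity a) := by
  cases a
  · unfold servingDensity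
    fun_prop
  · unfold servingDensity
    fun_prop

lemma laplace_nonneg (N : Params) (a : Association) (r s : ℝ) : 0 ≤ N.laplace a r s :=
  mul_nonneg (Real.exp_pos _).le (Real.exp_pos _).le

/-- The probability that the power received from a base station at distance `r` exceeds `θ` times
an interference of value `y`. -/
def coverageGiven (N : Params) (θ r y : ℝ) : ℝ :=
  N.pLOS r * erlangTail N.m (N.m * θ / N.ellLOS r * y) +
    (1 - N.pLOS r) * Real.exp (-(θ / N.ellNLOS r * y))

lemma measurable_coverageGiven (N : Params) (θ : ℝ) :
    Measurable fun p : ℝ × ℝ => N.coverageGiven θ p.1 p.2 := by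
  have h1 := N.measurable_pLOS
  have h2 := (continuous_erlangTail N.m).measurable
  have h3 := N.measurable_ellLOS
  have h4 := N.measurable_ellNLOS
  unfold coverageGiven
  fun_prop

lemma coverageGiven_nonneg (N : Params) {θ r y : ℝ} (hθ : 0 ≤ θ) (hr : 0 ≤ r) (hy : 0 ≤ y) :
    0 ≤ N.coverageGiven θ r y := by
  obtain ⟨h0, h1⟩ := N.pLOS_mem r hr
  have h2 := N.ellLOS_nonneg r
  have h3 := erlangTail_nonneg N.m (x := N.m * θ / N.ellLOS r * y) (by positivity)
  have h4 := mul_nonneg (sub_nonneg.2 h1) (Real.exp_pos (-(θ / N.ellNLOS r * y))).le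
  unfold coverageGiven
  positivity

/-- Given its position and the interference, the probability that a base station covers the
user. -/
lemma markKernel_sir (N : Params) {θ : ℝ} (hθ : 0 < θ) {x : Plane} (hx : 0 < ‖x‖) {I : ℝ≥0∞}
    (hI0 : I ≠ 0) (hI : I ≠ ⊤) :
    N.markKernel x {z | ENNReal.ofReal θ < N.power x z / I} =
      ENNReal.ofReal (N.coverageGiven θ ‖x‖ I.toReal) := by
  have hm := N.m_pos
  obtain ⟨h0, h1⟩ := N.pLOS_mem ‖x‖ (norm_nonneg x)
  have hLOS := N.ellLOS_pos hx
  have hNLOS := N.ellNLOS_pos hx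
  have hI' : 0 ≤ I.toReal := ENNReal.toReal_nonneg
  have hA : MeasurableSet {z | ENNReal.ofReal θ < N.power x z / I} :=
    measurableSet_lt measurable_const
      ((N.measurable_power.comp (measurable_prodMk_left (x := x))).div_const I)
  have hset : ∀ (ℓ : ℝ), 0 < ℓ → ∀ γ : ℝ,
      (ENNReal.ofReal θ < ENNReal.ofReal (γ * ℓ) / I ↔ γ ∈ Ioi (θ / ℓ * I.toReal)) := by
    intro ℓ hℓ γ
    rw [ENNReal.lt_div_iff_mul_lt (Or.inl hI0) (Or.inl hI)]
    conv_lhs => rw [← ENNReal.ofReal_toReal hI, ← ENNReal.ofReal_mul hθ.le]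
    rw [ENNReal.ofReal_lt_ofReal_iff_of_nonneg (by positivity), mem_Ioi, div_mul_eq_mul_div,
      div_lt_iff₀ hℓ]
  have hLset : ∀ γ, {z | ENNReal.ofReal θ < N.power x z / I}.indicator
      (1 : Bool × ℝ → ℝ≥0∞) (true, γ) = (Ioi (θ / N.ellLOS ‖x‖ * I.toReal)).indicator 1 γ := by
    intro γ
    have := hset _ hLOS γ
    simp only [indicator, mem_ofPred_eq, power, if_true, this, Pi.one_apply]
  have hNset : ∀ γ, {z | ENNReal.ofReal θ < N.power x z / I}.indicator
      (1 : Bool × ℝ → ℝ≥0∞) (false, γ) = (Ioi (θ / N.ellNLOS ‖x‖ * I.toReal)).indicator 1 γ := by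
    intro γ
    have := hset _ hNLOS γ
    simp only [indicator, mem_ofPred_eq, power, Bool.false_eq_true, if_false, this, Pi.one_apply]
  have hexp : gammaMeasure (1 : ℝ) 1 (Ioi (θ / N.ellNLOS ‖x‖ * I.toReal)) =
      ENNReal.ofReal (Real.exp (-(θ / N.ellNLOS ‖x‖ * I.toReal))) := by
    have := gammaMeasure_Ioi (m := 1) le_rfl one_pos
      (y := θ / N.ellNLOS ‖x‖ * I.toReal) (by positivity)
    rw [Nat.cast_one] at this
    rw [this]
    simp [erlangTail]
  have h3 := erlangTail_nonneg N.m (x := N.m * θ / N.ellLOS ‖x‖ * I.toReal) (by positivity)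
  have e : N.m * (θ / N.ellLOS ‖x‖ * I.toReal) = N.m * θ / N.ellLOS ‖x‖ * I.toReal := by ring
  rw [markKernel_apply, ← lintegral_indicator_one hA,
    N.lintegral_markLaw x (measurable_one.indicator hA), lintegral_congr hLset,
    lintegral_congr hNset, lintegral_indicator_one measurableSet_Ioi,
    lintegral_indicator_one measurableSet_Ioi, gammaMeasure_Ioi N.one_le_m hm (by positivity),
    expMeasure, hexp, ← ENNReal.ofReal_mul h0, ← ENNReal.ofReal_mul (by linarith),
    ← ENNReal.ofReal_add _ (mul_nonneg (by linarith) (Real.exp_pos _).le), coverageGiven]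
  · rw [e]
  · rw [e]
    exact mul_nonneg h0 h3

namespace IsNetwork

variable (hN : N.IsNetwork P X L g)
include hN

/-! ### Means over the possible serving base stations -/

/-- The mean of a functional of the serving distance and of the interference. -/
theorem lintegral_tsum_weight_norm (a : Association) {H : ℝ × ℝ≥0∞ → ℝ≥0∞} (hH : Measurable H) :
    ∫⁻ ω, ∑' i, weight X a i ω * H (‖X i ω‖, N.interference X L g i ω) ∂P =
      ∫⁻ r in Ioi 0, ENNReal.ofReal (N.servingDensity a r) *
        ∫⁻ ω, H (r, N.farPower X L g (nu a r) ω) ∂P := by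
  rw [hN.lintegral_tsum_weight a (H := fun p => H (‖p.1‖, p.2))
    (hH.comp (measurable_fst.norm.prodMk measurable_snd))]
  have hv : Measurable fun r => ENNReal.ofReal (N.lam * N.voidProb a r) :=
    ((N.measurable_voidProb a).const_mul _).ennreal_ofReal
  have hm : Measurable fun p : ℝ × Ω => H (p.1, N.farPower X L g (nu a p.1) p.2) :=
    hH.comp (measurable_fst.prodMk (hN.measurable_farPower.comp
      (((measurable_nu a).comp measurable_fst).prodMk measurable_snd)))
  rw [lintegral_comp_norm (f := fun r => ENNReal.ofReal (N.lam * N.voidProb a r) *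
    ∫⁻ ω, H (r, N.farPower X L g (nu a r) ω) ∂P) (hv.mul hm.lintegral_prod_right')]
  refine setLIntegral_congr_fun measurableSet_Ioi fun r hr => ?_
  have hr0 : 0 < r := hr
  rw [← mul_assoc, servingDensity_eq, mul_comm (N.lam * N.voidProb a r),
    ← ENNReal.ofReal_mul (by have := Real.pi_pos; positivity)]

/-- The Laplace transform of the interference together with the serving distance. -/
theorem lintegral_tsum_weight_exp (a : Association) (hs : 0 ≤ s) {B : Set ℝ}
    (hB : MeasurableSet B) :
    ∫⁻ ω, ∑' i, weight X a i ω * (B.indicator 1 ‖X i ω‖ *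
        ENNReal.ofReal (Real.exp (-(s * (N.interference X L g i ω).toReal)))) ∂P =
      ∫⁻ r in B ∩ Ioi 0, ENNReal.ofReal (N.laplace a r s * N.servingDensity a r) := by
  rw [hN.lintegral_tsum_weight_norm a (H := fun p => B.indicator 1 p.1 *
    ENNReal.ofReal (Real.exp (-(s * p.2.toReal))))
    (((measurable_one.indicator hB).comp measurable_fst).mul
      ((measurable_snd.ennreal_toReal.const_mul s).neg.exp.ennreal_ofReal)),
    ← setLIntegral_indicator hB]
  refine setLIntegral_congr_fun measurableSet_Ioi fun r hr => ?_
  have hr0 : 0 < r := hr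
  by_cases hrB : r ∈ B
  · simp only [hrB, indicator_of_mem, Pi.one_apply, one_mul]
    rw [hN.lintegral_exp_farPower hs a hr0.le, mul_comm (N.laplace a r s),
      ENNReal.ofReal_mul (N.servingDensity_nonneg a hr0.le)]
  · simp [hrB]

lemma integrable_erlangTail_farPower (m : ℕ) (hs : 0 ≤ s) (ρ : ℝ) :
    Integrable (fun ω => erlangTail m (s * (N.farPower X L g ρ ω).toReal)) P := by
  have hm := hN.measurable_farPower_toReal ρ
  -- the tail is at most the full exponential series times `exp (-x)`, which is `1`
  refine Integrable.of_bound (C := 1)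
    ((continuous_erlangTail m).measurable.comp (hm.const_mul s)).aestronglyMeasurable
    (Eventually.of_forall fun ω => ?_)
  have hx : 0 ≤ s * (N.farPower X L g ρ ω).toReal := mul_nonneg hs ENNReal.toReal_nonneg
  rw [Real.norm_of_nonneg (erlangTail_nonneg m hx), erlangTail, ← Finset.sum_mul, Real.exp_neg,
    ← div_eq_mul_inv, div_le_one (Real.exp_pos _)]
  exact Real.sum_le_exp_of_nonneg hx m

/-- The coverage integrand, without the density of the serving distance, is the mean over the
interference of the conditional coverage probability. -/
lemma lintegral_coverageGiven (a : Association) {θ r : ℝ} (hθ : 0 < θ) (hr : 0 < r) :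
    ∫⁻ ω, ENNReal.ofReal (N.coverageGiven θ r (N.farPower X L g (nu a r) ω).toReal) ∂P =
      ENNReal.ofReal (N.pLOS r * N.coverageLOS a θ r +
        (1 - N.pLOS r) * N.laplace a r (θ / N.ellNLOS r)) := by
  have hm := N.m_pos
  have hLOS := N.ellLOS_pos hr
  have hNLOS := N.ellNLOS_pos hr
  have hs1 : 0 < N.m * θ / N.ellLOS r := by positivity
  have hs2 : 0 < θ / N.ellNLOS r := by positivity
  have hi1 := (hN.integrable_erlangTail_farPower N.m hs1.le (nu a r)).const_mul (N.pLOS r)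
  have hi2 : Integrable (fun ω => (1 - N.pLOS r) *
      Real.exp (-(θ / N.ellNLOS r * (N.farPower X L g (nu a r) ω).toReal))) P := by
    have := (hN.integrable_exp_farPower (nu a r) (neg_nonpos.2 hs2.le)).const_mul (1 - N.pLOS r)
    simpa only [neg_mul] using this
  have hlap : ∫ ω, Real.exp (-(θ / N.ellNLOS r * (N.farPower X L g (nu a r) ω).toReal)) ∂P =
      N.laplace a r (θ / N.ellNLOS r) := by
    rw [hN.laplace_eq_mgf hs2.le a hr.le, mgf]
    simp only [neg_mul]
  rw [coverageLOS, hN.sum_iteratedDeriv_laplace hs1 a hr.le, ← hlap, ← integral_const_mul,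
    ← integral_const_mul, ← integral_add hi1 hi2, ofReal_integral_eq_lintegral_ofReal]
  · rfl
  · exact hi1.add hi2
  · exact Eventually.of_forall fun ω =>
      N.coverageGiven_nonneg hθ.le hr.le ENNReal.toReal_nonneg

omit [IsProbabilityMeasure P] in
lemma measurable_sir (i : ℕ) : Measurable (N.sir X L g i) :=
  (hN.measurable_rxPower i).div (hN.measurable_interference i)

/-- The mark of the base station `i` is integrated out: its interference does not involve it. -/
lemma lintegral_weight_sir (a : Association) {θ : ℝ} (hθ : 0 < θ) (i : ℕ) :
    ∫⁻ ω, weight X a i ω * {ω | ENNReal.ofReal θ < N.sir X L g i ω}.indicator 1 ω ∂P =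
      ∫⁻ ω, weight X a i ω *
        ENNReal.ofReal (N.coverageGiven θ ‖X i ω‖ (N.interference X L g i ω).toReal) ∂P := by
  set W : Set (ℕ → Plane) := {x | ∀ j, j ≠ i → nu a ‖x i‖ ≤ ‖x j‖} with hW
  set I : (ℕ → Plane) × (ℕ → Bool × ℝ) → ℝ≥0∞ := fun p =>
    ∑' j : {j : ℕ // j ≠ i}, N.power (p.1 j) (p.2 j) with hI
  have hpm : ∀ j, Measurable fun p : (ℕ → Plane) × (ℕ → Bool × ℝ) => N.power (p.1 j) (p.2 j) :=
    fun j => by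
      have hpair : Measurable fun p : (ℕ → Plane) × (ℕ → Bool × ℝ) => (p.1 j, p.2 j) := by
        fun_prop
      exact N.measurable_power.comp hpair
  have hIm : Measurable I := Measurable.tsum fun j => hpm j
  set E : Set ((ℕ → Plane) × (ℕ → Bool × ℝ)) :=
    {p | ENNReal.ofReal θ < N.power (p.1 i) (p.2 i) / I p} with hE
  have hEm : MeasurableSet E := measurableSet_lt measurable_const ((hpm i).div hIm)
  have h1 := hN.marking.lintegral_update hN.measurable_X i
    (F := fun p => W.indicator 1 p.1 * E.indicator 1 p)
    (((measurable_one.indicator (measurableSet_weight a i)).comp measurable_fst).mul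
      (measurable_one.indicator hEm))
  refine Eq.trans ?_ (h1.trans ?_)
  · rfl
  refine lintegral_congr_ae ?_
  filter_upwards [hN.ae_norm_pos, hN.ae_interference] with ω hω1 hω2
  have hIupd : ∀ z, I (fun j => X j ω, Function.update (fun j => (L j ω, g j ω)) i z) =
      N.interference X L g i ω := by
    intro z
    refine tsum_congr fun j => ?_
    simp only [Function.update_of_ne j.2]
    rfl
  have h2 : ∀ z, E.indicator (1 : (ℕ → Plane) × (ℕ → Bool × ℝ) → ℝ≥0∞)
      (fun j => X j ω, Function.update (fun j => (L j ω, g j ω)) i z) =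
      {z | ENNReal.ofReal θ < N.power (X i ω) z / N.interference X L g i ω}.indicator 1 z := by
    intro z
    have : (fun j => X j ω, Function.update (fun j => (L j ω, g j ω)) i z) ∈ E ↔
        z ∈ {z | ENNReal.ofReal θ < N.power (X i ω) z / N.interference X L g i ω} := by
      simp only [hE, mem_ofPred_eq, hIupd, Function.update_self]
    by_cases hz : z ∈ {z | ENNReal.ofReal θ < N.power (X i ω) z / N.interference X L g i ω}
    · rw [indicator_of_mem hz, indicator_of_mem (this.2 hz)]
      rfl
    · rw [indicator_of_notMem hz, indicator_of_notMem fun h => hz (this.1 h)]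
  have hAm : MeasurableSet
      {z | ENNReal.ofReal θ < N.power (X i ω) z / N.interference X L g i ω} :=
    measurableSet_lt measurable_const
      ((N.measurable_power.comp (measurable_prodMk_left (x := X i ω))).div_const _)
  simp only [h2]
  rw [lintegral_const_mul _ (measurable_one.indicator hAm), lintegral_indicator_one hAm,
    N.markKernel_sir hθ (hω1 i) (hω2 i).1.ne' (hω2 i).2.ne]
  rfl

/-- The mean number of possible serving base stations that cover the user. -/
theorem lintegral_tsum_weight_sir (a : Association) {θ : ℝ} (hθ : 0 < θ) :
    ∫⁻ ω, ∑' i, weight X a i ω *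
        {ω | ENNReal.ofReal θ < N.sir X L g i ω}.indicator 1 ω ∂P =
      ∫⁻ r in Ioi 0, ENNReal.ofReal (N.coverageIntegrand a θ r) := by
  have hc : ∀ i, Measurable fun ω => ENNReal.ofReal
      (N.coverageGiven θ ‖X i ω‖ (N.interference X L g i ω).toReal) := fun i =>
    ((N.measurable_coverageGiven θ).comp ((hN.measurable_X i).norm.prodMk
      (hN.measurable_interference i).ennreal_toReal)).ennreal_ofReal
  have hS : ∀ i, MeasurableSet {ω | ENNReal.ofReal θ < N.sir X L g i ω} := fun i =>
    measurableSet_lt measurable_const (hN.measurable_sir i)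
  rw [lintegral_tsum (f := fun i ω => weight X a i ω *
    {ω | ENNReal.ofReal θ < N.sir X L g i ω}.indicator 1 ω) fun i =>
      ((hN.measurable_weight a i).mul (measurable_one.indicator (hS i))).aemeasurable]
  simp_rw [hN.lintegral_weight_sir a hθ]
  rw [← lintegral_tsum (f := fun i ω => weight X a i ω * ENNReal.ofReal
      (N.coverageGiven θ ‖X i ω‖ (N.interference X L g i ω).toReal)) fun i =>
    ((hN.measurable_weight a i).mul (hc i)).aemeasurable]
  rw [hN.lintegral_tsum_weight_norm a
    (H := fun p => ENNReal.ofReal (N.coverageGiven θ p.1 p.2.toReal))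
    ((N.measurable_coverageGiven θ).comp
      (measurable_fst.prodMk measurable_snd.ennreal_toReal)).ennreal_ofReal]
  refine setLIntegral_congr_fun measurableSet_Ioi fun r hr => ?_
  have hr0 : 0 < r := hr
  rw [hN.lintegral_coverageGiven a hθ hr0, coverageIntegrand, mul_comm _ (N.servingDensity a r),
    ENNReal.ofReal_mul (N.servingDensity_nonneg a hr0.le)]

/-! ### Integrability of the coverage integrand -/

lemma coverageLOS_nonneg (a : Association) {θ r : ℝ} (hθ : 0 < θ) (hr : 0 < r) :
    0 ≤ N.coverageLOS a θ r := by
  have hs : 0 < N.m * θ / N.ellLOS r := div_pos (mul_pos N.m_pos hθ) (N.ellLOS_pos hr)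
  rw [coverageLOS, hN.sum_iteratedDeriv_laplace hs a hr.le]
  exact integral_nonneg fun ω => erlangTail_nonneg _ (mul_nonneg hs.le ENNReal.toReal_nonneg)

lemma coverageIntegrand_nonneg (a : Association) {θ r : ℝ} (hθ : 0 < θ) (hr : 0 < r) :
    0 ≤ N.coverageIntegrand a θ r := by
  obtain ⟨h0, h1⟩ := N.pLOS_mem r hr.le
  have h2 := hN.coverageLOS_nonneg a hθ hr
  have h3 := N.laplace_nonneg a r (θ / N.ellNLOS r)
  have h4 := mul_nonneg (sub_nonneg.2 h1) h3
  exact mul_nonneg (add_nonneg (mul_nonneg h0 h2) h4) (N.servingDensity_nonneg a hr.le)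

lemma aestronglyMeasurable_coverageIntegrand (a : Association) {θ : ℝ} (hθ : 0 < θ) :
    AEStronglyMeasurable (N.coverageIntegrand a θ) (volume.restrict (Ioi 0)) := by
  have hm : Measurable fun p : ℝ × Ω => ENNReal.ofReal
      (N.coverageGiven θ p.1 (N.farPower X L g (nu a p.1) p.2).toReal) :=
    ((N.measurable_coverageGiven θ).comp (measurable_fst.prodMk (hN.measurable_farPower.comp
      (((measurable_nu a).comp measurable_fst).prodMk
        measurable_snd)).ennreal_toReal)).ennreal_ofReal
  have hm2 : Measurable fun r : ℝ => (∫⁻ ω, ENNReal.ofReal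
      (N.coverageGiven θ r (N.farPower X L g (nu a r) ω).toReal) ∂P).toReal *
        N.servingDensity a r :=
    (hm.lintegral_prod_right' (ν := P)).ennreal_toReal.mul (N.measurable_servingDensity a)
  refine hm2.aestronglyMeasurable.congr ?_
  filter_upwards [ae_restrict_mem measurableSet_Ioi] with r hr
  have hr0 : 0 < r := hr
  obtain ⟨h0, h1⟩ := N.pLOS_mem r hr0.le
  have h2 := hN.coverageLOS_nonneg a hθ hr0
  have h4 := mul_nonneg (sub_nonneg.2 h1) (N.laplace_nonneg a r (θ / N.ellNLOS r))
  rw [hN.lintegral_coverageGiven a hθ hr0,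
    ENNReal.toReal_ofReal (add_nonneg (mul_nonneg h0 h2) h4), coverageIntegrand]

/-- The number of base stations whose SIR exceeds `θ` is at most `(1 + θ) / θ`: each of them
contributes more than the fraction `θ / (1 + θ)` of the total power. -/
lemma ae_tsum_sir_le {θ : ℝ} (hθ : 0 < θ) :
    ∀ᵐ ω ∂P, ∑' i, {ω | ENNReal.ofReal θ < N.sir X L g i ω}.indicator (1 : Ω → ℝ≥0∞) ω ≤
      (1 + ENNReal.ofReal θ) / ENNReal.ofReal θ := by
  filter_upwards [hN.ae_regular, hN.ae_interference] with ω hω hI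
  obtain ⟨-, h2, -, h4⟩ := hω
  set S := ∑' i, N.rxPower X L g i ω with hS
  set t := ENNReal.ofReal θ with ht
  have ht0 : t ≠ 0 := (ENNReal.ofReal_pos.2 hθ).ne'
  have htt : t ≠ ⊤ := ENNReal.ofReal_ne_top
  have hS0 : S ≠ 0 := ((h2 0).trans_le (ENNReal.le_tsum 0)).ne'
  have hsum : ∀ i, S = N.rxPower X L g i ω + N.interference X L g i ω := by
    intro i
    rw [interference_eq_tsum, hS, ENNReal.tsum_eq_add_tsum_ite i]
    exact congrArg _ (tsum_congr fun j => by split_ifs <;> rfl)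
  have h1 : ∀ i, {ω | t < N.sir X L g i ω}.indicator (1 : Ω → ℝ≥0∞) ω * (t * S) ≤
      (1 + t) * N.rxPower X L g i ω := by
    intro i
    by_cases hi : t < N.sir X L g i ω
    · rw [indicator_of_mem (show ω ∈ {ω | t < N.sir X L g i ω} from hi), Pi.one_apply, one_mul,
        hsum i, mul_add, add_mul, one_mul, add_comm]
      rw [sir, ENNReal.lt_div_iff_mul_lt (Or.inl (hI i).1.ne') (Or.inl (hI i).2.ne)] at hi
      gcongr
    · rw [indicator_of_notMem (show ω ∉ {ω | t < N.sir X L g i ω} from hi), zero_mul]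
      exact zero_le
  have h3 := ENNReal.tsum_le_tsum h1
  rw [ENNReal.tsum_mul_right, ENNReal.tsum_mul_left, ← mul_assoc] at h3
  rw [ENNReal.le_div_iff_mul_le (Or.inl ht0) (Or.inl htt)]
  exact (ENNReal.mul_le_mul_iff_left hS0 h4.ne).1 h3

/-- The mean number of closest base stations is one. -/
lemma lintegral_tsum_weight_closest : ∫⁻ ω, ∑' i, weight X .closest i ω ∂P = 1 := by
  have hlam := N.lam_pos
  have hpi := Real.pi_pos
  have h := hN.lintegral_tsum_weight_norm .closest (H := fun _ => 1) measurable_const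
  simp only [mul_one, lintegral_one, measure_univ] at h
  rw [h]
  have hd : ∀ r ∈ Ici (0 : ℝ), HasDerivAt (fun r => -Real.exp (-(Real.pi * N.lam * r ^ 2)))
      (N.servingDensity .closest r) r := by
    intro r _
    have h1 : HasDerivAt (fun r => -Real.exp (-(Real.pi * N.lam * r ^ 2))) _ r :=
      (((hasDerivAt_pow 2 r).const_mul (Real.pi * N.lam)).fun_neg.exp).fun_neg
    refine h1.congr_deriv ?_
    rw [servingDensity]
    push_cast
    ring
  have hlim : Tendsto (fun r : ℝ => -Real.exp (-(Real.pi * N.lam * r ^ 2))) atTop (𝓝 0) := by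
    rw [← neg_zero]
    refine Tendsto.neg (Real.tendsto_exp_neg_atTop_nhds_zero.comp ?_)
    exact (tendsto_pow_atTop two_ne_zero).const_mul_atTop (by positivity)
  have hpos : ∀ r ∈ Ioi (0 : ℝ), 0 ≤ N.servingDensity .closest r := fun r hr =>
    N.servingDensity_nonneg .closest (le_of_lt hr)
  have hint := integrableOn_Ioi_deriv_of_nonneg
    (hd 0 self_mem_Ici).continuousAt.continuousWithinAt
    (fun x hx => hd x (mem_Ici_of_Ioi hx)) hpos hlim
  rw [← ofReal_integral_eq_lintegral_ofReal hint
    ((ae_restrict_iff' measurableSet_Ioi).2 (Eventually.of_forall hpos)),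
    integral_Ioi_of_hasDerivAt_of_tendsto' hd hint hlim]
  simp

lemma lintegral_coverageIntegrand_lt_top (a : Association) {θ : ℝ} (hθ : 0 < θ) :
    ∫⁻ r in Ioi 0, ENNReal.ofReal (N.coverageIntegrand a θ r) < ⊤ := by
  rw [← hN.lintegral_tsum_weight_sir a hθ]
  cases a
  · refine lt_of_le_of_lt (lintegral_mono fun ω => ENNReal.tsum_le_tsum fun i => ?_)
      (hN.lintegral_tsum_weight_closest.trans_lt ENNReal.one_lt_top)
    exact mul_le_of_le_one_right' (indicator_le_self _ _ _)
  · simp only [weight_strongest, one_mul]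
    refine (lintegral_mono_ae (hN.ae_tsum_sir_le hθ)).trans_lt ?_
    rw [lintegral_const, measure_univ, mul_one]
    exact ENNReal.div_lt_top (by simp) (ENNReal.ofReal_pos.2 hθ).ne'

theorem integrableOn_coverageIntegrand (a : Association) {θ : ℝ} (hθ : 0 < θ) :
    IntegrableOn (N.coverageIntegrand a θ) (Ioi 0) := by
  refine ⟨hN.aestronglyMeasurable_coverageIntegrand a hθ, ?_⟩
  rw [hasFiniteIntegral_iff_ofReal ((ae_restrict_iff' measurableSet_Ioi).2
    (Eventually.of_forall fun r hr => hN.coverageIntegrand_nonneg a hθ hr))]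
  exact hN.lintegral_coverageIntegrand_lt_top a hθ

lemma ofReal_integral_coverageIntegrand (a : Association) {θ : ℝ} (hθ : 0 < θ) :
    ENNReal.ofReal (∫ r in Ioi 0, N.coverageIntegrand a θ r) =
      ∫⁻ r in Ioi 0, ENNReal.ofReal (N.coverageIntegrand a θ r) :=
  ofReal_integral_eq_lintegral_ofReal (hN.integrableOn_coverageIntegrand a hθ)
    ((ae_restrict_iff' measurableSet_Ioi).2
      (Eventually.of_forall fun _ hr => hN.coverageIntegrand_nonneg a hθ hr))

/-! ### The coverage probability -/

/-- Almost surely there is exactly one closest base station. -/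
lemma ae_existsUnique_closest : ∀ᵐ ω ∂P, ∃! i, IsClosest X i ω := by
  have hex : ∀ᵐ ω ∂P, ∃ i, IsClosest X i ω := by
    filter_upwards [hN.ae_finite_near] with ω hω
    obtain ⟨i, hi, hmin⟩ := Set.exists_min_image {i | ‖X i ω‖ < ‖X 0 ω‖ + 1} (fun i => ‖X i ω‖)
      (hω _) ⟨0, lt_add_one ‖X 0 ω‖⟩
    refine ⟨i, fun j => ?_⟩
    by_cases hj : ‖X j ω‖ < ‖X 0 ω‖ + 1
    · exact hmin j hj
    · exact (le_of_lt hi).trans (not_lt.1 hj)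
  have hge : ∀ᵐ ω ∂P, 1 ≤ ∑' i, weight X .closest i ω := by
    filter_upwards [hex] with ω ⟨i, hi⟩
    refine le_of_eq_of_le ?_ (ENNReal.le_tsum i)
    rw [weight_closest, indicator_of_mem (show ω ∈ {ω | IsClosest X i ω} from hi)]
    rfl
  -- the number of closest base stations is at least one and has mean one
  have hone := ae_eq_of_ae_le_of_lintegral_le (μ := P) (f := fun _ => 1)
    (g := fun ω => ∑' i, weight X .closest i ω) hge (by simp)
    (Measurable.tsum fun i => hN.measurable_weight .closest i).aemeasurable
    (by rw [hN.lintegral_tsum_weight_closest]; simp)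
  filter_upwards [hex, hone] with ω ⟨i, hi⟩ h1
  refine ⟨i, hi, fun j hj => ?_⟩
  by_contra hne
  have h2 : ∑ k ∈ {i, j}, weight X .closest k ω ≤ ∑' k, weight X .closest k ω :=
    ENNReal.sum_le_tsum _
  rw [← h1, Finset.sum_pair (Ne.symm hne), weight_closest, weight_closest,
    indicator_of_mem (show ω ∈ {ω | IsClosest X i ω} from hi),
    indicator_of_mem (show ω ∈ {ω | IsClosest X j ω} from hj)] at h2
  simp only [Pi.one_apply] at h2
  norm_num at h2

omit [IsProbabilityMeasure P] in
lemma measurableSet_serving (a : Association) (i : ℕ) :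
    MeasurableSet {ω | N.IsServing X L g i ω a} := by
  cases a
  · have : {ω | N.IsServing X L g i ω .closest} = ⋂ j, {ω | ‖X i ω‖ ≤ ‖X j ω‖} := by
      ext ω
      simp [IsServing, IsClosest]
    rw [this]
    exact MeasurableSet.iInter fun j =>
      measurableSet_le (hN.measurable_X i).norm (hN.measurable_X j).norm
  · have : {ω | N.IsServing X L g i ω .strongest} =
        ⋂ j, {ω | N.sir X L g j ω ≤ N.sir X L g i ω} := by
      ext ω
      simp [IsServing]
    rw [this]
    exact MeasurableSet.iInter fun j =>
      measurableSet_le (hN.measurable_sir j) (hN.measurable_sir i)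

/-- The coverage formula holds as soon as the number of possible serving base stations that cover
the user is a.s. the indicator of coverage. -/
lemma coverage_eq_of_ae (a : Association) {θ : ℝ} (hθ : 0 < θ)
    (h : ∀ᵐ ω ∂P, ∑' i, weight X a i ω *
        {ω | ENNReal.ofReal θ < N.sir X L g i ω}.indicator 1 ω =
      {ω | ∃ i, N.IsServing X L g i ω a ∧ ENNReal.ofReal θ < N.sir X L g i ω}.indicator 1 ω) :
    N.coverage X L g P a θ = ∫ r in Ioi (0 : ℝ), N.coverageIntegrand a θ r := by
  have hE : MeasurableSet
      {ω | ∃ i, N.IsServing X L g i ω a ∧ ENNReal.ofReal θ < N.sir X L g i ω} := by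
    have : {ω | ∃ i, N.IsServing X L g i ω a ∧ ENNReal.ofReal θ < N.sir X L g i ω} =
        ⋃ i, {ω | N.IsServing X L g i ω a} ∩ {ω | ENNReal.ofReal θ < N.sir X L g i ω} := by
      ext ω
      simp
    rw [this]
    exact MeasurableSet.iUnion fun i => (hN.measurableSet_serving a i).inter
      (measurableSet_lt measurable_const (hN.measurable_sir i))
  have h0 : 0 ≤ ∫ r in Ioi (0 : ℝ), N.coverageIntegrand a θ r :=
    setIntegral_nonneg measurableSet_Ioi fun r hr => hN.coverageIntegrand_nonneg a hθ hr
  rw [coverage, Measure.real, ← lintegral_indicator_one hE, ← lintegral_congr_ae h,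
    hN.lintegral_tsum_weight_sir a hθ, ← hN.ofReal_integral_coverageIntegrand a hθ,
    ENNReal.toReal_ofReal h0]

theorem coverage_closest {θ : ℝ} (hθ : 0 < θ) :
    N.coverage X L g P .closest θ = ∫ r in Ioi (0 : ℝ), N.coverageIntegrand .closest θ r := by
  refine hN.coverage_eq_of_ae .closest hθ ?_
  filter_upwards [hN.ae_existsUnique_closest] with ω ⟨i, hi, huniq⟩
  have hi' : IsClosest X i ω := hi
  rw [tsum_eq_single i fun j hj => ?_, weight_closest,
    indicator_of_mem (show ω ∈ {ω | IsClosest X i ω} from hi), Pi.one_apply, one_mul]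
  · by_cases hs : ENNReal.ofReal θ < N.sir X L g i ω
    · rw [indicator_of_mem (show ω ∈ {ω | ENNReal.ofReal θ < N.sir X L g i ω} from hs),
        indicator_of_mem]
      exact ⟨i, hi', hs⟩
    · rw [indicator_of_notMem (show ω ∉ {ω | ENNReal.ofReal θ < N.sir X L g i ω} from hs),
        indicator_of_notMem]
      rintro ⟨j, hj, hjs⟩
      rw [huniq j hj] at hjs
      exact hs hjs
  · rw [weight_closest, indicator_of_notMem, zero_mul]
    exact fun h => hj (huniq j h)

/-- If `θ ≥ 1`, a base station whose SIR exceeds `θ` is the only one, and has the largest SIR. -/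
theorem coverage_strongest {θ : ℝ} (hθ : 1 ≤ θ) :
    N.coverage X L g P .strongest θ =
      ∫ r in Ioi (0 : ℝ), N.coverageIntegrand .strongest θ r := by
  refine hN.coverage_eq_of_ae .strongest (one_pos.trans_le hθ) ?_
  have hθ' : 1 ≤ ENNReal.ofReal θ := by
    rw [← ENNReal.ofReal_one]
    exact ENNReal.ofReal_le_ofReal hθ
  filter_upwards [hN.ae_interference] with ω hI
  simp only [weight_strongest, one_mul]
  have hle : ∀ i j, j ≠ i → N.rxPower X L g j ω ≤ N.interference X L g i ω := fun i j hj =>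
    ENNReal.le_tsum (f := fun j : {j // j ≠ i} => N.rxPower X L g j ω) ⟨j, hj⟩
  have hdom : ∀ i, ENNReal.ofReal θ < N.sir X L g i ω → ∀ j, j ≠ i → N.sir X L g j ω ≤ 1 := by
    intro i hi j hj
    have h1 : 1 < N.sir X L g i ω := hθ'.trans_lt hi
    rw [sir, ENNReal.lt_div_iff_mul_lt (Or.inl (hI i).1.ne') (Or.inl (hI i).2.ne), one_mul] at h1
    refine ENNReal.div_le_of_le_mul ?_
    rw [one_mul]
    exact (hle i j hj).trans (h1.le.trans (hle j i hj.symm))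
  by_cases hex : ∃ i, ENNReal.ofReal θ < N.sir X L g i ω
  · obtain ⟨i, hi⟩ := hex
    rw [tsum_eq_single i fun j hj => ?_,
      indicator_of_mem (show ω ∈ {ω | ENNReal.ofReal θ < N.sir X L g i ω} from hi),
      indicator_of_mem]
    · refine ⟨i, fun j => ?_, hi⟩
      rcases eq_or_ne j i with rfl | hj
      · exact le_rfl
      · exact (hdom i hi j hj).trans (hθ'.trans hi.le)
    · exact indicator_of_notMem
        (s := {ω | ENNReal.ofReal θ < N.sir X L g j ω})
        (fun h => absurd (hθ'.trans_lt h) (hdom i hi j hj).not_gt) _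
  · rw [indicator_of_notMem fun h => hex ⟨h.choose, h.choose_spec.2⟩,
      ENNReal.tsum_eq_zero.2 fun i => ?_]
    exact indicator_of_notMem (s := {ω | ENNReal.ofReal θ < N.sir X L g i ω})
      (fun h => hex ⟨i, h⟩) _

end IsNetwork

end Params

end Network

end CellularNetwork

end

theorem mainTheorem1 {Ω : Type*} [MeasurableSpace Ω] (P : Measure Ω) [IsProbabilityMeasure P]
    (N : CellularNetwork.Params) (X : ℕ → Ω → CellularNetwork.Plane) (L : ℕ → Ω → Bool)
    (g : ℕ → Ω → ℝ) (hN : N.IsNetwork P X L g) :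
    -- the coverage formula
    (∀ (a : CellularNetwork.Association) (θ : ℝ), 0 < θ →
      (a = CellularNetwork.Association.strongest → 1 ≤ θ) →
      N.coverage X L g P a θ = ∫ r in Ioi (0 : ℝ), N.coverageIntegrand a θ r) ∧
    -- for strongest association and every threshold, the same integral is the mean number of
    -- base stations whose SIR exceeds the threshold
    (∀ θ : ℝ, 0 < θ →
      ∫⁻ ω, ∑' i, {ω | ENNReal.ofReal θ < N.sir X L g i ω}.indicator 1 ω ∂P =
        ENNReal.ofReal (∫ r in Ioi (0 : ℝ),
          N.coverageIntegrand CellularNetwork.Association.strongest θ r)) ∧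
    -- `L_I` is the Laplace transform of the interference, given that the serving base station is
    -- at distance `r`: closest association
    (∀ s : ℝ, 0 ≤ s → ∀ B : Set ℝ, MeasurableSet B →
      ∫⁻ ω, ∑' i, {ω | CellularNetwork.Params.IsClosest X i ω ∧ ‖X i ω‖ ∈ B}.indicator
          (fun ω => ENNReal.ofReal (Real.exp (-(s * (N.interference X L g i ω).toReal)))) ω ∂P =
        ∫⁻ r in B ∩ Ioi 0,
          ENNReal.ofReal (N.laplace CellularNetwork.Association.closest r s *
            N.servingDensity CellularNetwork.Association.closest r)) ∧
    -- strongest association: every base station is a possible serving one, and the mean is taken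
    -- under the (reduced) Palm distribution, that is through the Campbell measure
    (∀ s : ℝ, 0 ≤ s → ∀ B : Set ℝ, MeasurableSet B →
      ∫⁻ ω, ∑' i, {ω | ‖X i ω‖ ∈ B}.indicator
          (fun ω => ENNReal.ofReal (Real.exp (-(s * (N.interference X L g i ω).toReal)))) ω ∂P =
        ∫⁻ r in B ∩ Ioi 0,
          ENNReal.ofReal (N.laplace CellularNetwork.Association.strongest r s *
            N.servingDensity CellularNetwork.Association.strongest r)) ∧
    -- all the quantities above are well defined
    (∀ᵐ ω ∂P, ∀ i, 0 < N.interference X L g i ω ∧ N.interference X L g i ω < ⊤) ∧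
    (∀ (a : CellularNetwork.Association) (r : ℝ), 0 < r →
      (∀ s : ℝ, 0 ≤ s →
        IntegrableOn (N.kernelNLOS s) (Ioi (CellularNetwork.Params.nu a r)) ∧
        IntegrableOn (N.kernelCorrection s) (Ioi (CellularNetwork.Params.nu a r))) ∧
      ContDiffOn ℝ (⊤ : ℕ∞) (N.laplace a r) (Ioi 0)) ∧
    (∀ (a : CellularNetwork.Association) (θ : ℝ), 0 < θ →
      IntegrableOn (N.coverageIntegrand a θ) (Ioi 0)) := by
  refine ⟨fun a θ hθ h1 => ?_, fun θ hθ => ?_, fun s hs B hB => ?_, fun s hs B hB => ?_,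
    hN.ae_interference, fun a r hr => ⟨fun s hs => ?_, hN.contDiffOn_laplace a hr.le⟩,
    fun a θ hθ => hN.integrableOn_coverageIntegrand a hθ⟩
  · cases a
    · exact hN.coverage_closest hθ
    · exact hN.coverage_strongest (h1 rfl)
  · rw [hN.ofReal_integral_coverageIntegrand _ hθ, ← hN.lintegral_tsum_weight_sir _ hθ]
    simp only [CellularNetwork.Params.weight_strongest, one_mul]
  · rw [← hN.lintegral_tsum_weight_exp _ hs hB]
    refine lintegral_congr fun ω => tsum_congr fun i => ?_
    rw [CellularNetwork.Params.weight_closest]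
    by_cases h1 : CellularNetwork.Params.IsClosest X i ω <;> by_cases h2 : ‖X i ω‖ ∈ B <;>
      simp [indicator, h1, h2]
  · rw [← hN.lintegral_tsum_weight_exp _ hs hB]
    refine lintegral_congr fun ω => tsum_congr fun i => ?_
    rw [CellularNetwork.Params.weight_strongest]
    by_cases h2 : ‖X i ω‖ ∈ B <;> simp [indicator, h2]
  · have hsub := Ioi_subset_Ioi (CellularNetwork.Params.nu_nonneg a hr.le)
    exact ⟨(N.integrableOn_kernelNLOS hs).mono_set hsub,
      (N.integrableOn_kernelCorrection hs).mono_set hsub⟩
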